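/- All graphs are finite undirected multigraphs: parallel edges and loops are allowed, a loop is a cycle of length $1$, and two parallel edges form a cycle of length $2$. A forest is a graph without cycles. For an integer $r\ge 0$, an $r$-pseudoforest is a graph in which each connected component can be made into a forest by deleting at most $r$ edges. An $r$-pseudoforest deletion set of a graph $G=(V,E)$ is a set $X\subseteq V$ such that $G-X$ is an $r$-pseudoforest. The problem $r$-Pseudoforest Deletion asks, given a graph $G$ and integers $k,r\ge 0$, whether $G$ has an $r$-pseudoforest deletion set $X$ with $|X|\le k$. Theorem. There is an algorithm that, given a graph $G$ with $n$ vertices and integers $k,r\ge 0$, decides $r$-Pseudoforest Deletion in time $$\bigl(1+(2r+3)^{r+2}\bigr)^{k+1}\, n^{O(1)}.$$ Here an algorithm is one fixed deterministic program for all $G$, $k$ and $r$, running on a word RAM with words of $O(\log(n+|E|+k+r))$ bits, on which every instruction takes one step. The graph is given by its adjacency matrix of edge multiplicities. The factor $n^{O(1)}$ stands for $p(n)$ with one fixed polynomial $p$ that depends on none of $G$, $k$ and $r$. -/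

import Mathlib

namespace PseudoforestDeletion

/-! ### Multigraphs

`Graph α β` is Mathlib's type of multigraphs (parallel edges and loops allowed) with vertices
in `α` and edges in `β`. -/

/-- `x 0, e 0, x 1, e 1, …, e (m - 1), x m = x 0` is a cycle of length `m ≥ 1` in `G`: the vertices
`x 0, …, x (m - 1)` are distinct and so are the edges. A loop is a cycle of length `1` and two
parallel edges form a cycle of length `2`. -/
def IsCycle {α β : Type*} (G : Graph α β) (m : ℕ) (x : ℕ → α) (e : ℕ → β) : Prop :=
  1 ≤ m ∧ x m = x 0 ∧ Set.InjOn x (Set.Iio m) ∧ Set.InjOn e (Set.Iio m) ∧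
    ∀ i < m, G.IsLink (e i) (x i) (x (i + 1))

/-- A forest is a multigraph without cycles. -/
def IsForest {α β : Type*} (G : Graph α β) : Prop :=
  ∀ (m : ℕ) (x : ℕ → α) (e : ℕ → β), ¬ IsCycle G m x e

/-- The connected component of the vertex `v` of `G`: the subgraph induced by the vertices that
can be reached from `v`. -/
def component {α β : Type*} (G : Graph α β) (v : α) : Graph α β :=
  G.induce {u | Relation.ReflTransGen G.Adj v u}

/-- Each connected component can be made into a forest by deleting at most `r` edges. -/
def IsPseudoforest {α β : Type*} (r : ℕ) (G : Graph α β) : Prop :=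
  ∀ v ∈ G.vertexSet, ∃ F ⊆ (component G v).edgeSet,
    F.encard ≤ r ∧ IsForest ((component G v).deleteEdges F)

/-- `X` is an `r`-pseudoforest deletion set of `G`. -/
def IsDeletionSet {α β : Type*} (r : ℕ) (G : Graph α β) (X : Set α) : Prop :=
  X ⊆ G.vertexSet ∧ IsPseudoforest r (G.deleteVerts X)

/-- `(G, k, r)` is a yes-instance of `r`-pseudoforest deletion. -/
def HasSolution {α β : Type*} (r k : ℕ) (G : Graph α β) : Prop :=
  ∃ X : Set α, IsDeletionSet r G X ∧ X.encard ≤ k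

/-- The number of edges between `u` and `v`; for `u = v` the number of loops at `u`. -/
noncomputable def multiplicity {α β : Type*} (G : Graph α β) (u v : α) : ℕ :=
  {e | G.IsLink e u v}.ncard

/-! ### The machine model: programs for a word RAM

A machine has registers and a random access memory, all of whose cells hold natural numbers that
are smaller than a word bound `W`. A program is a finite piece of syntax, so it can name only
finitely many registers. Every instruction and every test takes one step. -/

/-- The arithmetic operations (`sub` is truncated subtraction). -/
inductive Op where
  | add
  | sub
  | mul

/-- The result of an arithmetic operation. -/
def Op.eval : Op → ℕ → ℕ → ℕ
  | .add, a, b => a + b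
  | .sub, a, b => a - b
  | .mul, a, b => a * b

/-- Programs. With `R` for the registers and `M` for the memory:
`const d c` is `R[d] := c`, `arith o d a b` is `R[d] := R[a] o R[b]`,
`load d a` is `R[d] := M[R[a]]`, `store a b` is `M[R[a]] := R[b]`,
`cond a b P Q` is `if R[a] < R[b] then P else Q`,
and `loop a b P` is `while R[a] < R[b] do P`. -/
inductive Program where
  | skip
  | const (d c : ℕ)
  | arith (o : Op) (d a b : ℕ)
  | load (d a : ℕ)
  | store (a b : ℕ)
  | seq (P Q : Program)
  | cond (a b : ℕ) (P Q : Program)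
  | loop (a b : ℕ) (P : Program)

/-- The contents of the registers and of the memory. -/
structure State where
  reg : ℕ → ℕ
  mem : ℕ → ℕ

/-- `R[d] := x`. -/
def State.setReg (s : State) (d x : ℕ) : State :=
  { s with reg := Function.update s.reg d x }

/-- `M[a] := x`. -/
def State.setMem (s : State) (a x : ℕ) : State :=
  { s with mem := Function.update s.mem a x }

/-- `Exec W P s t s'`: on a machine with word bound `W` the program `P`, started in the state `s`,
halts after exactly `t` steps in the state `s'`. There is no rule for an instruction whose result
does not fit into a word, so a run in which such an overflow occurs is not an execution. -/
inductive Exec (W : ℕ) : Program → State → ℕ → State → Prop where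
  | skip (s : State) : Exec W .skip s 1 s
  | const (s : State) (d c : ℕ) (h : c < W) : Exec W (.const d c) s 1 (s.setReg d c)
  | arith (s : State) (o : Op) (d a b : ℕ) (h : o.eval (s.reg a) (s.reg b) < W) :
      Exec W (.arith o d a b) s 1 (s.setReg d (o.eval (s.reg a) (s.reg b)))
  | load (s : State) (d a : ℕ) : Exec W (.load d a) s 1 (s.setReg d (s.mem (s.reg a)))
  | store (s : State) (a b : ℕ) : Exec W (.store a b) s 1 (s.setMem (s.reg a) (s.reg b))
  | seq (P Q : Program) (s s₁ s₂ : State) (t₁ t₂ : ℕ)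
      (hP : Exec W P s t₁ s₁) (hQ : Exec W Q s₁ t₂ s₂) : Exec W (.seq P Q) s (t₁ + t₂) s₂
  | condTrue (a b : ℕ) (P Q : Program) (s s' : State) (t : ℕ)
      (h : s.reg a < s.reg b) (hP : Exec W P s t s') : Exec W (.cond a b P Q) s (t + 1) s'
  | condFalse (a b : ℕ) (P Q : Program) (s s' : State) (t : ℕ)
      (h : ¬ s.reg a < s.reg b) (hQ : Exec W Q s t s') : Exec W (.cond a b P Q) s (t + 1) s'
  | loopDone (a b : ℕ) (P : Program) (s : State)
      (h : ¬ s.reg a < s.reg b) : Exec W (.loop a b P) s 1 s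
  | loopStep (a b : ℕ) (P : Program) (s s₁ s₂ : State) (t₁ t₂ : ℕ)
      (h : s.reg a < s.reg b) (hP : Exec W P s t₁ s₁) (hL : Exec W (.loop a b P) s₁ t₂ s₂) :
      Exec W (.loop a b P) s (t₁ + 1 + t₂) s₂

/-- The input `(G, k, r)` for a multigraph `G` with vertex set `{0, …, n - 1}`: the registers `0`,
`1`, `2` hold `n`, `k`, `r`, and the memory holds the adjacency matrix, that is, the cell `n * u + v`
holds the number of edges between the vertices `u` and `v`. Everything else is `0`. -/
noncomputable def inputState {β : Type*} (n k r : ℕ) (G : Graph ℕ β) : State where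
  reg i := if i = 0 then n else if i = 1 then k else if i = 2 then r else 0
  mem a := multiplicity G (a / n) (a % n)

/-- The word bound for inputs `(G, k, r)`: words have `O(log (n + |E(G)| + k + r))` bits, where
`c` is the constant in the `O`. -/
noncomputable def wordBound {β : Type*} (c n k r : ℕ) (G : Graph ℕ β) : ℕ :=
  (n + G.edgeSet.ncard + k + r + 2) ^ c

end PseudoforestDeletion

/-!
An `r`-pseudoforest deletion set of size at most `k` is found by iterative compression, and the
branching of each compression step is guided by a sequence of choices, over all of which the program
iterates.

*The condition.* `G - X` is an `r`-pseudoforest if and only if each connected vertex set `S` of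
`G - X` spans at most `|S| - 1 + r` edges (`Sparse`, `hasSolution_iff`). So only the adjacency matrix
matters, and a candidate is verified by a graph search from every vertex that keeps track of the number
of edges (`sparse_iff_search`).

*Compression.* The vertices are added one at a time. A solution for the old graph together with the
new vertex is a solution `Z` of size at most `k + 1` for the new graph. One choice for each vertex of
`Z` says whether it is deleted or kept. Let `W` be the set of kept vertices and `U` that of undecided
ones, which initially is the complement of `Z`, so that it induces an `r`-pseudoforest.

*Branching.* A vertex of degree at most one is irrelevant, and a vertex of degree two with one edge to
`W` may be kept (`Base.free`). For any other vertex with an edge to `W` there are two branches. When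
a vertex is deleted, or a vertex with at least two edges to `W`, loops included, is kept, then the
potential `b + r |Z ∩ W| + |W| - |E(W)|` drops, where `b` is the number of deletions that are left; it
stays positive as long as some edge joins `U` and `W` (`Base.budget_pos`). If a vertex `v` with a single
edge to `W` is kept, it does not drop. Then the branching goes on along the component `C` of `v` in
`U`, always at a vertex adjacent to the part moved so far. This chain ends with a vertex that is deleted
or that closes a cycle, and then the potential has dropped. As `C` is an `r`-pseudoforest, the chain has
at most `r + 1` vertices at which there is a branching (`Chain`, `Chain.lt`), so one choice out of
`r + 2` determines where it ends. Therefore `(k + 1) (r + 3)` choices suffice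
(`freshClaim`, `exists_valid_outcome`), and there are at most
`(r + 2) ^ ((k + 1) (r + 3)) ≤ ((2 r + 3) ^ (r + 2)) ^ (k + 1)` sequences of choices
(`pow_choices_le`). A candidate is accepted only if it passes the verification, so nothing has to be
shown about the other sequences.

*The machine.* The program is verified with a weakest-precondition calculus (`wp`, `exec_of_wp`) that
also bounds the running time, by counting the iterations of each loop. All loops are polynomial in the
number of vertices, except for the one over the sequences of choices (`Program.cost_le`).
-/

namespace PseudoforestDeletion

section

/-! ### Excess of connected vertex sets -/

/-- The number of edges from `v` to the vertex set `S`, in the multigraph with adjacency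
matrix `A`; a loop at `v` is counted once if `v ∈ S`. -/
def deg (A : ℕ → ℕ → ℕ) (v : ℕ) (S : Finset ℕ) : ℕ := ∑ u ∈ S, A v u

/-- Twice the number of edges with both ends in `S`. -/
def twiceEdges (A : ℕ → ℕ → ℕ) (S : Finset ℕ) : ℕ := ∑ v ∈ S, (deg A v S + A v v)

/-- `S` is nonempty and induces a connected subgraph: every proper part of `S` is left by
an edge inside `S`. -/
def Conn (A : ℕ → ℕ → ℕ) (S : Finset ℕ) : Prop :=
  S.Nonempty ∧ ∀ T ⊆ S, T.Nonempty → T ≠ S → ∃ u ∈ T, ∃ v ∈ S, v ∉ T ∧ A u v ≠ 0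

/-- The `r`-pseudoforest condition on the subgraph induced by `Y`: a connected set `S` of vertices
spans at most `|S| - 1 + r` edges. -/
def Sparse (A : ℕ → ℕ → ℕ) (r : ℕ) (Y : Finset ℕ) : Prop :=
  ∀ S ⊆ Y, Conn A S → twiceEdges A S + 2 ≤ 2 * S.card + 2 * r

/-- No edge leaves `T` inside `Y`. -/
def Closed (A : ℕ → ℕ → ℕ) (Y T : Finset ℕ) : Prop :=
  ∀ u ∈ Y, u ∉ T → deg A u T = 0

variable {A : ℕ → ℕ → ℕ} {r : ℕ} {S T W U X Y C K : Finset ℕ} {u v : ℕ}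

lemma deg_eq_zero : deg A v S = 0 ↔ ∀ u ∈ S, A v u = 0 := by
  simp [deg]

lemma deg_ne_zero : deg A v S ≠ 0 ↔ ∃ u ∈ S, A v u ≠ 0 := by
  simp [deg]

lemma deg_insert (h : u ∉ S) : deg A v (insert u S) = deg A v S + A v u := by
  simp [deg, Finset.sum_insert h, add_comm]

lemma deg_empty : deg A v ∅ = 0 := rfl

lemma deg_mono (h : S ⊆ T) : deg A v S ≤ deg A v T :=
  Finset.sum_le_sum_of_subset h

lemma deg_union (h : Disjoint S T) : deg A v (S ∪ T) = deg A v S + deg A v T :=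
  Finset.sum_union h

lemma deg_erase (h : u ∈ S) : deg A v (S.erase u) + A v u = deg A v S := by
  rw [← deg_insert (Finset.notMem_erase u S), Finset.insert_erase h]

lemma Conn.nonempty (h : Conn A S) : S.Nonempty := h.1

lemma conn_singleton (v : ℕ) : Conn A {v} := by
  refine ⟨by simp, fun T hT hne hT' => absurd ?_ hT'⟩
  rcases Finset.subset_singleton_iff.1 hT with h | h
  · simp [h] at hne
  · exact h

lemma twiceEdges_empty : twiceEdges A ∅ = 0 := rfl

section symm
variable (hA : ∀ u v, A u v = A v u)
include hA

lemma twiceEdges_insert (h : v ∉ S) :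
    twiceEdges A (insert v S) = twiceEdges A S + 2 * deg A v S + 2 * A v v := by
  have h1 : ∑ x ∈ S, (deg A x (insert v S) + A x x)
      = ∑ x ∈ S, (deg A x S + A x x) + ∑ x ∈ S, A v x := by
    rw [← Finset.sum_add_distrib]
    refine Finset.sum_congr rfl fun x _ => ?_
    rw [deg_insert h, hA v x]; ring
  rw [twiceEdges, Finset.sum_insert h, h1, deg_insert h]
  simp only [twiceEdges, deg]
  ring

lemma twiceEdges_erase (h : v ∈ S) :
    twiceEdges A (S.erase v) + 2 * deg A v (S.erase v) + 2 * A v v = twiceEdges A S := by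
  rw [← twiceEdges_insert hA (Finset.notMem_erase v S), Finset.insert_erase h]

lemma closed_iff : Closed A Y T ↔ ∀ u ∈ Y, u ∉ T → ∀ v ∈ T, A v u = 0 := by
  simp only [Closed, deg_eq_zero]
  exact forall₅_congr fun u _ _ v _ => by rw [hA]

lemma Conn.insert_adj (h : Conn A S) (hv : deg A v S ≠ 0) : Conn A (insert v S) := by
  by_cases hvS : v ∈ S
  · rwa [Finset.insert_eq_of_mem hvS]
  obtain ⟨w, hw, hvw⟩ := deg_ne_zero.1 hv
  refine ⟨Finset.insert_nonempty _ _, fun T hT hne hTS => ?_⟩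
  by_cases hS : S ⊆ T
  · have hvT : v ∉ T := fun hvT => hTS (subset_antisymm hT (Finset.insert_subset hvT hS))
    exact ⟨w, hS hw, v, by simp, hvT, by rwa [hA]⟩
  by_cases hTv : (T.erase v).Nonempty
  · have hsub : T.erase v ⊆ S := fun x hx => by
      have := hT (Finset.mem_of_mem_erase hx)
      simp only [Finset.mem_insert] at this
      exact this.resolve_left (Finset.ne_of_mem_erase hx)
    obtain ⟨a, ha, b, hb, hbT, hab⟩ := h.2 _ hsub hTv
      (fun h' => hS (h' ▸ Finset.erase_subset _ _))
    refine ⟨a, Finset.mem_of_mem_erase ha, b, by simp [hb], fun hbT' => hbT ?_, hab⟩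
    exact Finset.mem_erase.2 ⟨fun h => hvS (h ▸ hb), hbT'⟩
  · have hTv' : T = {v} := by
      rw [Finset.not_nonempty_iff_eq_empty, Finset.erase_eq_empty_iff] at hTv
      rcases hTv with h' | h'
      · simp [h'] at hne
      · exact h'
    subst hTv'
    exact ⟨v, by simp, w, by simp [hw], fun h' => hvS (by simp at h'; rwa [← h']), hvw⟩

/-- A vertex with at most one edge into the rest of a connected set can be removed. -/
lemma Conn.erase_pendant (h : Conn A S) (hv : v ∈ S) (hd : deg A v (S.erase v) ≤ 1)
    (hne : (S.erase v).Nonempty) : Conn A (S.erase v) := by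
  have huniq : ∀ a ∈ S.erase v, ∀ b ∈ S.erase v, A v a ≠ 0 → A v b ≠ 0 → a = b := by
    intro a ha b hb h1 h2
    by_contra hab
    have : ({a, b} : Finset ℕ) ⊆ S.erase v := by
      intro x hx
      simp only [Finset.mem_insert, Finset.mem_singleton] at hx
      rcases hx with rfl | rfl <;> assumption
    have := (deg_mono (A := A) (v := v) this).trans hd
    simp [deg, Finset.sum_pair hab] at this
    omega
  refine ⟨hne, fun T hT hTne hTS => ?_⟩
  have hTS' : T ⊆ S := hT.trans (Finset.erase_subset _ _)
  have hvT : v ∉ T := fun h => by simpa using hT h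
  obtain ⟨a, ha, b, hb, hbT, hab⟩ := h.2 T hTS' hTne (fun h' => hvT (h' ▸ hv))
  by_cases hbv : b = v
  · subst hbv
    -- `v` is attached to `T`, so no edge joins it to the other part
    have hne' : insert b T ≠ S := by
      intro h'
      apply hTS
      rw [← h', Finset.erase_insert hvT]
    obtain ⟨x, hx, y, hy, hyT, hxy⟩ := h.2 (insert b T)
      (Finset.insert_subset hv hTS') (by simp) hne'
    simp only [Finset.mem_insert, not_or] at hx hyT
    rcases hx with rfl | hx
    · have := huniq a (hT ha) y (by simp [hy, hyT.1]) (by rwa [hA]) hxy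
      exact absurd (this ▸ ha) hyT.2
    · exact ⟨x, hx, y, by simp [hy, hyT.1], hyT.2, hxy⟩
  · exact ⟨a, ha, b, by simp [hb, hbv], hbT, hab⟩

lemma Conn.subset_of_closed (hT : Conn A T) (hTY : T ⊆ Y) (hcl : Closed A Y S)
    (hne : (T ∩ S).Nonempty) : T ⊆ S := by
  by_contra hTS
  obtain ⟨a, ha, b, hb, hbT, hab⟩ := hT.2 (T ∩ S) Finset.inter_subset_left hne
    (fun h => hTS (h ▸ Finset.inter_subset_right))
  simp only [Finset.mem_inter, not_and] at ha hbT
  exact hab ((closed_iff hA).1 hcl b (hTY hb) (hbT hb) a ha.2)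

/-- Among connected sets the excess is monotone. -/
lemma Conn.excess_mono (hS : Conn A S) (hT : Conn A T) (hST : S ⊆ T) :
    twiceEdges A S + 2 * T.card ≤ twiceEdges A T + 2 * S.card := by
  induction hn : (T \ S).card generalizing S with
  | zero =>
    have : T ⊆ S := by simpa using hn
    rw [subset_antisymm hST this]
  | succ n ih =>
    have hne : S ≠ T := by rintro rfl; simp at hn
    obtain ⟨a, ha, b, hb, hbS, hab⟩ := hT.2 S hST hS.nonempty hne
    have hd : deg A b S ≠ 0 := deg_ne_zero.2 ⟨a, ha, by rwa [hA]⟩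
    have hc : (T \ insert b S).card = n := by
      rw [Finset.sdiff_insert, Finset.card_erase_of_mem (by simp [hb, hbS]), hn]; rfl
    have := ih (hS.insert_adj hA hd) (Finset.insert_subset hb hST) hc
    rw [twiceEdges_insert hA hbS, Finset.card_insert_of_notMem hbS] at this
    omega

omit hA in
lemma Sparse.mono (h : Sparse A r Y) (hXY : X ⊆ Y) : Sparse A r X :=
  fun S hS => h S (hS.trans hXY)

/-- Attaching a vertex of degree at most one keeps an `r`-pseudoforest. -/
lemma Sparse.insert_pendant (h : Sparse A r Y) (hl : A v v = 0) (hd : deg A v Y ≤ 1) :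
    Sparse A r (insert v Y) := by
  intro S hS hc
  by_cases hv : v ∈ S
  · have hsub : S.erase v ⊆ Y := fun x hx => by
      have := hS (Finset.mem_of_mem_erase hx)
      simp only [Finset.mem_insert] at this
      exact this.resolve_left (Finset.ne_of_mem_erase hx)
    have hd' := (deg_mono (A := A) (v := v) hsub).trans hd
    have he := twiceEdges_erase hA hv
    have hcard := Finset.card_erase_add_one hv
    rcases (S.erase v).eq_empty_or_nonempty with h0 | hne
    · rw [h0, twiceEdges_empty, deg_empty] at he
      rw [h0] at hcard
      simp at hcard
      omega
    · have := h _ hsub (hc.erase_pendant hA hv hd' hne)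
      omega
  · exact h S ((Finset.subset_insert_iff_of_notMem hv).1 hS) hc

/-- A vertex `v` of a deletion set `X` can be replaced by `a` if all but one of the edges at `v`
go to `a`. -/
lemma Sparse.replace {a : ℕ} (h : Sparse A r (Y \ X)) (hl : A v v = 0)
    (hd : deg A v ((Y.erase v).erase a) ≤ 1) : Sparse A r (Y \ insert a (X.erase v)) := by
  refine Sparse.mono (Y := insert v ((Y \ X) \ {v, a})) (Sparse.insert_pendant hA
    (h.mono Finset.sdiff_subset) hl ((deg_mono ?_).trans hd)) ?_
  · intro x; simp only [Finset.mem_sdiff, Finset.mem_insert, Finset.mem_singleton,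
      Finset.mem_erase]; tauto
  · intro x; simp only [Finset.mem_sdiff, Finset.mem_insert, Finset.mem_singleton,
      Finset.mem_erase]; tauto

lemma Sparse.union (hW : Sparse A r W) (hU : Sparse A r U) (h : ∀ u ∈ U, deg A u W = 0) :
    Sparse A r (W ∪ U) := by
  intro S hS hc
  by_cases hne : (S ∩ W).Nonempty
  · have hcl : Closed A (W ∪ U) W := fun u hu huW => h u (by simpa [huW] using hu)
    exact hW S (hc.subset_of_closed hA hS hcl hne) hc
  · refine hU S (fun x hx => ?_) hc
    have := hS hx
    rw [Finset.not_nonempty_iff_eq_empty] at hne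
    have hxW : x ∉ W := fun h => by
      have : x ∈ S ∩ W := by simp [hx, h]
      simp [hne] at this
    simpa [hxW] using this

/-- The connected component of `v` in `Y`. -/
lemma exists_component (hv : v ∈ Y) : ∃ C ⊆ Y, v ∈ C ∧ Conn A C ∧ Closed A Y C := by
  classical
  have hne : (Y.powerset.filter (fun C => v ∈ C ∧ Conn A C)).Nonempty :=
    ⟨{v}, by simp [hv, conn_singleton]⟩
  obtain ⟨C, hC, hmax⟩ := Finset.exists_max_image _ Finset.card hne
  simp only [Finset.mem_filter, Finset.mem_powerset] at hC hmax
  refine ⟨C, hC.1, hC.2.1, hC.2.2, fun u hu huC => ?_⟩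
  by_contra hd
  have := hmax (insert u C) ⟨Finset.insert_subset hu hC.1, by simp [hC.2.1],
    hC.2.2.insert_adj hA hd⟩
  rw [Finset.card_insert_of_notMem huC] at this
  omega

lemma twiceEdges_union_closed (hd : Disjoint S T) (hcl : ∀ u ∈ T, deg A u S = 0) :
    twiceEdges A (S ∪ T) = twiceEdges A S + twiceEdges A T := by
  rw [twiceEdges, Finset.sum_union hd]
  congr 1
  · refine Finset.sum_congr rfl fun x hx => ?_
    rw [deg_union hd, (deg_eq_zero (S := T)).2, add_zero]
    intro u hu
    rw [hA]; exact deg_eq_zero.1 (hcl u hu) x hx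
  · refine Finset.sum_congr rfl fun x hx => ?_
    rw [deg_union hd, hcl x hx, zero_add]

/-- If every connected component of the `r`-pseudoforest on `W` meets `V`, then there are at most
`|W| + (r - 1) |components| < |W| + r |V|` edges. -/
lemma Sparse.twiceEdges_le (h : Sparse A r W) (hW : W.Nonempty) (V : Finset ℕ)
    (hV : ∀ T ⊆ W, T.Nonempty → Closed A W T → (T ∩ V).Nonempty) :
    twiceEdges A W + 2 ≤ 2 * W.card + 2 * r * V.card := by
  induction hn : W.card using Nat.strong_induction_on generalizing W V with
  | _ n ih =>
    subst hn
    obtain ⟨w, hw⟩ := hW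
    obtain ⟨C, hCW, hwC, hC, hcl⟩ := exists_component hA hw
    have h1 := h C hCW hC
    have hCV := hV C hCW hC.nonempty hcl
    have hsum : twiceEdges A W = twiceEdges A C + twiceEdges A (W \ C) := by
      rw [← twiceEdges_union_closed hA Finset.disjoint_sdiff, Finset.union_sdiff_of_subset hCW]
      intro u hu
      simp only [Finset.mem_sdiff] at hu
      exact hcl u hu.1 hu.2
    have hcard : C.card + (W \ C).card = W.card := by
      rw [add_comm]; exact Finset.card_sdiff_add_card_eq_card hCW
    have hVcard : (V ∩ C).card + (V \ C).card = V.card := Finset.card_inter_add_card_sdiff V C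
    have hpos : 1 ≤ (V ∩ C).card := by rw [Finset.inter_comm]; exact hCV.card_pos
    rcases (W \ C).eq_empty_or_nonempty with h0 | hne
    · rw [h0, twiceEdges_empty] at hsum
      rw [h0] at hcard
      simp at hcard
      have : r ≤ r * V.card := Nat.le_mul_of_pos_right _ (by omega)
      nlinarith
    · have hCpos := hC.nonempty.card_pos
      have := ih (W \ C).card (by omega) (h.mono Finset.sdiff_subset) hne (V \ C) ?_ rfl
      · have h2 : r * (V \ C).card + r ≤ r * V.card := by
          rw [← hVcard]; nlinarith
        nlinarith
      · intro T hT hTne hTcl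
        have hTW : T ⊆ W := hT.trans Finset.sdiff_subset
        obtain ⟨x, hx⟩ := hV T hTW hTne (fun u hu huT => by
          by_cases huC : u ∈ C
          · refine deg_eq_zero.2 fun x hx => ?_
            have := hT hx
            simp only [Finset.mem_sdiff] at this
            rw [hA]; exact deg_eq_zero.1 (hcl x this.1 this.2) u huC
          · exact hTcl u (by simp [hu, huC]) huT)
        refine ⟨x, ?_⟩
        simp only [Finset.mem_inter] at hx
        have := hT hx.1
        simp only [Finset.mem_sdiff] at this
        simp [hx, this.2]

end symm

end

section

/-! ### The disjoint problem: invariants of the branching -/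

variable {A : ℕ → ℕ → ℕ} {r b m j : ℕ} {S T W U V X Y C K : Finset ℕ} {u v : ℕ}

/-- The invariant of the branching: `U` is the set of undecided vertices, `W` the set of vertices
that are kept, `b` vertices of `U` may still be deleted, and every component of `W`
meets `V`. -/
structure Base (A : ℕ → ℕ → ℕ) (r : ℕ) (U W V : Finset ℕ) (b : ℕ) : Prop where
  disj : Disjoint W U
  sparse : Sparse A r U
  sol : ∃ X ⊆ U, X.card ≤ b ∧ Sparse A r ((W ∪ U) \ X)
  reach : ∀ T ⊆ W, T.Nonempty → Closed A W T → (T ∩ V).Nonempty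

/-- The number `m` of choices suffices, because the potential `b + r |V| + |W| - |E(W)|` is at most
`m`, or since at most `m` vertices are undecided. The potential drops by one when a vertex is
deleted and by at least `d - 1` when a vertex with `d` edges into `W` is kept, loops included. -/
def Budget (A : ℕ → ℕ → ℕ) (r : ℕ) (U W V : Finset ℕ) (b m : ℕ) : Prop :=
  2 * b + 2 * r * V.card + 2 * W.card ≤ twiceEdges A W + 2 * m ∨ U.card ≤ m

/-- As `Budget`, but inside a chain: its choice has been read, while the potential drops only at the
end of the chain. -/
def ChainBudget (A : ℕ → ℕ → ℕ) (r : ℕ) (U W V : Finset ℕ) (b m : ℕ) : Prop :=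
  2 * b + 2 * r * V.card + 2 * W.card ≤ twiceEdges A W + 2 * m + 2 ∨ U.card ≤ m

lemma Base.sparse_kept (h : Base A r U W V b) : Sparse A r W := by
  obtain ⟨X, hX, -, hs⟩ := h.sol
  refine hs.mono fun x hx => ?_
  simp only [Finset.mem_sdiff, Finset.mem_union]
  exact ⟨Or.inl hx, fun h' => Finset.disjoint_left.1 h.disj hx (hX h')⟩

section symm
variable (hA : ∀ u v, A u v = A v u)
include hA

omit hA in
lemma Base.discard (h : Base A r U W V b) (v : ℕ) : Base A r (U.erase v) W V b := by
  obtain ⟨X, hX, hb, hs⟩ := h.sol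
  refine ⟨h.disj.mono_right (Finset.erase_subset _ _), h.sparse.mono (Finset.erase_subset _ _),
    ⟨X.erase v, Finset.erase_subset_erase _ hX, (Finset.card_erase_le).trans hb,
      hs.mono fun x => ?_⟩, h.reach⟩
  have : v ∈ W → v ∉ U := fun h1 h2 => Finset.disjoint_left.1 h.disj h1 h2
  simp only [Finset.mem_sdiff, Finset.mem_union, Finset.mem_erase]
  rintro ⟨h1, h2⟩
  refine ⟨by tauto, fun hxX => h2 ⟨?_, hxX⟩⟩
  rintro rfl
  have := hX hxX
  tauto

/-- Moving a vertex with a neighbour in `W` to `W`, if some solution avoids it. -/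
lemma Base.move (h : Base A r U W V b) (hv : v ∈ U) (hd : deg A v W ≠ 0) (hX : X ⊆ U)
    (hvX : v ∉ X) (hb : X.card ≤ b) (hs : Sparse A r ((W ∪ U) \ X)) :
    Base A r (U.erase v) (insert v W) V b := by
  have hvW : v ∉ W := fun h' => Finset.disjoint_left.1 h.disj h' hv
  refine ⟨?_, h.sparse.mono (Finset.erase_subset _ _), ⟨X, ?_, hb, hs.mono ?_⟩, ?_⟩
  · rw [Finset.disjoint_left]
    intro x
    have : x ∈ W → x ∉ U := fun h1 h2 => Finset.disjoint_left.1 h.disj h1 h2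
    simp only [Finset.mem_insert, Finset.mem_erase]
    tauto
  · intro x hx
    exact Finset.mem_erase.2 ⟨fun h' => hvX (h' ▸ hx), hX hx⟩
  · refine Finset.sdiff_subset_sdiff (fun x => ?_) subset_rfl
    simp only [Finset.mem_union, Finset.mem_insert, Finset.mem_erase]
    rintro ((rfl | h) | h)
    · exact Or.inr hv
    · exact Or.inl h
    · exact Or.inr h.2
  · intro T hT hne hcl
    have hcl' : Closed A W (T.erase v) := by
      intro u hu huT
      have huv : u ≠ v := fun h' => hvW (h' ▸ hu)
      have h1 := hcl u (by simp [hu]) (fun h' => huT (by simp [huv, h']))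
      exact Nat.eq_zero_of_le_zero (h1 ▸ deg_mono (Finset.erase_subset _ _))
    have hTne : (T.erase v).Nonempty := by
      rw [Finset.nonempty_iff_ne_empty]
      intro h0
      have hTv : T = {v} := by
        rw [Finset.erase_eq_empty_iff] at h0
        rcases h0 with h' | h'
        · simp [h'] at hne
        · exact h'
      subst hTv
      apply hd
      refine deg_eq_zero.2 fun w hw => ?_
      exact (closed_iff hA).1 hcl w (by simp [hw])
        (by simpa using fun h' : w = v => hvW (h' ▸ hw)) v (by simp)
    obtain ⟨x, hx⟩ := h.reach (T.erase v) (fun x hx => by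
      have := hT (Finset.mem_of_mem_erase hx)
      simpa [Finset.ne_of_mem_erase hx] using this) hTne hcl'
    exact ⟨x, by simp only [Finset.mem_inter, Finset.mem_erase] at hx ⊢; tauto⟩

/-- A vertex of degree two with exactly one edge to `W` can be kept: its other neighbour may be
deleted in its place. -/
lemma Base.free (h : Base A r U W V b) (hv : v ∈ U) (hd : deg A v W = 1) (hl : A v v = 0)
    (hU : deg A v U = 1) : Base A r (U.erase v) (insert v W) V b := by
  obtain ⟨X, hX, hb, hs⟩ := h.sol
  by_cases hvX : v ∈ X
  · obtain ⟨a, ha, hva⟩ := deg_ne_zero.1 (show deg A v U ≠ 0 by omega)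
    have hav : a ≠ v := by rintro rfl; exact hva hl
    refine h.move hA hv (by omega) (X := insert a (X.erase v)) ?_ ?_ ?_ ?_
    · exact Finset.insert_subset ha ((Finset.erase_subset _ _).trans hX)
    · simp [hav.symm]
    · refine (Finset.card_insert_le _ _).trans ?_
      rw [Finset.card_erase_add_one hvX]; exact hb
    · refine hs.replace hA hl ?_
      have h1 : ((W ∪ U).erase v).erase a ⊆ W ∪ U.erase a := by
        intro x; simp only [Finset.mem_union, Finset.mem_erase]; tauto
      refine (deg_mono h1).trans ?_
      rw [deg_union (h.disj.mono_right (Finset.erase_subset _ _))]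
      have := deg_erase (A := A) (v := v) ha
      omega
  · exact h.move hA hv (by omega) hX hvX hb hs

/-- If `v` has an edge to the kept part, then some solution deletes `v`, or `v` can be kept. -/
lemma Base.branch (h : Base A r U W V b) (hv : v ∈ U) (hd : deg A v W ≠ 0) :
    (∃ b', b = b' + 1 ∧ Base A r (U.erase v) W V b') ∨
      Base A r (U.erase v) (insert v W) V b := by
  obtain ⟨X, hX, hb, hs⟩ := h.sol
  by_cases hvX : v ∈ X
  · left
    have hc := Finset.card_erase_add_one hvX
    refine ⟨b - 1, by omega, h.disj.mono_right (Finset.erase_subset _ _),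
      h.sparse.mono (Finset.erase_subset _ _), ⟨X.erase v, Finset.erase_subset_erase _ hX,
      by omega, hs.mono fun x => ?_⟩, h.reach⟩
    have : v ∈ W → v ∉ U := fun h1 h2 => Finset.disjoint_left.1 h.disj h1 h2
    simp only [Finset.mem_sdiff, Finset.mem_union, Finset.mem_erase]
    rintro ⟨h1, h2⟩
    refine ⟨by tauto, fun hxX => h2 ⟨?_, hxX⟩⟩
    rintro rfl
    tauto
  · exact Or.inr (h.move hA hv hd hX hvX hb hs)

/-- As long as an undecided vertex has an edge to the kept part, at least one choice is left: the potential
is positive because the kept part is an `r`-pseudoforest all of whose components meet `V`. -/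
lemma Base.budget_pos (h : Base A r U W V b) (hv : v ∈ U) (hd : deg A v W ≠ 0)
    (hm : Budget A r U W V b m) : 1 ≤ m := by
  rcases hm with hm | hm
  · obtain ⟨w, hw, -⟩ := deg_ne_zero.1 hd
    have := h.sparse_kept.twiceEdges_le hA ⟨w, hw⟩ V h.reach
    omega
  · exact (Finset.card_pos.2 ⟨v, hv⟩).trans_le hm

/-- The invariant of a chain: the vertices of `K` have been moved from a component `C` of the
undecided part to the kept part, whose other vertices form `W`, one by one, each of them attached
by a single edge; for `j` of them it also was an option to delete them. The set `K` spans a tree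
(`tree`), the component `C` has a cycle and satisfies the `r`-pseudoforest condition (`cyclic`,
`excess`), and at least `j + |K|` edges of `C` have an end in `K` (`balance`). Every undecided vertex
has degree at least two (`total`), and if it is not adjacent to `K`, then it has at most one edge to
`W`, and in that case at least two edges into the undecided part (`stable`). -/
structure Chain (A : ℕ → ℕ → ℕ) (r : ℕ) (U W K C : Finset ℕ) (j : ℕ) : Prop where
  subset : K ⊆ C
  subset_union : C ⊆ U ∪ K
  conn : Conn A C
  closed : Closed A (U ∪ K) C
  nonempty : K.Nonempty
  tree : twiceEdges A K + 2 = 2 * K.card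
  cyclic : 2 * C.card ≤ twiceEdges A C
  excess : twiceEdges A C + 2 ≤ 2 * C.card + 2 * r
  balance : 2 * j + twiceEdges A (C \ K) + 2 * K.card ≤ twiceEdges A C
  le : j ≤ r
  total : ∀ u ∈ U, 2 ≤ deg A u W + deg A u K + deg A u U + A u u
  stable : ∀ u ∈ U, deg A u K = 0 → deg A u W ≠ 0 → deg A u W + A u u < 2 ∧ 2 ≤ deg A u U

omit hA in
/-- A graph of minimum degree two has at least as many edges as vertices. -/
lemma two_card_le (h : ∀ u ∈ S, 2 ≤ deg A u S + A u u) : 2 * S.card ≤ twiceEdges A S := by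
  rw [twiceEdges, mul_comm, ← smul_eq_mul, ← Finset.sum_const]
  exact Finset.sum_le_sum h

lemma deg_closed (hS : S ⊆ Y) (hcl : Closed A Y S) (hv : v ∈ S) : deg A v Y = deg A v S := by
  rw [← Finset.union_sdiff_of_subset hS, deg_union Finset.disjoint_sdiff, add_eq_left]
  refine deg_eq_zero.2 fun u hu => ?_
  simp only [Finset.mem_sdiff] at hu
  exact (closed_iff hA).1 hcl u hu.1 hu.2 v hv

omit hA in
lemma deg_erase_eq (h : A v u = 0) : deg A v (S.erase u) = deg A v S := by
  by_cases hu : u ∈ S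
  · have := deg_erase (A := A) (v := v) hu; omega
  · rw [Finset.erase_eq_of_notMem hu]

/-- A chain starts at a vertex `v` with a single edge to `W` and at least two edges into the
undecided part, when nothing cheaper is left to do. -/
lemma Chain.start (hs : Sparse A r U) (hv : v ∈ U) (hl : A v v = 0) (hU : 2 ≤ deg A v U)
    (htot : ∀ u ∈ U, 2 ≤ deg A u W + deg A u U + A u u)
    (hst : ∀ u ∈ U, deg A u W ≠ 0 → deg A u W + A u u < 2 ∧ 2 ≤ deg A u U) :
    ∃ C, Chain A r (U.erase v) W {v} C 1 := by
  obtain ⟨C, hCU, hvC, hC, hcl⟩ := exists_component hA hv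
  have hUv : U.erase v ∪ {v} = U := by
    rw [Finset.union_comm, ← Finset.insert_eq, Finset.insert_erase hv]
  have hdC : ∀ u ∈ C, deg A u U = deg A u C := fun u hu => deg_closed hA hCU hcl hu
  have hcyc : 2 * C.card ≤ twiceEdges A C := by
    refine two_card_le fun u hu => ?_
    rw [← hdC u hu]
    by_cases h0 : deg A u W = 0
    · have := htot u (hCU hu); omega
    · have := hst u (hCU hu) h0; omega
  have hex := hs C hCU hC
  have hdeg (u : ℕ) : deg A u {v} + deg A u (U.erase v) = deg A u U := by
    have := deg_erase (A := A) (v := u) hv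
    simp only [deg, Finset.sum_singleton] at this ⊢
    omega
  refine ⟨C, by simpa using hvC, by rwa [hUv], hC, by rwa [hUv], by simp, ?_, hcyc, hex, ?_,
    by omega, ?_, ?_⟩
  · simp [twiceEdges, deg, hl]
  · have h1 := twiceEdges_erase hA hvC
    rw [← Finset.erase_eq, Finset.card_singleton]
    have h2 := deg_erase_eq (S := C) hl
    rw [← hdC v hvC] at h2
    omega
  · intro u hu
    have h1 := htot u (Finset.mem_of_mem_erase hu)
    have h2 := hdeg u
    omega
  · intro u hu h0 hW
    have h1 := hst u (Finset.mem_of_mem_erase hu) hW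
    have h2 := hdeg u
    omega

/-- Since `K` spans a tree and `C` contains a cycle, some undecided vertex is adjacent to `K`. -/
lemma Chain.exists_adj (h : Chain A r U W K C j) : ∃ u ∈ U, deg A u K ≠ 0 := by
  have hne : K ≠ C := by
    rintro rfl
    have := h.tree; have := h.cyclic; omega
  obtain ⟨a, ha, b, hb, hbK, hab⟩ := h.conn.2 K h.subset h.nonempty hne
  have := h.subset_union hb
  simp only [Finset.mem_union, hbK, or_false] at this
  exact ⟨b, this, deg_ne_zero.2 ⟨a, ha, by rwa [hA]⟩⟩

omit hA in
/-- A vertex adjacent to the chain lies in its component. -/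
lemma Chain.mem (h : Chain A r U W K C j) (hv : v ∈ U) (hK : deg A v K ≠ 0) : v ∈ C := by
  by_contra hvC
  have h1 := h.closed v (by simp [hv]) hvC
  have := deg_mono (A := A) (v := v) h.subset
  omega

lemma Chain.deg_rest (h : Chain A r U W K C j) (hd : Disjoint K U) (hv : v ∈ C) (hvK : v ∉ K) :
    deg A v U = deg A v (C \ K) := by
  have hCK : C \ K ⊆ U := fun x hx => by
    simp only [Finset.mem_sdiff] at hx
    have := h.subset_union hx.1
    simpa [hx.2] using this
  refine deg_closed hA hCK (fun u hu hu' => ?_) (by simp [hv, hvK])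
  have huK : u ∉ K := fun h' => Finset.disjoint_left.1 hd h' hu
  have huC : u ∉ C := fun h' => hu' (by simp [h', huK])
  have := h.closed u (by simp [hu]) huC
  have := deg_mono (A := A) (v := u) (S := C \ K) (T := C) Finset.sdiff_subset
  omega

/-- When every undecided vertex of `C` has degree at least two in the undecided part, the chain
has made fewer than `r` choices. -/
lemma Chain.lt (h : Chain A r U W K C j) (hd : Disjoint K U)
    (hU : ∀ u ∈ U, 2 ≤ deg A u U + A u u) : j + 1 ≤ r := by
  have h1 : 2 * (C \ K).card ≤ twiceEdges A (C \ K) := by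
    refine two_card_le fun u hu => ?_
    simp only [Finset.mem_sdiff] at hu
    rw [← h.deg_rest hA hd hu.1 hu.2]
    have := h.subset_union hu.1
    exact hU u (by simpa [hu.2] using this)
  have h2 : (C \ K).card + K.card = C.card := Finset.card_sdiff_add_card_eq_card h.subset
  have := h.balance
  have := h.excess
  omega

/-- A vertex attached to `K` by a single edge joins the chain. It counts among the `j` vertices if it has
at least two further edges; otherwise it has one. -/
lemma Chain.extend (h : Chain A r U W K C j) (hd : Disjoint K U) (hv : v ∈ U)
    (hK : deg A v K = 1) (hl : A v v = 0) {j' : ℕ} (hj : j' + 1 ≤ j + deg A v U) (hr : j' ≤ r) :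
    Chain A r (U.erase v) W (insert v K) C j' := by
  have hvC := h.mem hv (by omega)
  have hvK : v ∉ K := fun h' => Finset.disjoint_left.1 hd h' hv
  have hUK : U.erase v ∪ insert v K = U ∪ K := by
    ext x; simp only [Finset.mem_union, Finset.mem_erase, Finset.mem_insert]
    by_cases hx : x = v <;> simp [hx, hv]
  have hdeg (u : ℕ) : deg A u (insert v K) = deg A u K + A u v := deg_insert hvK
  have hdegU (u : ℕ) := deg_erase (A := A) (v := u) hv
  refine ⟨Finset.insert_subset hvC h.subset, hUK ▸ h.subset_union, h.conn, hUK ▸ h.closed,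
    by simp, ?_, h.cyclic, h.excess, ?_, hr, ?_, ?_⟩
  · rw [twiceEdges_insert hA hvK, Finset.card_insert_of_notMem hvK]
    have := h.tree
    omega
  · have h1 := twiceEdges_erase hA (S := C \ K) (v := v) (by simp [hvC, hvK])
    rw [deg_erase_eq hl, ← h.deg_rest hA hd hvC hvK] at h1
    rw [Finset.sdiff_insert, Finset.card_insert_of_notMem hvK]
    have := h.balance
    omega
  · intro u hu
    have := h.total u (Finset.mem_of_mem_erase hu)
    have := hdeg u; have := hdegU u
    omega
  · intro u hu h0 hW
    have h1 := hdeg u; have h2 := hdegU u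
    have := h.stable u (Finset.mem_of_mem_erase hu) (by omega) hW
    omega

end symm

end

section

/-! ### The branching procedure, guided by a stream of choices -/

variable {A : ℕ → ℕ → ℕ} {n r b m j : ℕ} {st : ℕ → ℕ} {V C : Finset ℕ} {u v : ℕ}

/-- The vertices of status `c`. The statuses are `0`: absent, `1`: deleted, `2`: undecided,
`3`: kept, `4`: kept, and moved there by the present chain, `5`: irrelevant. -/
def cls (n : ℕ) (st : ℕ → ℕ) (c : ℕ) : Finset ℕ := (Finset.range n).filter (fun v => st v = c)

/-- How urgently the vertex `v` has to be treated. An undecided vertex has score `5` if its degree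
is at most one, `4` if it has degree two and one edge to the kept part, `3` if keeping it
lowers the potential, `2` if its only edge to the kept part goes to the present chain,
and `1` if it goes elsewhere. -/
def score (A : ℕ → ℕ → ℕ) (n : ℕ) (st : ℕ → ℕ) (v : ℕ) : ℕ :=
  if st v = 2 then
    if deg A v (cls n st 3) + deg A v (cls n st 4) + deg A v (cls n st 2) + A v v < 2 then 5
    else if deg A v (cls n st 3) + deg A v (cls n st 4) = 0 then 0
    else if deg A v (cls n st 3) + deg A v (cls n st 4) + A v v < 2 then
      if deg A v (cls n st 2) < 2 then 4 else 1 + deg A v (cls n st 4)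
    else 3
  else 0

/-- The maximal score among the vertices below `j`, and the first vertex that attains it. -/
def pick (A : ℕ → ℕ → ℕ) (n : ℕ) (st : ℕ → ℕ) : ℕ → ℕ × ℕ
  | 0 => (0, 0)
  | j + 1 => if (pick A n st j).1 < score A n st j then (score A n st j, j) else pick A n st j

/-- The state of the branching: the statuses, the counter of the present chain (`0` outside
chains), and the choices that have not been read yet. A choice is the number of vertices
that are kept before one is deleted. -/
structure Cfg where
  st : ℕ → ℕ
  cnt : ℕ
  dig : ℕ → ℕ

/-- At the end of a chain its vertices become ordinary kept vertices. -/
def Cfg.settle (c : Cfg) : Cfg :=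
  if c.cnt = 0 then { c with st := fun u => if c.st u = 4 then 3 else c.st u } else c

/-- Outside a chain, read a choice. -/
def Cfg.fetch (c : Cfg) : Cfg :=
  if c.cnt = 0 then { c with cnt := c.dig 0 + 1, dig := fun i => c.dig (i + 1) } else c

/-- Treat the vertex `v` of score `sc`. -/
def Cfg.act (c : Cfg) (sc v : ℕ) : Cfg :=
  if 3 < sc then { c with st := Function.update c.st v sc }
  else if c.fetch.cnt - 1 = 0 then
    { c.fetch with st := Function.update c.st v 1, cnt := 0 }
  else { c.fetch with
    st := Function.update c.st v 4
    cnt := if sc = 3 then 0 else c.fetch.cnt - 1 }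

/-- One step of the branching. -/
def Cfg.step (A : ℕ → ℕ → ℕ) (n : ℕ) (c : Cfg) : Cfg :=
  if (pick A n c.st n).1 = 0 then c
  else (c.act (pick A n c.st n).1 (pick A n c.st n).2).settle

/-- `N` steps of the branching. -/
def Cfg.run (A : ℕ → ℕ → ℕ) (n : ℕ) : ℕ → Cfg → Cfg
  | 0, c => c
  | N + 1, c => Cfg.run A n N (c.step A n)

lemma mem_cls {c : ℕ} : v ∈ cls n st c ↔ v < n ∧ st v = c := by simp [cls]

lemma disjoint_cls {c d : ℕ} (h : c ≠ d) : Disjoint (cls n st c) (cls n st d) := by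
  rw [Finset.disjoint_left]
  intro x hx hy
  exact h ((mem_cls.1 hx).2.symm.trans (mem_cls.1 hy).2)

lemma cls_update_self {c : ℕ} (hv : v < n) :
    cls n (Function.update st v c) c = insert v (cls n st c) := by
  ext x
  by_cases hx : x = v <;> simp [mem_cls, hx, hv]

lemma cls_update_of_ne {c d : ℕ} (h : c ≠ d) :
    cls n (Function.update st v c) d = (cls n st d).erase v := by
  ext x
  by_cases hx : x = v <;> simp [mem_cls, hx, h]

lemma cls_erase {c : ℕ} (h : st v ≠ c) : (cls n st c).erase v = cls n st c := by
  rw [Finset.erase_eq_of_notMem]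
  exact fun h' => h (mem_cls.1 h').2

lemma pick_le (j : ℕ) : ∀ u < j, score A n st u ≤ (pick A n st j).1 := by
  induction j with
  | zero => simp
  | succ j ih =>
    intro u hu
    rw [pick]
    split_ifs with h
    · rcases Nat.lt_succ_iff_lt_or_eq.1 hu with h' | rfl
      · exact (ih u h').trans h.le
      · rfl
    · rcases Nat.lt_succ_iff_lt_or_eq.1 hu with h' | rfl
      · exact ih u h'
      · exact not_lt.1 h

lemma pick_snd (j : ℕ) (h : (pick A n st j).1 ≠ 0) :
    (pick A n st j).2 < j ∧ score A n st (pick A n st j).2 = (pick A n st j).1 := by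
  induction j with
  | zero => simp [pick] at h
  | succ j ih =>
    rw [pick] at h ⊢
    split_ifs at h ⊢ with h'
    · exact ⟨Nat.lt_succ_self j, rfl⟩
    · exact ⟨(ih h).1.trans (Nat.lt_succ_self j), (ih h).2⟩

lemma Cfg.step_one {c : Cfg} (hu : c.st u = 1) : (c.step A n).st u = 1 := by
  rw [Cfg.step]
  split_ifs with h
  · exact hu
  · have h2 := (pick_snd n h).2
    have hne : u ≠ (pick A n c.st n).2 := by
      intro h'
      rw [score, ← h', if_neg (by omega)] at h2
      exact h h2.symm
    have : (c.act (pick A n c.st n).1 (pick A n c.st n).2).st u = 1 := by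
      rw [Cfg.act]; split_ifs <;> simp [hne, hu]
    rw [Cfg.settle]
    split_ifs <;> simp [this]

lemma Cfg.run_one (N : ℕ) {c : Cfg} (hu : c.st u = 1) : (c.run A n N).st u = 1 := by
  induction N generalizing c with
  | zero => exact hu
  | succ N ih => exact ih (c.step_one hu)

lemma Cfg.run_of_pick_eq_zero (N : ℕ) {c : Cfg} (h : (pick A n c.st n).1 = 0) :
    c.run A n N = c := by
  induction N with
  | zero => rfl
  | succ N ih => rw [Cfg.run, Cfg.step, if_pos h, ih]

/-- The kept vertices. -/
def kept (n : ℕ) (st : ℕ → ℕ) : Finset ℕ := cls n st 3 ∪ cls n st 4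

/-- The statuses `st'` provide a solution that extends `st` by at most `b` deletions. -/
def Solves (A : ℕ → ℕ → ℕ) (r n : ℕ) (st : ℕ → ℕ) (b : ℕ) (st' : ℕ → ℕ) : Prop :=
  (cls n st' 1).card ≤ (cls n st 1).card + b ∧
    Sparse A r ((kept n st ∪ cls n st 2) \ cls n st' 1)

lemma deg_kept : deg A v (kept n st) = deg A v (cls n st 3) + deg A v (cls n st 4) :=
  deg_union (disjoint_cls (by norm_num))

lemma disjoint_kept : Disjoint (kept n st) (cls n st 2) :=
  Finset.disjoint_union_left.2 ⟨disjoint_cls (by norm_num), disjoint_cls (by norm_num)⟩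

/-- The statuses after a step in which `v` got status `c` and no chain is in progress. -/
def settled (st : ℕ → ℕ) (v c : ℕ) : ℕ → ℕ :=
  fun u => if Function.update st v c u = 4 then 3 else Function.update st v c u

lemma cls_settled_four {c : ℕ} : cls n (settled st v c) 4 = ∅ := by
  ext x
  simp only [mem_cls, settled, Finset.notMem_empty, iff_false, not_and]
  intro _; split_ifs <;> omega

lemma cls_settled_of_ne {c d : ℕ} (h3 : d ≠ 3) (h4 : d ≠ 4) :
    cls n (settled st v c) d = cls n (Function.update st v c) d := by
  ext x
  simp only [mem_cls, settled]
  split_ifs <;> omega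

lemma kept_settled {c : ℕ} :
    kept n (settled st v c) = kept n (Function.update st v c) := by
  ext x
  simp only [kept, mem_cls, settled, Finset.mem_union]
  split_ifs <;> omega

lemma kept_update_four (hv : v < n) (h : st v = 2) :
    kept n (Function.update st v 4) = insert v (kept n st) := by
  rw [kept, cls_update_self hv, cls_update_of_ne (by norm_num), cls_erase (by omega),
    Finset.union_insert, kept]

lemma kept_update {c : ℕ} (hc : c ≠ 3) (hc' : c ≠ 4) (h : st v = 2) :
    kept n (Function.update st v c) = kept n st := by
  rw [kept, cls_update_of_ne hc, cls_update_of_ne hc', cls_erase (by omega), cls_erase (by omega),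
    kept]

/-- Completeness of the branching for at most `N` undecided vertices, outside a chain: if a solution
exists and the budget allows `m` choices, then some sequence `f` whose entries vanish from
position `m` on leads to a solution. -/
def FreshClaim (A : ℕ → ℕ → ℕ) (n r N : ℕ) : Prop :=
  ∀ (st : ℕ → ℕ) (b m : ℕ) (V : Finset ℕ), (cls n st 2).card ≤ N → cls n st 4 = ∅ →
    Base A r (cls n st 2) (kept n st) V b → Budget A r (cls n st 2) (kept n st) V b m →
    ∃ f : ℕ → ℕ, (∀ i, f i ≤ r + 1) ∧ (∀ i, m ≤ i → f i = 0) ∧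
      Solves A r n st b (Cfg.run A n N ⟨st, 0, f⟩).st

/-- Completeness of the branching for at most `N` undecided vertices, inside a chain: some value of
the counter and some sequence of further choices lead to a solution. The chain starts with `j = 1`, and the choice that
is read there equals the counter afterwards, so it is at most `r + 1`. -/
def ChainClaim (A : ℕ → ℕ → ℕ) (n r N : ℕ) : Prop :=
  ∀ (st : ℕ → ℕ) (b m : ℕ) (V C : Finset ℕ) (j : ℕ), (cls n st 2).card ≤ N →
    Base A r (cls n st 2) (kept n st) V b → ChainBudget A r (cls n st 2) (kept n st) V b m →
    Chain A r (cls n st 2) (cls n st 3) (cls n st 4) C j →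
    ∃ (cnt : ℕ) (f : ℕ → ℕ), 1 ≤ cnt ∧ cnt + j ≤ r + 2 ∧ (∀ i, f i ≤ r + 1) ∧
      (∀ i, m ≤ i → f i = 0) ∧ Solves A r n st b (Cfg.run A n N ⟨st, cnt, f⟩).st

/-- If no undecided vertex has an edge to the kept part, nothing more has to be deleted. -/
lemma Solves.zero (hA : ∀ u v, A u v = A v u) (h : Base A r (cls n st 2) (kept n st) V b)
    (h2 : ∀ u ∈ cls n st 2, deg A u (kept n st) = 0) :
    Solves A r n st b st := by
  refine ⟨by omega, Sparse.mono (h.sparse_kept.union hA h.sparse h2) Finset.sdiff_subset⟩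

/-- The solution after `v` has been moved to the kept part. -/
lemma Solves.keep {st' : ℕ → ℕ} (hv : v < n) (h2 : st v = 2)
    (h : Solves A r n (Function.update st v 4) b st') : Solves A r n st b st' := by
  obtain ⟨h1, hs⟩ := h
  rw [cls_update_of_ne (by norm_num), cls_erase (by omega)] at h1
  rw [kept_update_four hv h2, cls_update_of_ne (by norm_num)] at hs
  refine ⟨h1, hs.mono (Finset.sdiff_subset_sdiff (fun x => ?_) subset_rfl)⟩
  simp only [Finset.mem_union, Finset.mem_insert, Finset.mem_erase]
  tauto

lemma Solves.delete {st' : ℕ → ℕ} (hv : v < n) (h2 : st v = 2) (h' : st' v = 1)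
    (h : Solves A r n (Function.update st v 1) b st') : Solves A r n st (b + 1) st' := by
  obtain ⟨h1, hs⟩ := h
  rw [cls_update_self hv, Finset.card_insert_of_notMem (by simp [mem_cls, h2])] at h1
  rw [kept_update (by norm_num) (by norm_num) h2, cls_update_of_ne (by norm_num)] at hs
  refine ⟨by omega, hs.mono fun x => ?_⟩
  have hm : v ∈ cls n st' 1 := mem_cls.2 ⟨hv, h'⟩
  simp only [Finset.mem_union, Finset.mem_sdiff, Finset.mem_erase]
  rintro ⟨hx, hx'⟩
  refine ⟨?_, hx'⟩
  have : x ≠ v := by rintro rfl; exact hx' hm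
  tauto

/-- A vertex of degree at most one is irrelevant. -/
lemma Solves.discard (hA : ∀ u v, A u v = A v u) {st' : ℕ → ℕ} (hv : v < n) (h2 : st v = 2)
    (hd : deg A v (kept n st) + deg A v (cls n st 2) + A v v < 2)
    (h : Solves A r n (Function.update st v 5) b st') : Solves A r n st b st' := by
  obtain ⟨h1, hs⟩ := h
  rw [cls_update_of_ne (by norm_num), cls_erase (by omega)] at h1
  rw [kept_update (by norm_num) (by norm_num) h2, cls_update_of_ne (by norm_num)] at hs
  have hv2 : v ∈ cls n st 2 := mem_cls.2 ⟨hv, h2⟩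
  have hl : A v v ≤ deg A v (cls n st 2) :=
    Finset.single_le_sum (f := fun u => A v u) (fun _ _ => Nat.zero_le _) hv2
  refine ⟨h1, (hs.insert_pendant (v := v) hA (by omega) ?_).mono fun x => ?_⟩
  · refine (deg_mono (T := kept n st ∪ cls n st 2) fun x => ?_).trans ?_
    · simp only [Finset.mem_union, Finset.mem_sdiff, Finset.mem_erase]; tauto
    · rw [deg_union disjoint_kept]; omega
  · simp only [Finset.mem_union, Finset.mem_sdiff, Finset.mem_erase, Finset.mem_insert]; tauto

lemma Solves.settled {st' : ℕ → ℕ} {c : ℕ} (h : Solves A r n (settled st v c) b st') :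
    Solves A r n (Function.update st v c) b st' := by
  rwa [Solves, cls_settled_of_ne (by norm_num) (by norm_num), kept_settled,
    cls_settled_of_ne (by norm_num) (by norm_num)] at h

end

section

variable {A : ℕ → ℕ → ℕ} {n r b m j : ℕ} {st : ℕ → ℕ} {V C : Finset ℕ} {u v : ℕ}

/-- What the score says about the edges of an undecided vertex. -/
lemma score_spec (hv : st v = 2) :
    (score A n st v = 5 ∧ deg A v (kept n st) + deg A v (cls n st 2) + A v v < 2) ∨
    (2 ≤ deg A v (kept n st) + deg A v (cls n st 2) + A v v ∧
      ((score A n st v = 0 ∧ deg A v (kept n st) = 0) ∨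
      (score A n st v = 4 ∧ deg A v (kept n st) = 1 ∧ A v v = 0 ∧ deg A v (cls n st 2) = 1) ∨
      (score A n st v = 3 ∧ deg A v (kept n st) ≠ 0 ∧ 2 ≤ deg A v (kept n st) + A v v) ∨
      (score A n st v = 1 + deg A v (cls n st 4) ∧ deg A v (kept n st) = 1 ∧ A v v = 0 ∧
        2 ≤ deg A v (cls n st 2)))) := by
  have h := deg_kept (A := A) (n := n) (st := st) (v := v)
  rw [score, if_pos hv]
  split_ifs <;> omega

section budget
variable {U W : Finset ℕ}

lemma Budget.erase (h : Budget A r U W V b m) (v : ℕ) : Budget A r (U.erase v) W V b m :=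
  h.imp_right (Finset.card_erase_le.trans)

lemma Budget.delete (hv : v ∈ U) (h : Budget A r U W V (b + 1) (m + 1)) :
    Budget A r (U.erase v) W V b m := by
  have := Finset.card_erase_add_one hv
  unfold Budget at *
  omega

lemma ChainBudget.delete (h : ChainBudget A r U W V (b + 1) m) (v : ℕ) :
    Budget A r (U.erase v) W V b m := by
  have := Finset.card_erase_le (s := U) (a := v)
  unfold Budget ChainBudget at *
  omega

variable (hA : ∀ u v, A u v = A v u)
include hA

lemma Budget.free (hvW : v ∉ W) (hd : deg A v W = 1) (h : Budget A r U W V b m) :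
    Budget A r (U.erase v) (insert v W) V b m := by
  have := Finset.card_erase_le (s := U) (a := v)
  have := twiceEdges_insert hA hvW
  have := Finset.card_insert_of_notMem hvW
  unfold Budget at *
  omega

lemma Budget.drop (hv : v ∈ U) (hvW : v ∉ W) (hd : 2 ≤ deg A v W + A v v)
    (h : Budget A r U W V b (m + 1)) : Budget A r (U.erase v) (insert v W) V b m := by
  have := Finset.card_erase_add_one hv
  have := twiceEdges_insert hA hvW
  have := Finset.card_insert_of_notMem hvW
  unfold Budget at *
  omega

lemma Budget.start (hv : v ∈ U) (hvW : v ∉ W) (hd : deg A v W = 1)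
    (h : Budget A r U W V b (m + 1)) : ChainBudget A r (U.erase v) (insert v W) V b m := by
  have := Finset.card_erase_add_one hv
  have := twiceEdges_insert hA hvW
  have := Finset.card_insert_of_notMem hvW
  unfold Budget ChainBudget at *
  omega

lemma ChainBudget.drop (hvW : v ∉ W) (hd : 2 ≤ deg A v W + A v v)
    (h : ChainBudget A r U W V b m) : Budget A r (U.erase v) (insert v W) V b m := by
  have := Finset.card_erase_le (s := U) (a := v)
  have := twiceEdges_insert hA hvW
  have := Finset.card_insert_of_notMem hvW
  unfold Budget ChainBudget at *
  omega

lemma ChainBudget.extend (hvW : v ∉ W) (hd : deg A v W = 1)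
    (h : ChainBudget A r U W V b m) : ChainBudget A r (U.erase v) (insert v W) V b m := by
  have := Finset.card_erase_le (s := U) (a := v)
  have := twiceEdges_insert hA hvW
  have := Finset.card_insert_of_notMem hvW
  unfold ChainBudget at *
  omega

end budget

lemma cls_two_update {c : ℕ} (hc : c ≠ 2) :
    cls n (Function.update st v c) 2 = (cls n st 2).erase v := cls_update_of_ne hc

lemma cls_two_settled {c : ℕ} (hc : c ≠ 2) :
    cls n (settled st v c) 2 = (cls n st 2).erase v := by
  rw [cls_settled_of_ne (by norm_num) (by norm_num), cls_two_update hc]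

lemma settle_update {c : ℕ} {f : ℕ → ℕ} :
    Cfg.settle ⟨Function.update st v c, 0, f⟩ = ⟨settled st v c, 0, f⟩ := rfl

lemma notMem_kept (h : st v = 2) : v ∉ kept n st := by simp [kept, mem_cls, h]

lemma card_erase_le_of_mem {N : ℕ} (hv : v ∈ cls n st 2) (h : (cls n st 2).card ≤ N + 1) :
    ((cls n st 2).erase v).card ≤ N := by
  rw [Finset.card_erase_of_mem hv]; omega

variable (hA : ∀ u v, A u v = A v u)
include hA

omit hA in
lemma FreshClaim.of_delete {N : ℕ} (hF : FreshClaim A n r N) (hv : v ∈ cls n st 2)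
    (hcard : (cls n st 2).card ≤ N + 1)
    (hbase : Base A r ((cls n st 2).erase v) (kept n st) V b)
    (hbud : Budget A r ((cls n st 2).erase v) (kept n st) V b m) :
    ∃ f : ℕ → ℕ, (∀ i, f i ≤ r + 1) ∧ (∀ i, m ≤ i → f i = 0) ∧
      Solves A r n st (b + 1) (Cfg.run A n N ⟨settled st v 1, 0, f⟩).st := by
  obtain ⟨hvn, hv2⟩ := mem_cls.1 hv
  obtain ⟨f, hf, hf0, hs⟩ := hF (settled st v 1) b m V
    (by rw [cls_two_settled (by norm_num)]; exact card_erase_le_of_mem hv hcard)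
    cls_settled_four
    (by rwa [cls_two_settled (by norm_num), kept_settled,
      kept_update (by norm_num) (by norm_num) hv2])
    (by rwa [cls_two_settled (by norm_num), kept_settled,
      kept_update (by norm_num) (by norm_num) hv2])
  refine ⟨f, hf, hf0, Solves.delete hvn hv2 ?_ hs.settled⟩
  exact Cfg.run_one N (by simp [settled])

omit hA in
lemma FreshClaim.of_keep {N : ℕ} (hF : FreshClaim A n r N) (hv : v ∈ cls n st 2)
    (hcard : (cls n st 2).card ≤ N + 1)
    (hbase : Base A r ((cls n st 2).erase v) (insert v (kept n st)) V b)
    (hbud : Budget A r ((cls n st 2).erase v) (insert v (kept n st)) V b m) :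
    ∃ f : ℕ → ℕ, (∀ i, f i ≤ r + 1) ∧ (∀ i, m ≤ i → f i = 0) ∧
      Solves A r n st b (Cfg.run A n N ⟨settled st v 4, 0, f⟩).st := by
  obtain ⟨hvn, hv2⟩ := mem_cls.1 hv
  obtain ⟨f, hf, hf0, hs⟩ := hF (settled st v 4) b m V
    (by rw [cls_two_settled (by norm_num)]; exact card_erase_le_of_mem hv hcard)
    cls_settled_four
    (by rwa [cls_two_settled (by norm_num), kept_settled, kept_update_four hvn hv2])
    (by rwa [cls_two_settled (by norm_num), kept_settled, kept_update_four hvn hv2])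
  exact ⟨f, hf, hf0, hs.settled.keep hvn hv2⟩

omit hA in
lemma ChainClaim.of_keep {N : ℕ} (hC : ChainClaim A n r N) (hv : v ∈ cls n st 2)
    (hcard : (cls n st 2).card ≤ N + 1)
    (hbase : Base A r ((cls n st 2).erase v) (insert v (kept n st)) V b)
    (hbud : ChainBudget A r ((cls n st 2).erase v) (insert v (kept n st)) V b m)
    (hch : Chain A r ((cls n st 2).erase v) (cls n st 3) (insert v (cls n st 4)) C j) :
    ∃ (cnt : ℕ) (f : ℕ → ℕ), 1 ≤ cnt ∧ cnt + j ≤ r + 2 ∧ (∀ i, f i ≤ r + 1) ∧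
      (∀ i, m ≤ i → f i = 0) ∧
      Solves A r n st b (Cfg.run A n N ⟨Function.update st v 4, cnt, f⟩).st := by
  obtain ⟨hvn, hv2⟩ := mem_cls.1 hv
  obtain ⟨cnt, f, h1, h2, hf, hf0, hs⟩ := hC (Function.update st v 4) b m V C j
    (by rw [cls_two_update (by norm_num)]; exact card_erase_le_of_mem hv hcard)
    (by rwa [cls_two_update (by norm_num), kept_update_four hvn hv2])
    (by rwa [cls_two_update (by norm_num), kept_update_four hvn hv2])
    (by rwa [cls_two_update (by norm_num), cls_update_self hvn, cls_update_of_ne (by norm_num),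
      cls_erase (c := 3) (by omega)])
  exact ⟨cnt, f, h1, h2, hf, hf0, hs.keep hvn hv2⟩

omit hA in
/-- Prepending a choice to a stream of choices. -/
lemma exists_cons {f : ℕ → ℕ} {d : ℕ} (hf : ∀ i, f i ≤ r + 1) (hf0 : ∀ i, m ≤ i → f i = 0)
    (hd : d ≤ r + 1) : ∃ g : ℕ → ℕ, (∀ i, g i ≤ r + 1) ∧ (∀ i, m + 1 ≤ i → g i = 0) ∧
      g 0 = d ∧ (fun i => g (i + 1)) = f := by
  refine ⟨fun i => Nat.casesOn i d f, fun i => ?_, fun i hi => ?_, rfl, rfl⟩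
  · cases i with
    | zero => exact hd
    | succ i => exact hf i
  · cases i with
    | zero => omega
    | succ i => exact hf0 i (by omega)

theorem FreshClaim.succ {N : ℕ} (hF : FreshClaim A n r N) (hC : ChainClaim A n r N) :
    FreshClaim A n r (N + 1) := by
  intro st b m V hcard hK hbase hbud
  have hkept : kept n st = cls n st 3 := by rw [kept, hK, Finset.union_empty]
  by_cases h0 : (pick A n st n).1 = 0
  · refine ⟨fun _ => 0, by simp, by simp, ?_⟩
    rw [Cfg.run_of_pick_eq_zero _ h0]
    refine Solves.zero hA hbase fun u hu => ?_
    obtain ⟨hun, hu2⟩ := mem_cls.1 hu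
    have h1 := pick_le (A := A) (n := n) (st := st) n u hun
    have h2 := score_spec (A := A) (n := n) hu2
    omega
  obtain ⟨hvn, hsc⟩ := pick_snd n h0
  set v := (pick A n st n).2 with hvdef
  have hv2 : st v = 2 := by
    by_contra h
    rw [score, if_neg h] at hsc
    exact h0 hsc.symm
  have hv : v ∈ cls n st 2 := mem_cls.2 ⟨hvn, hv2⟩
  have hvW := notMem_kept (n := n) hv2
  have hmax : ∀ u ∈ cls n st 2, score A n st u ≤ score A n st v := fun u hu =>
    hsc ▸ pick_le n u (mem_cls.1 hu).1
  have hstep (f : ℕ → ℕ) : Cfg.run A n (N + 1) ⟨st, 0, f⟩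
      = Cfg.run A n N ((Cfg.act ⟨st, 0, f⟩ (score A n st v) v).settle) := by
    rw [Cfg.run, Cfg.step, if_neg h0, hsc]
  simp only [hstep]
  rcases score_spec (A := A) (n := n) hv2 with ⟨hs, hd⟩ | ⟨htot, ⟨hs, hd⟩ | ⟨hs, hd, hl, hU⟩ |
      ⟨hs, hd, hd2⟩ | ⟨hs, hd, hl, hU⟩⟩
  · -- a vertex of degree at most one
    obtain ⟨f, hf, hf0, hsol⟩ := hF (settled st v 5) b m V
      (by rw [cls_two_settled (by norm_num)]; exact card_erase_le_of_mem hv hcard)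
      cls_settled_four
      (by rw [cls_two_settled (by norm_num), kept_settled,
            kept_update (by norm_num) (by norm_num) hv2]; exact hbase.discard v)
      (by rw [cls_two_settled (by norm_num), kept_settled,
            kept_update (by norm_num) (by norm_num) hv2]; exact hbud.erase v)
    refine ⟨f, hf, hf0, ?_⟩
    rw [hs]
    exact hsol.settled.discard hA hvn hv2 hd
  · omega
  · -- a vertex of degree two with one edge to the kept part
    obtain ⟨f, hf, hf0, hsol⟩ := hF.of_keep hv hcard (hbase.free hA hv hd hl hU)
      (hbud.free hA hvW hd)
    refine ⟨f, hf, hf0, ?_⟩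
    rw [hs]
    exact hsol
  · -- keeping the vertex lowers the potential: branch, with choice `0` or `1`
    have hm := hbase.budget_pos hA hv hd hbud
    obtain ⟨m, rfl⟩ : ∃ m', m = m' + 1 := ⟨m - 1, by omega⟩
    rcases hbase.branch hA hv hd with ⟨b', rfl, hb'⟩ | hb'
    · obtain ⟨f, hf, hf0, hsol⟩ := hF.of_delete hv hcard hb' (hbud.delete hv)
      obtain ⟨g, hg, hg0, hgd, hgf⟩ := exists_cons hf hf0 (Nat.zero_le _)
      refine ⟨g, hg, hg0, ?_⟩
      simpa [hs, Cfg.act, Cfg.fetch, settle_update, hgd, hgf] using hsol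
    · obtain ⟨f, hf, hf0, hsol⟩ := hF.of_keep hv hcard hb' (hbud.drop hA hv hvW hd2)
      obtain ⟨g, hg, hg0, hgd, hgf⟩ := exists_cons hf hf0 (show 1 ≤ r + 1 by omega)
      refine ⟨g, hg, hg0, ?_⟩
      simpa [hs, Cfg.act, Cfg.fetch, settle_update, hgd, hgf] using hsol
  · -- keeping the vertex starts a chain: one choice covers all branchings within the chain
    have hm := hbase.budget_pos hA hv (by omega) hbud
    obtain ⟨m, rfl⟩ : ∃ m', m = m' + 1 := ⟨m - 1, by omega⟩
    rw [hK, deg_empty] at hs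
    rcases hbase.branch hA hv (by omega) with ⟨b', rfl, hb'⟩ | hb'
    · obtain ⟨f, hf, hf0, hsol⟩ := hF.of_delete hv hcard hb' (hbud.delete hv)
      obtain ⟨g, hg, hg0, hgd, hgf⟩ := exists_cons hf hf0 (Nat.zero_le _)
      refine ⟨g, hg, hg0, ?_⟩
      simpa [hs, Cfg.act, Cfg.fetch, settle_update, hgd, hgf] using hsol
    · obtain ⟨C, hch⟩ := Chain.start (W := cls n st 3) hA hbase.sparse hv hl hU
        (fun u hu => by
          have := hmax u hu
          have := score_spec (A := A) (n := n) (mem_cls.1 hu).2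
          rw [hkept] at this
          omega)
        (fun u hu h => by
          have := hmax u hu
          have := score_spec (A := A) (n := n) (mem_cls.1 hu).2
          rw [hkept] at this
          omega)
      obtain ⟨cnt, f, h1, h2, hf, hf0, hsol⟩ := hC.of_keep (C := C) (j := 1) hv hcard hb'
        (hbud.start hA hv hvW hd) (by rw [hK]; exact hch)
      obtain ⟨g, hg, hg0, hgd, hgf⟩ := exists_cons hf hf0 (show cnt ≤ r + 1 by omega)
      refine ⟨g, hg, hg0, ?_⟩
      have h3 : cnt ≠ 0 := by omega
      simpa [hs, Cfg.act, Cfg.fetch, Cfg.settle, hgd, hgf, h3] using hsol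

theorem ChainClaim.succ {N : ℕ} (hF : FreshClaim A n r N) (hC : ChainClaim A n r N) :
    ChainClaim A n r (N + 1) := by
  intro st b m V C j hcard hbase hbud hch
  obtain ⟨a, ha, haK⟩ := hch.exists_adj hA
  have hdk (u : ℕ) := deg_kept (A := A) (n := n) (st := st) (v := u)
  have htotal (u : ℕ) (hu : u ∈ cls n st 2) :
      2 ≤ deg A u (kept n st) + deg A u (cls n st 2) + A u u := by
    rw [hdk]; exact hch.total u hu
  have hadj := hdk a
  have hsa := score_spec (A := A) (n := n) (mem_cls.1 ha).2
  have hpa := pick_le (A := A) (n := n) (st := st) n a (mem_cls.1 ha).1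
  have h0 : (pick A n st n).1 ≠ 0 := by
    have := htotal a ha
    omega
  obtain ⟨hvn, hsc⟩ := pick_snd n h0
  set v := (pick A n st n).2 with hvdef
  have hv2 : st v = 2 := by
    by_contra h
    rw [score, if_neg h] at hsc
    exact h0 hsc.symm
  have hv : v ∈ cls n st 2 := mem_cls.2 ⟨hvn, hv2⟩
  have hvW := notMem_kept (n := n) hv2
  have hdis : Disjoint (cls n st 4) (cls n st 2) := disjoint_cls (by norm_num)
  have hmax : ∀ u ∈ cls n st 2, score A n st u ≤ score A n st v := fun u hu =>
    hsc ▸ pick_le n u (mem_cls.1 hu).1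
  have hstep (cnt : ℕ) (f : ℕ → ℕ) : Cfg.run A n (N + 1) ⟨st, cnt, f⟩
      = Cfg.run A n N ((Cfg.act ⟨st, cnt, f⟩ (score A n st v) v).settle) := by
    rw [Cfg.run, Cfg.step, if_neg h0, hsc]
  simp only [hstep]
  have hdv := hdk v
  have hle := hch.le
  rcases score_spec (A := A) (n := n) hv2 with ⟨hs, hd⟩ | ⟨htot, ⟨hs, hd⟩ | ⟨hs, hd, hl, hU⟩ |
      ⟨hs, hd, hd2⟩ | ⟨hs, hd, hl, hU⟩⟩
  · have := htotal v hv
    omega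
  · omega
  · -- a vertex of degree two with one edge to the kept part, which goes to the chain
    have hdK : deg A v (cls n st 4) = 1 := by
      by_contra h
      have := hch.stable v hv (by omega) (by omega)
      omega
    obtain ⟨cnt, f, h1, h2, hf, hf0, hsol⟩ := hC.of_keep (C := C) (j := j) hv hcard
      (hbase.free hA hv hd hl hU) (hbud.extend hA hvW hd)
      (hch.extend hA hdis hv hdK hl (by omega) hle)
    refine ⟨cnt, f, h1, h2, hf, hf0, ?_⟩
    have h3 : cnt ≠ 0 := by omega
    simpa [hs, Cfg.act, Cfg.settle, h3] using hsol
  · -- the chain ends: either the vertex is deleted, or keeping it closes a cycle, which lowers the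
    -- potential and so pays for the choice read at the start of the chain
    rcases hbase.branch hA hv hd with ⟨b', rfl, hb'⟩ | hb'
    · obtain ⟨f, hf, hf0, hsol⟩ := hF.of_delete hv hcard hb' (hbud.delete v)
      refine ⟨1, f, le_rfl, by omega, hf, hf0, ?_⟩
      simpa [hs, Cfg.act, Cfg.fetch, settle_update] using hsol
    · obtain ⟨f, hf, hf0, hsol⟩ := hF.of_keep hv hcard hb' (hbud.drop hA hvW hd2)
      refine ⟨2, f, by omega, by omega, hf, hf0, ?_⟩
      simpa [hs, Cfg.act, Cfg.fetch, settle_update] using hsol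
  · -- the chosen vertex is adjacent to the chain, since some vertex is
    have hvm := hmax a ha
    have hta := htotal a ha
    have hdv1 : deg A v (cls n st 4) = 1 := by omega
    have hs2 : score A n st v = 2 := by omega
    rcases hbase.branch hA hv (by omega) with ⟨b', rfl, hb'⟩ | hb'
    · obtain ⟨f, hf, hf0, hsol⟩ := hF.of_delete hv hcard hb' (hbud.delete v)
      refine ⟨1, f, le_rfl, by omega, hf, hf0, ?_⟩
      simpa [hs2, Cfg.act, Cfg.fetch, settle_update] using hsol
    · have hjr : j + 1 ≤ r := hch.lt hA hdis fun u hu => by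
        have := hmax u hu
        have := score_spec (A := A) (n := n) (mem_cls.1 hu).2
        omega
      obtain ⟨cnt, f, h1, h2, hf, hf0, hsol⟩ := hC.of_keep (C := C) (j := j + 1) hv hcard hb'
        (hbud.extend hA hvW hd) (hch.extend hA hdis hv hdv1 hl (by omega) hjr)
      refine ⟨cnt + 1, f, by omega, by omega, hf, hf0, ?_⟩
      have h3 : cnt ≠ 0 := by omega
      simpa [hs2, Cfg.act, Cfg.fetch, Cfg.settle, h3] using hsol

/-- The branching finds a solution if there is one, for a suitable sequence of choices. -/
theorem freshClaim (N : ℕ) : FreshClaim A n r N := by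
  suffices h : FreshClaim A n r N ∧ ChainClaim A n r N from h.1
  induction N with
  | zero =>
    constructor
    · intro st b m V hcard _ hbase _
      refine ⟨fun _ => 0, by simp, by simp, Solves.zero hA hbase fun u hu => ?_⟩
      rw [Finset.card_eq_zero.1 (Nat.le_zero.1 hcard)] at hu
      simp at hu
    · intro st b m V C j hcard _ _ hch
      obtain ⟨a, ha, -⟩ := hch.exists_adj hA
      rw [Finset.card_eq_zero.1 (Nat.le_zero.1 hcard)] at ha
      simp at ha
  | succ N ih => exact ⟨ih.1.succ hA ih.2, ChainClaim.succ hA ih.1 ih.2⟩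

end

section

/-! ### The compression step -/

/-- The number of vertices below `j` among those vertices up to `i` that `zf` marks. -/
def rank (i : ℕ) (zf : ℕ → ℕ) (j : ℕ) : ℕ :=
  ((Finset.range j).filter (fun u => u ≤ i ∧ zf u ≠ 0)).card

/-- The state before the branching on the subgraph induced by `0, …, i`: for each marked vertex a
choice decides whether it is deleted or kept, and the other vertices are undecided. -/
def start (n i : ℕ) (zf dig : ℕ → ℕ) : Cfg where
  st u := if i < u then 0 else if zf u = 0 then 2 else if dig (rank i zf u) = 0 then 1 else 3
  cnt := 0
  dig q := dig (rank i zf n + q)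

lemma rank_succ (i : ℕ) (zf : ℕ → ℕ) (j : ℕ) :
    rank i zf (j + 1) = rank i zf j + if j ≤ i ∧ zf j ≠ 0 then 1 else 0 := by
  rw [rank, Finset.range_add_one, Finset.filter_insert]
  split_ifs with h
  · rw [Finset.card_insert_of_notMem (by simp)]; rfl
  · rfl

lemma rank_mono (i : ℕ) (zf : ℕ → ℕ) : Monotone (rank i zf) :=
  monotone_nat_of_le_succ fun j => by rw [rank_succ]; omega

lemma rank_le (i : ℕ) (zf : ℕ → ℕ) (j : ℕ) : rank i zf j ≤ j :=
  (Finset.card_filter_le _ _).trans (by simp)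

/-- A sequence of choices that gives the marked vertices prescribed values. -/
lemma exists_choices (i : ℕ) (zf : ℕ → ℕ) (g : ℕ → ℕ) (hg : ∀ u, g u ≤ 1) (j : ℕ) :
    ∃ d : ℕ → ℕ, (∀ t, d t ≤ 1) ∧ ∀ u < j, u ≤ i → zf u ≠ 0 → d (rank i zf u) = g u := by
  induction j with
  | zero => exact ⟨fun _ => 0, by simp, by simp⟩
  | succ j ih =>
    obtain ⟨d, hd, hdu⟩ := ih
    refine ⟨Function.update d (rank i zf j) (g j), fun t => ?_, fun u hu hui hz => ?_⟩
    · rw [Function.update_apply]; split_ifs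
      · exact hg j
      · exact hd t
    · rcases Nat.lt_succ_iff_lt_or_eq.1 hu with h | rfl
      · have h1 := rank_mono i zf (show u + 1 ≤ j by omega)
        rw [rank_succ, if_pos ⟨hui, hz⟩] at h1
        rw [Function.update_of_ne (by omega), hdu u h hui hz]
      · simp

variable {A : ℕ → ℕ → ℕ} {n r k i : ℕ} {zf st : ℕ → ℕ}

/-- The set of deleted vertices is a solution for the subgraph induced by `0, …, i`. -/
def Valid (A : ℕ → ℕ → ℕ) (n r k i : ℕ) (st : ℕ → ℕ) : Prop :=
  (cls n st 1).card ≤ k ∧ Sparse A r (Finset.range (i + 1) \ cls n st 1)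

/-- The statuses after the branching. -/
def outcome (A : ℕ → ℕ → ℕ) (n i : ℕ) (zf dig : ℕ → ℕ) : ℕ → ℕ :=
  (Cfg.run A n n (start n i zf dig)).st

/-- If the marked vertices are a solution of size at most `k + 1` and there is one of size at
most `k`, then some short sequence of choices makes the branching find such a solution. -/
theorem exists_valid_outcome (hA : ∀ u v, A u v = A v u) (hi : i < n)
    (hcard : rank i zf n ≤ k + 1)
    (hz : Sparse A r ((Finset.range (i + 1)).filter (fun u => zf u = 0)))
    (hsol : ∃ X : Finset ℕ, X.card ≤ k ∧ Sparse A r (Finset.range (i + 1) \ X))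
    {L : ℕ} (hL : n ≤ L ∨ (k + 1) * (r + 3) ≤ L) :
    ∃ dig : ℕ → ℕ, (∀ t, dig t ≤ r + 1) ∧ (∀ t, L ≤ t → dig t = 0) ∧
      Valid A n r k i (outcome A n i zf dig) := by
  classical
  obtain ⟨X, hX, hs⟩ := hsol
  obtain ⟨d, hd1, hd⟩ := exists_choices i zf (fun u => if u ∈ X then 0 else 1)
    (fun u => by split_ifs <;> omega) n
  let z := rank i zf n
  let Z := (Finset.range n).filter (fun u => u ≤ i ∧ zf u ≠ 0)
  have hZ : Z.card = z := rfl
  -- the statuses at the start, which depend only on the first `z` choices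
  let st : ℕ → ℕ := fun u =>
    if i < u then 0 else if zf u = 0 then 2 else if u ∈ X then 1 else 3
  have h1 : cls n st 1 = Z ∩ X := by
    ext u
    simp only [mem_cls, st, Z, Finset.mem_inter, Finset.mem_filter, Finset.mem_range]
    split_ifs <;> simp_all
  have h2 : cls n st 2 = (Finset.range (i + 1)).filter (fun u => zf u = 0) := by
    ext u
    simp only [mem_cls, st, Finset.mem_filter, Finset.mem_range]
    split_ifs <;> simp_all
    omega
  have h3 : cls n st 3 = Z \ X := by
    ext u
    simp only [mem_cls, st, Z, Finset.mem_sdiff, Finset.mem_filter, Finset.mem_range]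
    split_ifs <;> simp_all
  have h4 : cls n st 4 = ∅ := by
    ext u
    simp only [mem_cls, st, Finset.notMem_empty]
    split_ifs <;> simp_all
  have hk : kept n st = Z \ X := by rw [kept, h3, h4, Finset.union_empty]
  have hzX : (Z ∩ X).card + (X \ Z).card = X.card := by
    rw [Finset.inter_comm]; exact Finset.card_inter_add_card_sdiff X Z
  have hZX : (Z ∩ X).card + (Z \ X).card = z := Finset.card_inter_add_card_sdiff Z X
  have hzn : z ≤ n := rank_le i zf n
  have hU : (cls n st 2).card + z ≤ n := by
    have hdis : Disjoint (cls n st 2) Z := by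
      rw [Finset.disjoint_left, h2]
      intro u hu hu'
      simp only [Finset.mem_filter, Z] at hu hu'
      exact hu'.2.2 hu.2
    rw [← hZ, ← Finset.card_union_of_disjoint hdis]
    have : cls n st 2 ∪ Z ⊆ Finset.range n := by
      intro u; simp only [Z, Finset.mem_union, mem_cls, Finset.mem_filter]; simp; tauto
    simpa using Finset.card_le_card this
  have hbase : Base A r (cls n st 2) (kept n st) (kept n st) (k - (Z ∩ X).card) := by
    refine ⟨disjoint_kept, h2 ▸ hz, ⟨cls n st 2 ∩ X, Finset.inter_subset_left, ?_, ?_⟩,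
      fun T hT hne _ => by rwa [Finset.inter_eq_left.2 hT]⟩
    · have : cls n st 2 ∩ X ⊆ X \ Z := by
        intro u
        simp only [h2, Z, Finset.mem_inter, Finset.mem_filter, Finset.mem_sdiff]
        tauto
      have := Finset.card_le_card this
      omega
    · refine hs.mono fun u => ?_
      rw [hk, h2]
      simp only [Z, Finset.mem_inter, Finset.mem_filter, Finset.mem_sdiff, Finset.mem_union,
        Finset.mem_range]
      rintro ⟨h | h, h'⟩
      · exact ⟨by omega, h.2⟩
      · exact ⟨h.1, fun hX => h' ⟨h, hX⟩⟩
  -- at most `k + 1` choices are spent on the marked vertices, and the potential at the start is at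
  -- most `k + (r + 1) (k + 1)`
  have hbud : Budget A r (cls n st 2) (kept n st) (kept n st) (k - (Z ∩ X).card) (L - z) := by
    rcases hL with hL | hL
    · right; omega
    · left
      rw [hk]
      have hz1 : z ≤ k + 1 := hcard
      have hw : (Z \ X).card + (Z ∩ X).card ≤ k + 1 := by omega
      have h5 : r * (Z \ X).card ≤ r * (k + 1) := Nat.mul_le_mul_left _ (by omega)
      have h6 : (k + 1) * (r + 3) = r * (k + 1) + 3 * (k + 1) := by ring
      have h7 : (k + 1) * (r + 3) - (k + 1) ≤ L - z := by omega
      have h8 : 2 * r * (Z \ X).card = 2 * (r * (Z \ X).card) := by ring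
      have : (Z ∩ X).card ≤ k := by omega
      omega
  obtain ⟨f, hf, hf0, hsolve⟩ := freshClaim hA n st (k - (Z ∩ X).card) (L - z) (kept n st)
    (by omega) h4 hbase hbud
  let dig : ℕ → ℕ := fun t => if t < z then d t else f (t - z)
  have hstart : start n i zf dig = ⟨st, 0, f⟩ := by
    rw [start, Cfg.mk.injEq]
    refine ⟨?_, rfl, ?_⟩
    · funext u
      by_cases hu : i < u
      · simp [st, hu]
      by_cases hzu : zf u = 0
      · simp [st, hu, hzu]
      have hlt : rank i zf u < z := by
        have h1 := rank_mono i zf (show u + 1 ≤ n by omega)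
        rw [rank_succ, if_pos ⟨by omega, hzu⟩] at h1
        exact h1
      have hdu := hd u (by omega) (by omega) hzu
      by_cases hX : u ∈ X <;> simp [st, hu, hzu, dig, hlt, hdu, hX]
    · funext q
      simp [dig, z]
  refine ⟨dig, fun t => ?_, fun t ht => ?_, ?_⟩
  · simp only [dig]
    split_ifs
    · exact (hd1 t).trans (by omega)
    · exact hf _
  · have hzL : z ≤ L := by
      rcases hL with hL | hL
      · omega
      · have h1 : k + 1 ≤ (k + 1) * (r + 3) := Nat.le_mul_of_pos_right _ (by omega)
        have h2 : z ≤ k + 1 := hcard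
        omega
    simp only [dig]
    rw [if_neg (by omega)]
    exact hf0 _ (by omega)
  · rw [outcome, hstart]
    obtain ⟨hc, hs'⟩ := hsolve
    have hone : ∀ u ∈ cls n st 1, u ∈ cls n (Cfg.run A n n ⟨st, 0, f⟩).st 1 := fun u hu =>
      mem_cls.2 ⟨(mem_cls.1 hu).1, Cfg.run_one n (mem_cls.1 hu).2⟩
    refine ⟨?_, hs'.mono fun u => ?_⟩
    · rw [h1] at hc
      have : (Z ∩ X).card ≤ k := by omega
      omega
    · simp only [Finset.mem_sdiff, Finset.mem_range]
      rintro ⟨hu, hu'⟩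
      refine ⟨?_, hu'⟩
      have hn1 : u ∉ cls n st 1 := fun h => hu' (hone u h)
      rw [h1] at hn1
      rw [hk, h2]
      simp only [Z, Finset.mem_inter, Finset.mem_filter, Finset.mem_sdiff, Finset.mem_union,
        Finset.mem_range] at hn1 ⊢
      by_cases hzu : zf u = 0
      · exact Or.inr ⟨hu, hzu⟩
      · have : u < n ∧ u ≤ i ∧ zf u ≠ 0 := ⟨by omega, by omega, hzu⟩
        tauto

/-! ### Verifying a candidate -/

/-- One search step: the vertex `v`, if unmarked and adjacent to the set of vertices with mark `1`,
joins that set. The second component is the excess of the set. -/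
def visit (A : ℕ → ℕ → ℕ) (n v : ℕ) (p : (ℕ → ℕ) × ℕ) : (ℕ → ℕ) × ℕ :=
  if p.1 v = 0 ∧ 0 < deg A v (cls n p.1 1) then
    (Function.update p.1 v 1, p.2 + deg A v (cls n p.1 1) + A v v - 1)
  else p

/-- Visit all vertices below `j`. -/
def pass (A : ℕ → ℕ → ℕ) (n : ℕ) : ℕ → (ℕ → ℕ) × ℕ → (ℕ → ℕ) × ℕ
  | 0, p => p
  | j + 1, p => visit A n j (pass A n j p)

/-- Repeat the pass over all vertices `t` times. -/
def rounds (A : ℕ → ℕ → ℕ) (n : ℕ) : ℕ → (ℕ → ℕ) × ℕ → (ℕ → ℕ) × ℕ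
  | 0, p => p
  | t + 1, p => pass A n n (rounds A n t p)

/-- The search from `s`; the vertices of mark `2` are absent. -/
def search (A : ℕ → ℕ → ℕ) (n : ℕ) (mk : ℕ → ℕ) (s : ℕ) : (ℕ → ℕ) × ℕ :=
  rounds A n n (Function.update mk s 1, A s s)

/-- The invariant of the search in the vertex set `Y`: the vertices with mark `1` form a connected
set, whose number of edges minus its number of vertices plus one is the second component. -/
structure SearchInv (A : ℕ → ℕ → ℕ) (n : ℕ) (Y : Finset ℕ) (s : ℕ) (p : (ℕ → ℕ) × ℕ) : Prop where
  union : cls n p.1 0 ∪ cls n p.1 1 = Y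
  mem : s ∈ cls n p.1 1
  conn : Conn A (cls n p.1 1)
  excess : 2 * p.2 + 2 * (cls n p.1 1).card = twiceEdges A (cls n p.1 1) + 2

section
variable {Y : Finset ℕ} {s v : ℕ} {p : (ℕ → ℕ) × ℕ}

lemma SearchInv.visit (hA : ∀ u v, A u v = A v u) (hv : v < n) (h : SearchInv A n Y s p) :
    SearchInv A n Y s (visit A n v p) := by
  rw [PseudoforestDeletion.visit]
  split_ifs with hc
  · have h1 : v ∉ cls n p.1 1 := by simp [mem_cls, hc.1]
    have h0 : v ∈ cls n p.1 0 := mem_cls.2 ⟨hv, hc.1⟩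
    refine ⟨?_, ?_, ?_, ?_⟩ <;> simp only [cls_update_self hv]
    · rw [cls_update_of_ne (by norm_num), ← h.union]
      ext x
      simp only [Finset.mem_union, Finset.mem_erase, Finset.mem_insert]
      by_cases hx : x = v <;> simp [hx, h0]
    · simp [h.mem]
    · exact h.conn.insert_adj hA (by omega)
    · rw [twiceEdges_insert hA h1, Finset.card_insert_of_notMem h1]
      have := h.excess
      omega
  · exact h

lemma SearchInv.pass (hA : ∀ u v, A u v = A v u) (h : SearchInv A n Y s p) {j : ℕ}
    (hj : j ≤ n) : SearchInv A n Y s (pass A n j p) := by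
  induction j with
  | zero => exact h
  | succ j ih => exact (ih (by omega)).visit hA (by omega)

lemma SearchInv.rounds (hA : ∀ u v, A u v = A v u) (h : SearchInv A n Y s p) (t : ℕ) :
    SearchInv A n Y s (rounds A n t p) := by
  induction t with
  | zero => exact h
  | succ t ih => exact ih.pass hA le_rfl

lemma SearchInv.init {mk : ℕ → ℕ} (hY : cls n mk 0 = Y) (h1 : cls n mk 1 = ∅) (hs : s ∈ Y) :
    SearchInv A n Y s (Function.update mk s 1, A s s) := by
  have hsn : s < n := by rw [← hY] at hs; exact (mem_cls.1 hs).1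
  have hc : cls n (Function.update mk s 1) 1 = {s} := by
    rw [cls_update_self hsn, h1]; rfl
  refine ⟨?_, ?_, ?_, ?_⟩ <;> simp only [hc]
  · rw [cls_update_of_ne (by norm_num), hY, Finset.union_comm, ← Finset.insert_eq,
      Finset.insert_erase hs]
  · simp
  · exact conn_singleton s
  · simp [twiceEdges, deg]; ring

/-- A pass either finds that the search is finished, or it marks a vertex. -/
lemma pass_dichotomy (p : (ℕ → ℕ) × ℕ) {j : ℕ} (hj : j ≤ n) :
    (pass A n j p = p ∧ ∀ v < j, p.1 v = 0 → deg A v (cls n p.1 1) = 0) ∨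
      (cls n (pass A n j p).1 0).card < (cls n p.1 0).card := by
  induction j with
  | zero => exact Or.inl ⟨rfl, by simp⟩
  | succ j ih =>
    rw [pass, visit]
    rcases ih (by omega) with ⟨h, hd⟩ | h
    · rw [h]
      split_ifs with hc
      · right
        have h0 : j ∈ cls n p.1 0 := mem_cls.2 ⟨by omega, hc.1⟩
        rw [cls_update_of_ne (by norm_num)]
        exact Finset.card_erase_lt_of_mem h0
      · refine Or.inl ⟨rfl, fun v hv h0 => ?_⟩
        rcases Nat.lt_succ_iff_lt_or_eq.1 hv with hv | rfl
        · exact hd v hv h0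
        · by_contra h'
          exact hc ⟨h0, Nat.pos_of_ne_zero h'⟩
    · right
      split_ifs
      · rw [cls_update_of_ne (by norm_num)]
        exact (Finset.card_erase_le).trans_lt h
      · exact h

/-- After `t` rounds either no edge leaves the marked set, or at least `t` vertices have joined it. -/
lemma rounds_closed (p : (ℕ → ℕ) × ℕ) (t : ℕ) :
    (∀ v < n, (rounds A n t p).1 v = 0 → deg A v (cls n (rounds A n t p).1 1) = 0) ∨
      (cls n (rounds A n t p).1 0).card + t ≤ (cls n p.1 0).card := by
  induction t with
  | zero => exact Or.inr le_rfl
  | succ t ih =>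
    rw [rounds]
    rcases pass_dichotomy (A := A) (rounds A n t p) le_rfl with ⟨h, hd⟩ | h
    · left; rw [h]; exact hd
    · rcases ih with ih | ih
      · exfalso
        have hfix : ∀ j, j ≤ n → pass A n j (rounds A n t p) = rounds A n t p := by
          intro j hj
          induction j with
          | zero => rfl
          | succ j ihj =>
            rw [pass, ihj (by omega), visit, if_neg]
            rintro ⟨h0, h1⟩
            have := ih j (by omega) h0
            omega
        rw [hfix n le_rfl] at h
        omega
      · right; omega

/-- The search from every vertex of `Y` decides whether `Y` induces an `r`-pseudoforest. -/
theorem sparse_iff_search (hA : ∀ u v, A u v = A v u) {mk : ℕ → ℕ} (hY : cls n mk 0 = Y)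
    (h1 : cls n mk 1 = ∅) : Sparse A r Y ↔ ∀ s < n, mk s = 0 → (search A n mk s).2 ≤ r := by
  have hinv : ∀ s ∈ Y, SearchInv A n Y s (search A n mk s) := fun s hs =>
    (SearchInv.init hY h1 hs).rounds hA n
  constructor
  · intro h s hs h0
    have hi := hinv s (by rw [← hY]; exact mem_cls.2 ⟨hs, h0⟩)
    have := h _ (hi.union ▸ Finset.subset_union_right) hi.conn
    have := hi.excess
    omega
  · intro h S hSY hS
    obtain ⟨s, hs⟩ := hS.nonempty
    have hsY := hSY hs
    obtain ⟨hsn, hs0⟩ := mem_cls.1 (hY ▸ hsY)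
    have hi := hinv s hsY
    have hcl : Closed A Y (cls n (search A n mk s).1 1) := by
      intro u hu huS
      rw [← hi.union, Finset.mem_union] at hu
      have hu0 := mem_cls.1 (hu.resolve_right huS)
      rcases rounds_closed (A := A) (n := n) (Function.update mk s 1, A s s) n with hr | hr
      · exact hr u hu0.1 hu0.2
      · have hlt : (cls n (Function.update mk s 1) 0).card < n := by
          refine (Finset.card_lt_card (t := Finset.range n) ⟨Finset.filter_subset _ _, ?_⟩).trans_eq
            (by simp)
          intro hsub
          have := hsub (Finset.mem_range.2 hsn)
          simp at this
        dsimp only at hr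
        omega
    have hsub := hS.subset_of_closed hA hSY hcl ⟨s, Finset.mem_inter.2 ⟨hs, hi.mem⟩⟩
    have := hS.excess_mono hA hi.conn hsub
    have := hi.excess
    have := h s hsn hs0
    omega

end

end

/-! ### Pseudoforests and edge counts -/

section
variable {β : Type*} {G : Graph ℕ β} {E F : Finset β} {S C : Finset ℕ}

/-- The edge set `F` contains no cycle of `G`. -/
def Acyclic (G : Graph ℕ β) (F : Finset β) : Prop :=
  ∀ (m : ℕ) (x : ℕ → ℕ) (e : ℕ → β), (∀ i < m, e i ∈ F) → ¬ IsCycle G m x e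

open Classical in
/-- The edges of `E` with both ends in `S`. -/
noncomputable def edgesIn (G : Graph ℕ β) (E : Finset β) (S : Finset ℕ) : Finset β :=
  E.filter (fun e => ∃ x ∈ S, ∃ y ∈ S, G.IsLink e x y)

lemma mem_edgesIn {e : β} :
    e ∈ edgesIn G E S ↔ e ∈ E ∧ ∃ x ∈ S, ∃ y ∈ S, G.IsLink e x y := by
  classical simp [edgesIn]

lemma mem_of_mem_edgesIn {e : β} {x y : ℕ} (h : e ∈ edgesIn G E S) (hl : G.IsLink e x y) :
    x ∈ S := by
  obtain ⟨-, a, ha, b, hb, h'⟩ := mem_edgesIn.1 h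
  rcases hl.left_eq_or_eq h' with rfl | rfl <;> assumption

/-- If every vertex is incident with two edges, then there is a cycle: follow a walk that never
returns along the edge just used, until it meets itself. -/
lemma exists_isCycle {V : Finset ℕ} {v₀ : ℕ} {e₀ : β} (hv₀ : v₀ ∈ V)
    (h : ∀ v ∈ V, ∀ e : β, ∃ e' ∈ F, e' ≠ e ∧ ∃ w ∈ V, G.IsLink e' v w) :
    ¬ Acyclic G F := by
  have : Nonempty β := ⟨e₀⟩
  choose! f hfF hfne g hgV hlink using h
  let s : ℕ → ℕ × β := fun i => Nat.rec (v₀, e₀) (fun _ p => (g p.1 p.2, f p.1 p.2)) i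
  have hs (i : ℕ) : s (i + 1) = (g (s i).1 (s i).2, f (s i).1 (s i).2) := rfl
  have hV (i : ℕ) : (s i).1 ∈ V := by
    induction i with
    | zero => exact hv₀
    | succ i ih => rw [hs]; exact hgV _ ih _
  have hl (i : ℕ) : G.IsLink (s (i + 1)).2 (s i).1 (s (i + 1)).1 := by
    rw [hs]; exact hlink _ (hV i) _
  have hF (i : ℕ) : (s (i + 1)).2 ∈ F := by
    rw [hs]; exact hfF _ (hV i) _
  have hne (i : ℕ) : (s (i + 2)).2 ≠ (s (i + 1)).2 := by
    rw [hs (i + 1)]; exact hfne _ (hV (i + 1)) _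
  have hex : ∃ j, ∃ i < j, (s i).1 = (s j).1 := by
    obtain ⟨a, b, hab, heq⟩ := Finite.exists_ne_map_eq_of_infinite
      (fun i : ℕ => (⟨(s i).1, hV i⟩ : V))
    have heq' : (s a).1 = (s b).1 := congrArg Subtype.val heq
    rcases Nat.lt_or_gt_of_ne hab with h | h
    · exact ⟨b, a, h, heq'⟩
    · exact ⟨a, b, h, heq'.symm⟩
  classical
  obtain ⟨i, hij, heq⟩ := Nat.find_spec hex
  set j := Nat.find hex with hj
  have hinj : ∀ a b, a < b → b < j → (s a).1 ≠ (s b).1 := fun a b hab hb h' =>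
    Nat.find_min hex hb ⟨a, hab, h'⟩
  have hinje : ∀ a b, a < b → b < j → (s (a + 1)).2 ≠ (s (b + 1)).2 := by
    intro a b hab hb h'
    rcases (hl a).eq_and_eq_or_eq_and_eq (h' ▸ hl b) with ⟨h1, -⟩ | ⟨-, h2⟩
    · exact hinj a b hab hb h1
    · rcases Nat.lt_or_ge (a + 1) b with h3 | h3
      · exact hinj (a + 1) b h3 hb h2
      · obtain rfl : b = a + 1 := by omega
        exact hne a h'.symm
  intro hac
  refine hac (j - i) (fun t => (s (i + t)).1) (fun t => (s (i + t + 1)).2)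
    (fun t _ => hF _) ⟨by omega, ?_, ?_, ?_, fun t _ => hl _⟩
  · dsimp only
    rw [show i + (j - i) = j by omega, Nat.add_zero]; exact heq.symm
  · intro a ha b hb h'
    simp only [Set.mem_Iio] at ha hb
    rcases lt_trichotomy a b with h1 | h1 | h1
    · exact absurd h' (hinj _ _ (by omega) (by omega))
    · exact h1
    · exact absurd h'.symm (hinj _ _ (by omega) (by omega))
  · intro a ha b hb h'
    simp only [Set.mem_Iio] at ha hb
    rcases lt_trichotomy a b with h1 | h1 | h1
    · exact absurd h' (hinje _ _ (by omega) (by omega))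
    · exact h1
    · exact absurd h'.symm (hinje _ _ (by omega) (by omega))

/-- A forest has fewer edges than vertices. -/
lemma Acyclic.card_lt (hF : Acyclic G F) (hS : S.Nonempty)
    (h : ∀ e ∈ F, ∃ x ∈ S, ∃ y ∈ S, G.IsLink e x y) : F.card + 1 ≤ S.card := by
  classical
  induction hn : S.card generalizing S F with
  | zero => simp at hn; simp [hn] at hS
  | succ n ih =>
    have hloop : ∀ e ∈ F, ∀ x, ¬ G.IsLink e x x := fun e he x hl =>
      hF 1 (fun _ => x) (fun _ => e) (fun _ _ => he) ⟨le_rfl, rfl, fun a ha b hb _ => by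
        simp only [Set.mem_Iio] at ha hb; omega, fun a ha b hb _ => by
        simp only [Set.mem_Iio] at ha hb; omega, fun _ _ => hl⟩
    by_cases hv : ∃ v ∈ S, (F.filter (fun e => G.Inc e v)).card ≤ 1
    · obtain ⟨v, hvS, hv⟩ := hv
      have hcard := Finset.card_filter_add_card_filter_not (s := F) (fun e => G.Inc e v)
      have hac : Acyclic G (F.filter (fun e => ¬ G.Inc e v)) := fun m x e he =>
        hF m x e fun i hi => Finset.mem_of_mem_filter _ (he i hi)
      have hends : ∀ e ∈ F.filter (fun e => ¬ G.Inc e v),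
          ∃ x ∈ S.erase v, ∃ y ∈ S.erase v, G.IsLink e x y := by
        intro e he
        rw [Finset.mem_filter] at he
        obtain ⟨x, hx, y, hy, hl⟩ := h e he.1
        refine ⟨x, Finset.mem_erase.2 ⟨?_, hx⟩, y, Finset.mem_erase.2 ⟨?_, hy⟩, hl⟩
        · rintro rfl; exact he.2 hl.inc_left
        · rintro rfl; exact he.2 hl.inc_right
      have hc := Finset.card_erase_add_one hvS
      rcases (S.erase v).eq_empty_or_nonempty with h0 | hne
      · have hF0 : F = ∅ := by
          rw [Finset.eq_empty_iff_forall_notMem]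
          intro e he
          obtain ⟨x, hx, y, hy, hl⟩ := h e he
          have hS1 : S = {v} := by
            rw [Finset.erase_eq_empty_iff] at h0
            rcases h0 with h0 | h0
            · simp [h0] at hvS
            · exact h0
          rw [hS1, Finset.mem_singleton] at hx hy
          subst hx hy
          exact hloop e he _ hl
        simp [hF0]
      · have := ih hac hne hends (by omega)
        omega
    · push Not at hv
      obtain ⟨v₀, hv₀⟩ := hS
      obtain ⟨e₀, -⟩ := Finset.card_pos.1 ((Nat.zero_lt_one).trans (hv v₀ hv₀))
      refine absurd hF (exists_isCycle (e₀ := e₀) hv₀ fun v hv' e => ?_)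
      obtain ⟨e', he', hne⟩ := Finset.exists_mem_ne (hv v hv') e
      rw [Finset.mem_filter] at he'
      obtain ⟨x, hx, y, hy, hl⟩ := h e' he'.1
      obtain ⟨w, hw⟩ := he'.2
      refine ⟨e', he'.1, hne, w, ?_, hw⟩
      rcases hw.right_eq_or_eq hl with rfl | rfl <;> assumption

/-- The edges of `F` connect the vertex set `C`. -/
def Connects (G : Graph ℕ β) (F : Finset β) (C : Finset ℕ) : Prop :=
  ∀ T ⊆ C, T.Nonempty → T ≠ C → ∃ u ∈ T, ∃ v ∈ C, v ∉ T ∧ ∃ e ∈ F, G.IsLink e u v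

lemma Connects.card_le (h : Connects G F C) (hC : C.Nonempty) : C.card ≤ F.card + 1 := by
  suffices hs : ∀ t < C.card, ∃ S ⊆ C, S.card = t + 1 ∧ t ≤ (edgesIn G F S).card by
    obtain ⟨S, -, -, h1⟩ := hs (C.card - 1) (by have := hC.card_pos; omega)
    have : (edgesIn G F S).card ≤ F.card := by
      classical
      exact Finset.card_filter_le _ _
    omega
  intro t ht
  induction t with
  | zero =>
    obtain ⟨v, hv⟩ := hC
    exact ⟨{v}, by simpa using hv, by simp, Nat.zero_le _⟩
  | succ t ih =>
    obtain ⟨S, hSC, hcard, hle⟩ := ih (by omega)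
    obtain ⟨u, hu, v, hv, hvS, e, he, hl⟩ := h S hSC (Finset.card_pos.1 (by omega))
      (by rintro rfl; omega)
    refine ⟨insert v S, Finset.insert_subset hv hSC, by
      rw [Finset.card_insert_of_notMem hvS, hcard], ?_⟩
    have hlt : (edgesIn G F S).card < (edgesIn G F (insert v S)).card := by
      refine Finset.card_lt_card ⟨fun e' he' => ?_, fun hsub => ?_⟩
      · obtain ⟨h1, x, hx, y, hy, h2⟩ := mem_edgesIn.1 he'
        exact mem_edgesIn.2 ⟨h1, x, by simp [hx], y, by simp [hy], h2⟩
      · have : e ∈ edgesIn G F S := hsub (mem_edgesIn.2 ⟨he, u, by simp [hu], v, by simp, hl⟩)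
        exact hvS (mem_of_mem_edgesIn this hl.symm)
    omega

/-- A connected set has a spanning tree: a minimal connecting edge set is acyclic. -/
lemma Connects.exists_acyclic (h : Connects G F C)
    (hF : ∀ e ∈ F, ∃ x ∈ C, ∃ y ∈ C, G.IsLink e x y) :
    ∃ F' ⊆ F, Acyclic G F' ∧ Connects G F' C := by
  classical
  obtain ⟨F', hF', hmin⟩ := Finset.exists_min_image
    (F.powerset.filter (fun F' => Connects G F' C)) Finset.card ⟨F, by simp [h]⟩
  simp only [Finset.mem_filter, Finset.mem_powerset] at hF' hmin
  refine ⟨F', hF'.1, fun m x e he hcyc => ?_, hF'.2⟩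
  obtain ⟨hm, hx0, -, hinj, hlink⟩ := hcyc
  have h0 : e 0 ∈ F' := he 0 (by omega)
  have hxC : ∀ i < m, x i ∈ C ∧ x (i + 1) ∈ C := by
    intro i hi
    obtain ⟨a, ha, b, hb, hl⟩ := hF _ (hF'.1 (he i hi))
    constructor
    · rcases (hlink i hi).left_eq_or_eq hl with h | h <;> rw [h] <;> assumption
    · rcases (hlink i hi).right_eq_or_eq hl with h | h <;> rw [h] <;> assumption
  have hcon : Connects G (F'.erase (e 0)) C := by
    intro T hT hne hTC
    obtain ⟨u, hu, v, hv, hvT, f, hf, hl⟩ := hF'.2 T hT hne hTC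
    by_cases hfe : f = e 0
    · -- the rest of the cycle also crosses from `T` to its complement
      have hends : (x 1 ∈ T) ≠ (x m ∈ T) := by
        rw [hx0]
        rcases (hlink 0 (by omega)).eq_and_eq_or_eq_and_eq (hfe ▸ hl) with ⟨h1, h2⟩ | ⟨h1, h2⟩
        · rw [h1]; simp only [zero_add] at h2; rw [h2]; simp [hu, hvT]
        · rw [h1]; simp only [zero_add] at h2; rw [h2]; simp [hu, hvT]
      have hcross : ∃ i, 1 ≤ i ∧ i < m ∧ (x i ∈ T) ≠ (x (i + 1) ∈ T) := by
        by_contra hno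
        push Not at hno
        have : ∀ i, 1 ≤ i → i ≤ m → (x 1 ∈ T) = (x i ∈ T) := by
          intro i hi
          induction i, hi using Nat.le_induction with
          | base => intro _; rfl
          | succ i hi ih => intro him; rw [ih (by omega), hno i hi (by omega)]
        exact hends (this m hm le_rfl)
      obtain ⟨i, hi1, him, hi⟩ := hcross
      have hei : e i ∈ F'.erase (e 0) := by
        refine Finset.mem_erase.2 ⟨fun h' => ?_, he i him⟩
        have := hinj (Set.mem_Iio.2 him) (Set.mem_Iio.2 (show 0 < m by omega)) h'
        omega
      by_cases hxi : x i ∈ T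
      · have : x (i + 1) ∉ T := fun h' => hi (by simp [hxi, h'])
        exact ⟨x i, hxi, x (i + 1), (hxC i him).2, this, e i, hei, hlink i him⟩
      · have : x (i + 1) ∈ T := by
          by_contra h'; exact hi (by simp [hxi, h'])
        exact ⟨x (i + 1), this, x i, (hxC i him).1, hxi, e i, hei, (hlink i him).symm⟩
    · exact ⟨u, hu, v, hv, hvT, f, Finset.mem_erase.2 ⟨hfe, hf⟩, hl⟩
  have := hmin _ ⟨(Finset.erase_subset _ _).trans hF'.1, hcon⟩
  rw [Finset.card_erase_of_mem h0] at this
  have := Finset.card_pos.2 ⟨_, h0⟩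
  omega

variable (hE : ∀ e, e ∈ E ↔ e ∈ G.edgeSet)
include hE

lemma multiplicity_eq (u v : ℕ) [DecidablePred fun e => G.IsLink e u v] :
    multiplicity G u v = (E.filter (fun e => G.IsLink e u v)).card := by
  rw [multiplicity, ← Set.ncard_coe_finset]
  congr 1
  ext e
  simp only [Set.mem_ofPred_eq, Finset.coe_filter, hE]
  exact ⟨fun h => ⟨h.edge_mem, h⟩, fun h => h.2⟩

omit hE in
lemma multiplicity_comm (G : Graph ℕ β) (u v : ℕ) : multiplicity G u v = multiplicity G v u := by
  simp only [multiplicity, Graph.isLink_comm (x := u)]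

lemma multiplicity_ne_zero (u v : ℕ) : multiplicity G u v ≠ 0 ↔ ∃ e ∈ E, G.IsLink e u v := by
  classical
  rw [multiplicity_eq hE, Finset.card_ne_zero]
  simp [Finset.Nonempty]

lemma card_edgesIn_insert {v : ℕ} (hv : v ∉ S) : (edgesIn G E (insert v S)).card =
    (edgesIn G E S).card + deg (multiplicity G) v S + multiplicity G v v := by
  classical
  have hdeg : deg (multiplicity G) v S =
      (S.biUnion fun u => E.filter (fun e => G.IsLink e v u)).card := by
    rw [Finset.card_biUnion]
    · exact Finset.sum_congr rfl fun u _ => multiplicity_eq hE v u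
    · intro a ha b hb hab
      rw [Function.onFun, Finset.disjoint_left]
      intro e h1 h2
      rw [Finset.mem_filter] at h1 h2
      exact hab (h1.2.right_unique h2.2)
  rw [hdeg, multiplicity_eq hE, ← Finset.card_union_of_disjoint,
    ← Finset.card_union_of_disjoint]
  · congr 1
    ext e
    simp only [Finset.mem_union, mem_edgesIn, Finset.mem_biUnion, Finset.mem_filter]
    constructor
    · rintro ⟨he, x, hx, y, hy, hl⟩
      rcases Finset.mem_insert.1 hx with hx' | hx' <;>
        rcases Finset.mem_insert.1 hy with hy' | hy'
      · exact Or.inr ⟨he, by rwa [hx', hy'] at hl⟩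
      · exact Or.inl (Or.inr ⟨y, hy', he, by rwa [hx'] at hl⟩)
      · exact Or.inl (Or.inr ⟨x, hx', he, by rw [hy'] at hl; exact hl.symm⟩)
      · exact Or.inl (Or.inl ⟨he, x, hx', y, hy', hl⟩)
    · rintro ((⟨he, x, hx, y, hy, hl⟩ | ⟨y, hy, he, hl⟩) | ⟨he, hl⟩)
      · exact ⟨he, x, by simp [hx], y, by simp [hy], hl⟩
      · exact ⟨he, v, by simp, y, by simp [hy], hl⟩
      · exact ⟨he, v, by simp, v, by simp, hl⟩
  · rw [Finset.disjoint_left]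
    intro e h1 h2
    rw [Finset.mem_filter] at h2
    rcases Finset.mem_union.1 h1 with h1 | h1
    · exact hv (mem_of_mem_edgesIn h1 h2.2)
    · simp only [Finset.mem_biUnion, Finset.mem_filter] at h1
      obtain ⟨u, hu, -, hl⟩ := h1
      exact hv (h2.2.right_unique hl ▸ hu)
  · rw [Finset.disjoint_left]
    intro e h1 h2
    simp only [Finset.mem_biUnion, Finset.mem_filter] at h2
    obtain ⟨u, hu, -, hl⟩ := h2
    exact hv (mem_of_mem_edgesIn h1 hl)

lemma twiceEdges_eq (S : Finset ℕ) :
    twiceEdges (multiplicity G) S = 2 * (edgesIn G E S).card := by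
  classical
  induction S using Finset.induction_on with
  | empty =>
    have : edgesIn G E ∅ = ∅ := by ext e; simp [mem_edgesIn]
    rw [this]; rfl
  | insert v S hv ih =>
    rw [card_edgesIn_insert hE hv, twiceEdges_insert (multiplicity_comm G) hv, ih]
    ring

lemma Conn.connects (h : Conn (multiplicity G) C) : Connects G (edgesIn G E C) C := by
  intro T hT hne hTC
  obtain ⟨u, hu, v, hv, hvT, huv⟩ := h.2 T hT hne hTC
  obtain ⟨e, he, hl⟩ := (multiplicity_ne_zero hE u v).1 huv
  exact ⟨u, hu, v, hv, hvT, e, mem_edgesIn.2 ⟨he, u, hT hu, v, hv, hl⟩, hl⟩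

omit hE in
lemma Connects.reachable {H : Graph ℕ β} (h : Connects G F S)
    (hl : ∀ e ∈ F, ∀ x ∈ S, ∀ y ∈ S, G.IsLink e x y → H.Adj x y) {v : ℕ} (hv : v ∈ S) :
    ∀ u ∈ S, Relation.ReflTransGen H.Adj v u := by
  classical
  by_contra hno
  push Not at hno
  obtain ⟨u, hu, hu'⟩ := hno
  obtain ⟨a, ha, b, hb, hbT, e, he, hab⟩ := h
    (S.filter (fun u => Relation.ReflTransGen H.Adj v u)) (Finset.filter_subset _ _)
    ⟨v, by simp [hv, Relation.ReflTransGen.refl]⟩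
    (fun h' => hu' (Finset.mem_filter.1 (h' ▸ hu)).2)
  rw [Finset.mem_filter] at ha
  exact hbT (Finset.mem_filter.2 ⟨hb, ha.2.tail (hl e he a ha.1 b hb hab)⟩)

/-- Counting edges recognizes pseudoforests. If at most `r` edges of a component are deleted such that a
forest remains, then a connected subset keeps fewer edges than it has vertices; conversely, the edges
outside a spanning tree of the component can be deleted. -/
lemma isPseudoforest_iff {r : ℕ} {X : Set ℕ} {Y : Finset ℕ} (hY : G.vertexSet \ X = Y) :
    IsPseudoforest r (G.deleteVerts X) ↔ Sparse (multiplicity G) r Y := by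
  classical
  have hlink (e : β) (x y : ℕ) :
      (G.deleteVerts X).IsLink e x y ↔ G.IsLink e x y ∧ x ∈ Y ∧ y ∈ Y := by
    have hmem (x : ℕ) : x ∈ Y ↔ x ∈ G.vertexSet ∧ x ∉ X := by
      rw [← Finset.mem_coe, ← hY]; rfl
    rw [Graph.deleteVerts_isLink, hmem, hmem]
    exact ⟨fun ⟨h, h1, h2⟩ => ⟨h, ⟨h.left_mem, h1⟩, ⟨h.right_mem, h2⟩⟩,
      fun ⟨h, h1, h2⟩ => ⟨h, h1.2, h2.2⟩⟩
  have hV : (G.deleteVerts X).vertexSet = Y := by rw [Graph.vertexSet_deleteVerts, hY]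
  have hclink (v : ℕ) (e : β) (x y : ℕ) : (component (G.deleteVerts X) v).IsLink e x y ↔
      (G.IsLink e x y ∧ x ∈ Y ∧ y ∈ Y) ∧ Relation.ReflTransGen (G.deleteVerts X).Adj v x ∧
        Relation.ReflTransGen (G.deleteVerts X).Adj v y := by
    rw [component, Graph.induce_isLink, hlink]; rfl
  have hreach {S : Finset ℕ} (hSY : S ⊆ Y) (hS : Conn (multiplicity G) S) {v : ℕ}
      (hv : v ∈ S) : ∀ u ∈ S, Relation.ReflTransGen (G.deleteVerts X).Adj v u :=
    (hS.connects hE).reachable (fun e _ x hx y hy hl =>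
      ⟨e, (hlink e x y).2 ⟨hl, hSY hx, hSY hy⟩⟩) hv
  constructor
  · intro h S hSY hS
    obtain ⟨v, hv⟩ := hS.nonempty
    obtain ⟨F, -, hFr, hforest⟩ := h v (by rw [hV]; exact hSY hv)
    have hr := hreach hSY hS hv
    have hFfin : F.Finite := Set.finite_of_encard_le_coe hFr
    have hac : Acyclic G (edgesIn G E S \ hFfin.toFinset) := by
      intro m x e he hcyc
      refine hforest m x e ⟨hcyc.1, hcyc.2.1, hcyc.2.2.1, hcyc.2.2.2.1, fun i hi => ?_⟩
      have hl := hcyc.2.2.2.2 i hi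
      have hei := he i hi
      rw [Finset.mem_sdiff, Set.Finite.mem_toFinset] at hei
      have h1 := mem_of_mem_edgesIn hei.1 hl
      have h2 := mem_of_mem_edgesIn hei.1 hl.symm
      rw [Graph.deleteEdges_isLink, hclink]
      exact ⟨⟨⟨hl, hSY h1, hSY h2⟩, hr _ h1, hr _ h2⟩, hei.2⟩
    have h1 := hac.card_lt hS.nonempty fun e he =>
      (mem_edgesIn.1 (Finset.mem_sdiff.1 he).1).2
    have h2 := Finset.le_card_sdiff hFfin.toFinset (edgesIn G E S)
    have h3 : hFfin.toFinset.card ≤ r := by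
      rw [← Set.ncard_eq_toFinset_card F hFfin]
      rw [← hFfin.cast_ncard_eq] at hFr
      exact_mod_cast hFr
    rw [twiceEdges_eq hE]
    omega
  · intro h v hv
    rw [hV, Finset.mem_coe] at hv
    obtain ⟨C, hCY, hvC, hC, hcl⟩ := exists_component (multiplicity_comm G) hv
    have hr := hreach hCY hC hvC
    have hr' : ∀ u, Relation.ReflTransGen (G.deleteVerts X).Adj v u → u ∈ C := by
      intro u hu
      induction hu with
      | refl => exact hvC
      | tail _ hab ih =>
        rename_i a b _
        obtain ⟨e, he⟩ := hab
        rw [hlink] at he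
        by_contra hb
        refine (multiplicity_ne_zero hE a b).2 ⟨e, (hE e).2 he.1.edge_mem, he.1⟩ ?_
        exact (closed_iff (multiplicity_comm G)).1 hcl b he.2.2 hb a ih
    obtain ⟨F', hF', hac, hcon⟩ := (hC.connects hE).exists_acyclic
      fun e he => (mem_edgesIn.1 he).2
    have h1 := h C hCY hC
    rw [twiceEdges_eq hE] at h1
    have h2 := hcon.card_le hC.nonempty
    refine ⟨↑(edgesIn G E C \ F'), ?_, ?_, ?_⟩
    · intro e he
      rw [Finset.mem_coe, Finset.mem_sdiff] at he
      obtain ⟨-, x, hx, y, hy, hl⟩ := mem_edgesIn.1 he.1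
      exact Graph.IsLink.edge_mem ((hclink v e x y).2 ⟨⟨hl, hCY hx, hCY hy⟩, hr x hx, hr y hy⟩)
    · rw [Set.encard_coe_eq_coe_finsetCard]
      have := Finset.card_sdiff_add_card_eq_card hF'
      exact_mod_cast (by omega : (edgesIn G E C \ F').card ≤ r)
    · intro m x e hcyc
      have hl (i : ℕ) (hi : i < m) := hcyc.2.2.2.2 i hi
      simp only [Graph.deleteEdges_isLink] at hl
      refine hac m x e (fun i hi => ?_) ⟨hcyc.1, hcyc.2.1, hcyc.2.2.1, hcyc.2.2.2.1,
        fun i hi => ((hclink _ _ _ _).1 (hl i hi).1).1.1⟩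
      have hi' := (hclink _ _ _ _).1 (hl i hi).1
      have hmem : e i ∈ edgesIn G E C := mem_edgesIn.2
        ⟨(hE _).2 hi'.1.1.edge_mem, _, hr' _ hi'.2.1, _, hr' _ hi'.2.2, hi'.1.1⟩
      by_contra hnot
      exact (hl i hi).2 (by simp [hmem, hnot])

end

/-- The problem in terms of the adjacency matrix. -/
theorem hasSolution_iff {β : Type*} {G : Graph ℕ β} {n r k : ℕ}
    (hV : G.vertexSet = Set.Iio n) (hfin : G.edgeSet.Finite) :
    HasSolution r k G ↔
      ∃ X : Finset ℕ, X.card ≤ k ∧ Sparse (multiplicity G) r (Finset.range n \ X) := by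
  classical
  have hE : ∀ e, e ∈ hfin.toFinset ↔ e ∈ G.edgeSet := fun e => hfin.mem_toFinset
  constructor
  · rintro ⟨X, ⟨hXV, hX⟩, hk⟩
    have hXfin : X.Finite := Set.finite_of_encard_le_coe hk
    refine ⟨hXfin.toFinset, ?_, (isPseudoforest_iff hE ?_).1 hX⟩
    · rw [← Set.ncard_eq_toFinset_card X hXfin]
      rw [← hXfin.cast_ncard_eq] at hk
      exact_mod_cast hk
    · ext u; simp [hV]
  · rintro ⟨X, hk, hX⟩
    refine ⟨↑(X ∩ Finset.range n), ⟨fun u hu => ?_, (isPseudoforest_iff hE ?_).2 hX⟩, ?_⟩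
    · rw [hV]; simp at hu; exact hu.2
    · ext u; simp [hV]
    · rw [Set.encard_coe_eq_coe_finsetCard]
      exact_mod_cast (Finset.card_le_card Finset.inter_subset_left).trans hk

/-! ### A program logic for the word RAM -/

/-- Whether the program contains an instruction that writes the register `x`. -/
def Program.writes : Program → ℕ → Bool
  | .skip, _ => false
  | .const d _, x => d == x
  | .arith _ d _ _, x => d == x
  | .load d _, x => d == x
  | .store _ _, _ => false
  | .seq P Q, x => P.writes x || Q.writes x
  | .cond _ _ P Q, x => P.writes x || Q.writes x
  | .loop _ _ P, x => P.writes x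

/-- Whether the program contains an instruction that writes to the memory. -/
def Program.stores : Program → Bool
  | .store _ _ => true
  | .seq P Q => P.stores || Q.stores
  | .cond _ _ P Q => P.stores || Q.stores
  | .loop _ _ P => P.stores
  | _ => false

/-- A bound for the number of steps, provided that each loop with upper register `b` is iterated at
most `N b` times. -/
def Program.cost (N : ℕ → ℕ) : Program → ℕ
  | .seq P Q => P.cost N + Q.cost N
  | .cond _ _ P Q => P.cost N + Q.cost N + 1
  | .loop _ b P => N b * (P.cost N + 1) + 1
  | _ => 1

/-- A sufficient precondition for `P` to halt without overflow in a state that satisfies `Q`, where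
each loop with upper register `b` is iterated at most `N b` times. For a loop there has to
be an invariant, indexed by the number of remaining iterations. -/
def wp (W : ℕ) (N : ℕ → ℕ) : Program → (State → Prop) → State → Prop
  | .skip, Q, s => Q s
  | .const d c, Q, s => c < W ∧ Q (s.setReg d c)
  | .arith o d a b, Q, s =>
    o.eval (s.reg a) (s.reg b) < W ∧ Q (s.setReg d (o.eval (s.reg a) (s.reg b)))
  | .load d a, Q, s => Q (s.setReg d (s.mem (s.reg a)))
  | .store a b, Q, s => Q (s.setMem (s.reg a) (s.reg b))
  | .seq P P', Q, s => wp W N P (wp W N P' Q) s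
  | .cond a b P P', Q, s => if s.reg a < s.reg b then wp W N P Q s else wp W N P' Q s
  | .loop a b P, Q, s => ∃ (I : ℕ → State → Prop) (m : ℕ), m ≤ N b ∧ I m s ∧
      (∀ j s, I (j + 1) s → s.reg a < s.reg b ∧ wp W N P (I j) s) ∧
      ∀ s, I 0 s → ¬ s.reg a < s.reg b ∧ Q s

section logic
variable {W : ℕ} {N : ℕ → ℕ} {P P' : Program} {Q Q' : State → Prop} {s s' : State}

/-- Soundness of the program logic, with a bound for the running time. -/
theorem exec_of_wp (h : wp W N P Q s) :
    ∃ t s', Exec W P s t s' ∧ t ≤ P.cost N ∧ Q s' := by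
  induction P generalizing Q s with
  | skip => exact ⟨1, s, .skip s, le_rfl, h⟩
  | const d c => exact ⟨1, _, .const s d c h.1, le_rfl, h.2⟩
  | arith o d a b => exact ⟨1, _, .arith s o d a b h.1, le_rfl, h.2⟩
  | load d a => exact ⟨1, _, .load s d a, le_rfl, h⟩
  | store a b => exact ⟨1, _, .store s a b, le_rfl, h⟩
  | seq P P' ih ih' =>
    obtain ⟨t, s₁, h₁, ht, h⟩ := ih h
    obtain ⟨t', s₂, h₂, ht', h⟩ := ih' h
    exact ⟨t + t', s₂, .seq _ _ _ _ _ _ _ h₁ h₂, Nat.add_le_add ht ht', h⟩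
  | cond a b P P' ih ih' =>
    rw [wp] at h
    split_ifs at h with hab
    · obtain ⟨t, s₁, h₁, ht, h⟩ := ih h
      exact ⟨t + 1, s₁, .condTrue _ _ _ _ _ _ _ hab h₁, by rw [Program.cost]; omega, h⟩
    · obtain ⟨t, s₁, h₁, ht, h⟩ := ih' h
      exact ⟨t + 1, s₁, .condFalse _ _ _ _ _ _ _ hab h₁, by rw [Program.cost]; omega, h⟩
  | loop a b P ih =>
    obtain ⟨I, m, hm, hI, hstep, hend⟩ := h
    have key : ∀ m s, I m s → ∃ t s', Exec W (.loop a b P) s t s' ∧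
        t ≤ m * (P.cost N + 1) + 1 ∧ Q s' := by
      intro m
      induction m with
      | zero =>
        intro s hs
        exact ⟨1, s, .loopDone _ _ _ _ (hend s hs).1, by omega, (hend s hs).2⟩
      | succ m ihm =>
        intro s hs
        obtain ⟨hab, hw⟩ := hstep m s hs
        obtain ⟨t, s₁, h₁, ht, hs₁⟩ := ih hw
        obtain ⟨t', s₂, h₂, ht', hs₂⟩ := ihm s₁ hs₁
        refine ⟨t + 1 + t', s₂, .loopStep _ _ _ _ _ _ _ _ hab h₁ h₂, ?_, hs₂⟩
        rw [Nat.succ_mul]; omega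
    obtain ⟨t, s', h₁, ht, hQ⟩ := key m s hI
    refine ⟨t, s', h₁, ht.trans ?_, hQ⟩
    rw [Program.cost]
    gcongr

lemma wp_mono (h : wp W N P Q s) (hQ : ∀ s, Q s → Q' s) : wp W N P Q' s := by
  induction P generalizing Q Q' s with
  | skip => exact hQ _ h
  | const d c => exact ⟨h.1, hQ _ h.2⟩
  | arith o d a b => exact ⟨h.1, hQ _ h.2⟩
  | load d a => exact hQ _ h
  | store a b => exact hQ _ h
  | seq P P' ih ih' => exact ih h fun s h => ih' h hQ
  | cond a b P P' ih ih' =>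
    rw [wp] at h ⊢
    split_ifs at h ⊢
    · exact ih h hQ
    · exact ih' h hQ
  | loop a b P ih =>
    obtain ⟨I, m, hm, hI, hstep, hend⟩ := h
    exact ⟨I, m, hm, hI, hstep, fun s hs => ⟨(hend s hs).1, hQ _ (hend s hs).2⟩⟩

/-- `s` and `s'` agree on the registers, and on the memory, that `P` does not write. -/
structure Frame (P : Program) (s s' : State) : Prop where
  reg : ∀ x, P.writes x = false → s'.reg x = s.reg x
  mem : P.stores = false → s'.mem = s.mem

lemma Frame.refl (P : Program) (s : State) : Frame P s s := ⟨fun _ _ => rfl, fun _ => rfl⟩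

lemma Frame.trans {s₁ s₂ s₃ : State} (h : Frame P s₁ s₂) (h' : Frame P s₂ s₃) : Frame P s₁ s₃ :=
  ⟨fun x hx => (h'.reg x hx).trans (h.reg x hx), fun hP => (h'.mem hP).trans (h.mem hP)⟩

lemma Frame.of_le (h : Frame P s s') (hw : ∀ x, P'.writes x = false → P.writes x = false)
    (hs : P'.stores = false → P.stores = false) : Frame P' s s' :=
  ⟨fun x hx => h.reg x (hw x hx), fun hP => h.mem (hs hP)⟩

lemma frame_setReg {d : ℕ} (x : ℕ) (h : P.writes d = true) : Frame P s (s.setReg d x) := by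
  refine ⟨fun y hy => Function.update_of_ne ?_ _ _, fun _ => rfl⟩
  rintro rfl
  simp [h] at hy

/-- The frame rule. -/
lemma wp_frame (h : wp W N P Q s) : wp W N P (fun s' => Frame P s s' ∧ Q s') s := by
  induction P generalizing Q s with
  | skip => exact ⟨Frame.refl _ _, h⟩
  | const d c => exact ⟨h.1, frame_setReg _ (by simp [Program.writes]), h.2⟩
  | arith o d a b => exact ⟨h.1, frame_setReg _ (by simp [Program.writes]), h.2⟩
  | load d a => exact ⟨frame_setReg _ (by simp [Program.writes]), h⟩
  | store a b => exact ⟨⟨fun _ _ => rfl, fun h => by simp [Program.stores] at h⟩, h⟩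
  | seq P P' ih ih' =>
    rw [wp] at h ⊢
    refine wp_mono (ih h) fun s₁ ⟨h₁, h⟩ => wp_mono (ih' h) fun s₂ ⟨h₂, h⟩ => ⟨?_, h⟩
    refine (h₁.of_le ?_ ?_).trans (h₂.of_le ?_ ?_) <;>
      simp +contextual [Program.writes, Program.stores]
  | cond a b P P' ih ih' =>
    rw [wp] at h ⊢
    split_ifs at h ⊢
    · refine wp_mono (ih h) fun s₁ ⟨h₁, h⟩ => ⟨h₁.of_le ?_ ?_, h⟩ <;>
        simp +contextual [Program.writes, Program.stores]
    · refine wp_mono (ih' h) fun s₁ ⟨h₁, h⟩ => ⟨h₁.of_le ?_ ?_, h⟩ <;>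
        simp +contextual [Program.writes, Program.stores]
  | loop a b P ih =>
    obtain ⟨I, m, hm, hI, hstep, hend⟩ := h
    refine ⟨fun j s' => Frame (.loop a b P) s s' ∧ I j s', m, hm, ⟨Frame.refl _ _, hI⟩, ?_, ?_⟩
    · rintro j s₁ ⟨h₁, hs₁⟩
      refine ⟨(hstep j s₁ hs₁).1, wp_mono (ih (hstep j s₁ hs₁).2) fun s₂ ⟨h₂, hs₂⟩ => ⟨?_, hs₂⟩⟩
      refine h₁.trans (h₂.of_le ?_ ?_) <;> simp [Program.writes, Program.stores]
    · rintro s₁ ⟨h₁, hs₁⟩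
      exact ⟨(hend s₁ hs₁).1, h₁, (hend s₁ hs₁).2⟩

/-- `for R[i] = 0, …, R[0] - 1 do P`; the register `3` has to contain `1`. -/
def forN (i : ℕ) (P : Program) : Program :=
  .seq (.const i 0) (.loop i 0 (.seq P (.arith .add i i 3)))

/-- The rule for counting loops, with an invariant that is indexed by the counter. -/
theorem wp_forN {i n : ℕ} (I : ℕ → State → Prop) (hi : i ≠ 0 ∧ i ≠ 3)
    (hP : P.writes i = false ∧ P.writes 0 = false ∧ P.writes 3 = false)
    (hN : n ≤ N 0) (hW : n < W) (h0 : s.reg 0 = n) (h3 : s.reg 3 = 1)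
    (hinit : I 0 (s.setReg i 0))
    (hstep : ∀ j < n, ∀ s', Frame (forN i P) s s' → s'.reg i = j → I j s' →
      wp W N P (fun s'' => I (j + 1) (s''.setReg i (j + 1))) s')
    (hend : ∀ s', Frame (forN i P) s s' → s'.reg i = n → I n s' → Q s') :
    wp W N (forN i P) Q s := by
  have hwi : (forN i P).writes i = true := by simp [forN, Program.writes]
  have hw : ∀ x, (forN i P).writes x = false → P.writes x = false := by
    simp +contextual [forN, Program.writes]
  have hst : (forN i P).stores = false → P.stores = false := by
    simp +contextual [forN, Program.stores]
  have h0' : (forN i P).writes 0 = false := by simp [forN, Program.writes, hi, hP]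
  have h3' : (forN i P).writes 3 = false := by simp [forN, Program.writes, hi, hP]
  refine ⟨by omega, fun d s' => ∃ j, j + d = n ∧ Frame (forN i P) s s' ∧ s'.reg i = j ∧ I j s',
    n, hN, ⟨0, by simp, frame_setReg 0 hwi, by simp [State.setReg], hinit⟩, ?_, ?_⟩
  · rintro d s₁ ⟨j, hj, hF, hij, hI⟩
    have e0 := (hF.reg 0 h0').trans h0
    have e3 := (hF.reg 3 h3').trans h3
    refine ⟨by rw [hij, e0]; omega, ?_⟩
    rw [wp]
    refine wp_mono (wp_frame (hstep j (by omega) s₁ hF hij hI)) ?_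
    rintro s₂ ⟨hF₂, hI₂⟩
    have e3' := (hF₂.reg 3 hP.2.2).trans e3
    have ei' := (hF₂.reg i hP.1).trans hij
    refine ⟨by rw [e3', ei']; simp only [Op.eval]; omega, j + 1, by omega, ?_, ?_, ?_⟩
    · exact (hF.trans (hF₂.of_le hw hst)).trans (frame_setReg _ hwi)
    · simp [State.setReg, Op.eval, e3', ei']
    · simpa only [Op.eval, e3', ei'] using hI₂
  · rintro s₁ ⟨j, hj, hF, hij, hI⟩
    obtain rfl : j = n := by omega
    exact ⟨by rw [hij, (hF.reg 0 h0').trans h0]; omega, hend s₁ hF hij hI⟩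

@[simp] lemma reg_setReg (s : State) (d x y : ℕ) :
    (s.setReg d x).reg y = if y = d then x else s.reg y := by
  simp [State.setReg, Function.update_apply]

@[simp] lemma mem_setReg (s : State) (d x : ℕ) : (s.setReg d x).mem = s.mem := rfl

@[simp] lemma reg_setMem (s : State) (a x : ℕ) : (s.setMem a x).reg = s.reg := rfl

@[simp] lemma mem_setMem (s : State) (a x : ℕ) :
    (s.setMem a x).mem = Function.update s.mem a x := rfl

@[simp] lemma wp_skip : wp W N .skip Q s = Q s := rfl

@[simp] lemma wp_const {d c : ℕ} : wp W N (.const d c) Q s = (c < W ∧ Q (s.setReg d c)) := rfl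

@[simp] lemma wp_add {d a b : ℕ} : wp W N (.arith .add d a b) Q s =
    (s.reg a + s.reg b < W ∧ Q (s.setReg d (s.reg a + s.reg b))) := rfl

@[simp] lemma wp_sub {d a b : ℕ} : wp W N (.arith .sub d a b) Q s =
    (s.reg a - s.reg b < W ∧ Q (s.setReg d (s.reg a - s.reg b))) := rfl

@[simp] lemma wp_mul {d a b : ℕ} : wp W N (.arith .mul d a b) Q s =
    (s.reg a * s.reg b < W ∧ Q (s.setReg d (s.reg a * s.reg b))) := rfl

@[simp] lemma wp_load {d a : ℕ} : wp W N (.load d a) Q s = Q (s.setReg d (s.mem (s.reg a))) := rfl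

@[simp] lemma wp_store {a b : ℕ} : wp W N (.store a b) Q s = Q (s.setMem (s.reg a) (s.reg b)) := rfl

@[simp] lemma wp_seq : wp W N (.seq P P') Q s = wp W N P (wp W N P' Q) s := rfl

@[simp] lemma wp_cond {a b : ℕ} : wp W N (.cond a b P P') Q s =
    if s.reg a < s.reg b then wp W N P Q s else wp W N P' Q s := rfl

/-- `if R[x] = c then P else P'`, with auxiliary register `31`. -/
def ifEq (x c : ℕ) (P P' : Program) : Program :=
  .seq (.const 31 c) (.cond x 31 P' (.cond 31 x P' P))

lemma wp_ifEq {x c : ℕ} (hx : x ≠ 31) (hc : c < W) : wp W N (ifEq x c P P') Q s =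
    if s.reg x = c then wp W N P Q (s.setReg 31 c) else wp W N P' Q (s.setReg 31 c) := by
  rw [ifEq, wp_seq, wp_const, wp_cond, wp_cond]
  simp only [reg_setReg, hx, if_true, if_false, hc, true_and]
  split_ifs <;> first | rfl | omega

end logic

/-! ### The memory and the registers of the program -/

local infixr:67 " ⨟ " => Program.seq

/-- The contents of the working arrays: the statuses, the marks of the present solution, the
marks of a better solution, the marks of the search, and the choices. -/
structure Mem where
  st : ℕ → ℕ
  zf : ℕ → ℕ
  bst : ℕ → ℕ
  mark : ℕ → ℕ
  dig : ℕ → ℕ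

/-- The adjacency matrix is followed by five arrays; each but the last has length `n`. -/
def layout (n : ℕ) (A : ℕ → ℕ → ℕ) (m : Mem) (a : ℕ) : ℕ :=
  if a < n * n then A (a / n) (a % n)
  else if a < n * n + n then m.st (a - n * n)
  else if a < n * n + n + n then m.zf (a - (n * n + n))
  else if a < n * n + n + n + n then m.bst (a - (n * n + n + n))
  else if a < n * n + n + n + n + n then m.mark (a - (n * n + n + n + n))
  else m.dig (a - (n * n + n + n + n + n))

section layout
variable {n : ℕ} {A : ℕ → ℕ → ℕ} {m : Mem} {u v x : ℕ}

lemma layout_adj (hu : u < n) (hv : v < n) : layout n A m (n * u + v) = A u v := by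
  have h1 : n * u + v < n * n := by
    have := Nat.mul_le_mul_left n (show u + 1 ≤ n from hu)
    rw [Nat.mul_succ] at this
    omega
  rw [layout, if_pos h1, Nat.mul_add_div (by omega), Nat.mul_add_mod, Nat.mod_eq_of_lt hv,
    Nat.div_eq_of_lt hv, add_zero]

lemma layout_st (h : v < n) : layout n A m (n * n + v) = m.st v := by
  rw [layout, if_neg (by omega), if_pos (by omega)]; congr 1; omega

lemma layout_zf (h : v < n) : layout n A m (n * n + n + v) = m.zf v := by
  rw [layout, if_neg (by omega), if_neg (by omega), if_pos (by omega)]; congr 1; omega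

lemma layout_bst (h : v < n) : layout n A m (n * n + n + n + v) = m.bst v := by
  rw [layout, if_neg (by omega), if_neg (by omega), if_neg (by omega), if_pos (by omega)]
  congr 1; omega

lemma layout_mark (h : v < n) : layout n A m (n * n + n + n + n + v) = m.mark v := by
  rw [layout, if_neg (by omega), if_neg (by omega), if_neg (by omega), if_neg (by omega),
    if_pos (by omega)]
  congr 1; omega

lemma layout_dig (v : ℕ) : layout n A m (n * n + n + n + n + n + v) = m.dig v := by
  rw [layout, if_neg (by omega), if_neg (by omega), if_neg (by omega), if_neg (by omega),
    if_neg (by omega)]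
  congr 1; omega

lemma update_eq {f g : ℕ → ℕ} {a : ℕ} (h1 : g a = x) (h2 : ∀ b, b ≠ a → f b = g b) :
    Function.update f a x = g := by
  funext b
  by_cases hb : b = a
  · subst hb; simp [h1]
  · rw [Function.update_of_ne hb, h2 b hb]

lemma update_layout_st (h : v < n) : Function.update (layout n A m) (n * n + v) x =
    layout n A { m with st := Function.update m.st v x } := by
  refine update_eq (by rw [layout_st h]; simp) fun b hb => ?_
  unfold layout
  split_ifs <;> try rfl
  exact (Function.update_of_ne (by omega) _ _).symm

lemma update_layout_zf (h : v < n) : Function.update (layout n A m) (n * n + n + v) x =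
    layout n A { m with zf := Function.update m.zf v x } := by
  refine update_eq (by rw [layout_zf h]; simp) fun b hb => ?_
  unfold layout
  split_ifs <;> try rfl
  exact (Function.update_of_ne (by omega) _ _).symm

lemma update_layout_bst (h : v < n) : Function.update (layout n A m) (n * n + n + n + v) x =
    layout n A { m with bst := Function.update m.bst v x } := by
  refine update_eq (by rw [layout_bst h]; simp) fun b hb => ?_
  unfold layout
  split_ifs <;> try rfl
  exact (Function.update_of_ne (by omega) _ _).symm

lemma update_layout_mark (h : v < n) : Function.update (layout n A m) (n * n + n + n + n + v) x =
    layout n A { m with mark := Function.update m.mark v x } := by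
  refine update_eq (by rw [layout_mark h]; simp) fun b hb => ?_
  unfold layout
  split_ifs <;> try rfl
  exact (Function.update_of_ne (by omega) _ _).symm

lemma update_layout_dig (v : ℕ) :
    Function.update (layout n A m) (n * n + n + n + n + n + v) x =
      layout n A { m with dig := Function.update m.dig v x } := by
  refine update_eq (by rw [layout_dig]; simp) fun b hb => ?_
  unfold layout
  split_ifs <;> try rfl
  exact (Function.update_of_ne (by omega) _ _).symm

/-- Only the first `n` entries of the statuses and of the marks matter. -/
lemma layout_congr {m m' : Mem} (h1 : ∀ v < n, m.st v = m'.st v) (h2 : ∀ v < n, m.zf v = m'.zf v)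
    (h3 : ∀ v < n, m.bst v = m'.bst v) (h4 : ∀ v < n, m.mark v = m'.mark v) (h5 : m.dig = m'.dig) :
    layout n A m = layout n A m' := by
  funext a
  unfold layout
  split_ifs
  · rfl
  · exact h1 _ (by omega)
  · exact h2 _ (by omega)
  · exact h3 _ (by omega)
  · exact h4 _ (by omega)
  · rw [h5]

end layout

/-- The registers that stay constant: the input `n`, `k`, `r`, the constants `1` and `0`, the
addresses of the five arrays, the length `L` of the sequences of choices and the largest choice
`r + 1`. -/
abbrev Ctx (n k r L : ℕ) (s : State) : Prop :=
  s.reg 0 = n ∧ s.reg 1 = k ∧ s.reg 2 = r ∧ s.reg 3 = 1 ∧ s.reg 4 = 0 ∧ s.reg 5 = n * n ∧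
    s.reg 6 = n * n + n ∧ s.reg 7 = n * n + n + n ∧ s.reg 8 = n * n + n + n + n ∧
    s.reg 9 = n * n + n + n + n + n ∧ s.reg 10 = L ∧ s.reg 11 = r + 1

/-- Whether `P` leaves these registers unchanged. -/
def Program.keepsCtx (P : Program) : Bool := (List.range 12).all fun x => !P.writes x

/-- The word bound exceeds all numbers that occur; `e` is a bound for the multiplicities. -/
structure Wide (W : ℕ) (N : ℕ → ℕ) (A : ℕ → ℕ → ℕ) (n k r e : ℕ) : Prop where
  loops : n ≤ N 0
  symm : ∀ u v, A u v = A v u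
  le : ∀ u v, A u v ≤ e
  addr : n * n + 8 * n + 8 ≤ W
  degree : 4 * (n * e) + 4 * e + 8 ≤ W
  excess : n * (n * e + e) + 4 * (n * e) + 4 * e + 8 ≤ W
  target : k + r + 8 ≤ W

section
variable {W : ℕ} {N : ℕ → ℕ} {A : ℕ → ℕ → ℕ} {n k r e L : ℕ} {P : Program} {s s' : State}
  {Q : State → Prop} {m : Mem}

lemma Frame.ctx (hF : Frame P s s') (hP : P.keepsCtx = true) (h : Ctx n k r L s) :
    Ctx n k r L s' := by
  have hr : ∀ x < 12, s'.reg x = s.reg x := by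
    intro x hx
    refine hF.reg x ?_
    have := List.all_eq_true.1 hP x (List.mem_range.2 hx)
    simpa using this
  have := hr 0; have := hr 1; have := hr 2; have := hr 3; have := hr 4; have := hr 5
  have := hr 6; have := hr 7; have := hr 8; have := hr 9; have := hr 10; have := hr 11
  simp_all [Ctx]

lemma Wide.sum_le (h : Wide W N A n k r e) (v : ℕ) (p : ℕ → Prop) [DecidablePred p] {j : ℕ}
    (hj : j ≤ n) : ∑ u ∈ Finset.range j, (if p u then A v u else 0) ≤ n * e := by
  refine (Finset.sum_le_card_nsmul _ _ e fun u _ => ?_).trans ?_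
  · split_ifs
    · exact h.le v u
    · exact Nat.zero_le _
  · rw [Finset.card_range, smul_eq_mul]
    exact Nat.mul_le_mul_right _ hj

lemma deg_cls (A : ℕ → ℕ → ℕ) (v n : ℕ) (f : ℕ → ℕ) (c : ℕ) :
    deg A v (cls n f c) = ∑ u ∈ Finset.range n, (if f u = c then A v u else 0) :=
  Finset.sum_filter _ _

lemma Wide.deg_le (h : Wide W N A n k r e) (v : ℕ) (f : ℕ → ℕ) (c : ℕ) :
    deg A v (cls n f c) ≤ n * e := by
  rw [deg_cls]; exact h.sum_le v _ le_rfl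

lemma Wide.mul_add_lt (h : Wide W N A n k r e) {u v : ℕ} (hu : u < n) (hv : v < n) :
    n * u + v < W := by
  have h1 : n * u ≤ n * n := Nat.mul_le_mul_left n hu.le
  have := h.addr
  omega

lemma Wide.mul_lt (h : Wide W N A n k r e) {u : ℕ} (hu : u < n) : n * u < W := by
  have := h.mul_add_lt hu (show 0 < n by omega); omega

/-! ### Computing degrees and choosing a vertex -/

/-- `R[22]` becomes the number of edges from the vertex `R[v]` to those vertices at which the
array with address `R[b]` has the entry `c`. -/
def sumP (b c v : ℕ) : Program :=
  .const 22 0 ⨟ forN 21 (.arith .mul 30 0 v ⨟ .arith .add 30 30 21 ⨟ .load 32 30 ⨟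
    .arith .add 30 b 21 ⨟ .load 33 30 ⨟ ifEq 33 c (.arith .add 22 22 32) .skip)

lemma wp_sumP (hw : Wide W N A n k r e) (hc : Ctx n k r L s) {b c v x : ℕ}
    {f : ℕ → ℕ} (hbf : b = 5 ∧ f = m.st ∨ b = 8 ∧ f = m.mark) (hv : v = 20 ∨ v = 42) (hcW : c < 6)
    (hx : s.reg v = x) (hxn : x < n) (hm : s.mem = layout n A m)
    (hQ : ∀ s', Frame (sumP b c v) s s' → s'.reg 22 = deg A x (cls n f c) → Q s') :
    wp W N (sumP b c v) Q s := by
  have haddr := hw.addr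
  have hdeg := hw.degree
  have hexp : Frame (sumP b c v) s (s.setReg 22 0) := frame_setReg 0 rfl
  have hb : b = 5 ∨ b = 8 := hbf.imp And.left And.left
  have hf : ∀ u < n, s.mem (s.reg b + u) = f u := by
    intro u hu
    rcases hbf with ⟨rfl, rfl⟩ | ⟨rfl, rfl⟩
    · rw [hm, hc.2.2.2.2.2.1, layout_st hu]
    · rw [hm, hc.2.2.2.2.2.2.2.2.1, layout_mark hu]
  have hbW : s.reg b + n < W := by
    rcases hb with rfl | rfl <;> simp [hc] <;> omega
  rw [sumP, wp_seq, wp_const]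
  refine ⟨by omega, wp_forN (n := n)
    (fun j s => s.reg 22 = ∑ u ∈ Finset.range j, (if f u = c then A x u else 0))
    (by decide) ?_ hw.loops (by omega) (by simp [hc]) (by simp [hc]) (by simp) ?_ ?_⟩
  · rcases hb with rfl | rfl <;> rcases hv with rfl | rfl <;> exact ⟨rfl, rfl, rfl⟩
  · intro j hj s' hF hij hI
    have hc' : s'.reg 0 = n := by
      refine (hF.reg 0 ?_).trans (by simp [hc])
      rcases hb with rfl | rfl <;> rcases hv with rfl | rfl <;> rfl
    have hb' : s'.reg b = s.reg b := by
      refine (hF.reg b ?_).trans ?_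
      · rcases hb with rfl | rfl <;> rcases hv with rfl | rfl <;> rfl
      · rcases hb with rfl | rfl <;> simp
    have hv' : s'.reg v = x := by
      refine (hF.reg v ?_).trans ?_
      · rcases hb with rfl | rfl <;> rcases hv with rfl | rfl <;> rfl
      · rcases hv with rfl | rfl <;> simp [hx]
    have hm' : s'.mem = s.mem := hF.mem rfl
    have h1 := hw.mul_lt hxn
    have h2 := hw.mul_add_lt hxn hj
    have h3 := hf j hj
    have h4 := hw.sum_le x (fun u => f u = c) (j := j) hj.le
    have h5 := hw.le x j
    have hbn : b ≠ 30 ∧ b ≠ 32 := by omega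
    simp only [wp_seq, wp_mul, wp_add, wp_load, reg_setReg, mem_setReg, hc', hv', hij, hm']
    rw [wp_ifEq (by decide) (by omega)]
    rw [hm] at h3
    simp [hbn, hb', h1, h2, h3, hm, layout_adj hxn hj]
    rw [Finset.sum_range_succ, hI]
    refine ⟨by omega, ?_⟩
    split_ifs with h
    · simp; omega
    · simp
  · intro s' hF _ hI
    refine hQ s' (hexp.trans (hF.of_le ?_ ?_)) (by rw [hI, deg_cls])
    · simp +contextual [sumP, Program.writes]
    · simp +contextual [sumP, Program.stores]

end

section
variable {W : ℕ} {N : ℕ → ℕ} {A : ℕ → ℕ → ℕ} {n k r e L : ℕ} {P : Program} {s s' : State}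
  {Q : State → Prop} {m : Mem}

/-- From the degrees in the registers `22` to `24` and the number of loops in the register `35`,
compute the score of an undecided vertex. -/
def rateP : Program :=
  .arith .add 23 23 24 ⨟ .arith .add 25 23 22 ⨟ .arith .add 25 25 35 ⨟ .const 36 2 ⨟
  .cond 25 36 (.const 26 5) (.cond 4 23
    (.arith .add 37 23 35 ⨟ .cond 37 36 (.cond 22 36 (.const 26 4) (.arith .add 26 3 24))
      (.const 26 3)) .skip)

lemma wp_rateP (hc : Ctx n k r L s) {a b d l : ℕ} (ha : s.reg 23 = a) (hb : s.reg 24 = b)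
    (hd : s.reg 22 = d) (hl : s.reg 35 = l) (h26 : s.reg 26 = 0) (h : a + b + d + l + 6 ≤ W) :
    wp W N rateP (fun s' => s'.reg 26 = if a + b + d + l < 2 then 5 else if a + b = 0 then 0
      else if a + b + l < 2 then if d < 2 then 4 else 1 + b else 3) s := by
  simp [rateP, hc, ha, hb, hd, hl, h26]
  clear hc ha hb hd hl h26
  refine ⟨by omega, by omega, by omega, by omega, ?_⟩
  split_ifs <;> omega

/-- `R[26]` becomes the score of the vertex `R[20]`. -/
def scoreP : Program :=
  .const 26 0 ⨟ .arith .add 30 5 20 ⨟ .load 34 30 ⨟ ifEq 34 2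
    (sumP 5 3 20 ⨟ .arith .add 23 22 4 ⨟ sumP 5 4 20 ⨟ .arith .add 24 22 4 ⨟ sumP 5 2 20 ⨟
      .arith .mul 35 0 20 ⨟ .arith .add 35 35 20 ⨟ .load 35 35 ⨟ rateP) .skip

lemma wp_scoreP (hw : Wide W N A n k r e) (hc : Ctx n k r L s) {x : ℕ} (hx : s.reg 20 = x)
    (hxn : x < n) (hm : s.mem = layout n A m)
    (hQ : ∀ s', Frame scoreP s s' → s'.reg 26 = score A n m.st x → Q s') :
    wp W N scoreP Q s := by
  suffices h : wp W N scoreP (fun s' => s'.reg 26 = score A n m.st x) s from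
    wp_mono (wp_frame h) fun s' ⟨hF, h⟩ => hQ s' hF h
  have haddr := hw.addr
  have hdeg := hw.degree
  have h3 := hw.deg_le x m.st 3
  have h4 := hw.deg_le x m.st 4
  have h2 := hw.deg_le x m.st 2
  have hl := hw.le x x
  have hmul := hw.mul_lt hxn
  have hmul' := hw.mul_add_lt hxn hxn
  rw [scoreP]
  simp only [wp_seq, wp_const, wp_add, wp_load, reg_setReg, mem_setReg]
  rw [wp_ifEq (by decide) (by omega)]
  simp [hc, hx, hm, layout_st hxn]
  refine ⟨by omega, by omega, ?_⟩
  split_ifs with hst2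
  · refine wp_sumP hw (L := L) (by simp [Ctx, hc]) (.inl ⟨rfl, rfl⟩) (.inl rfl) (by omega) (by simp [hx])
      hxn hm ?_
    intro s₁ hF₁ hr₁
    have hc₁ : Ctx n k r L s₁ := hF₁.ctx rfl (by simp [Ctx, hc])
    have hm₁ : s₁.mem = layout n A m := by rw [hF₁.mem rfl]; exact hm
    have hx₁ : s₁.reg 20 = x := by rw [hF₁.reg 20 rfl]; simp [hx]
    have hs₁ : s₁.reg 26 = 0 := by rw [hF₁.reg 26 rfl]; simp
    simp [hc₁, hr₁]
    refine ⟨by omega, ?_⟩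
    refine wp_sumP hw (L := L) (by simp [Ctx, hc₁]) (.inl ⟨rfl, rfl⟩) (.inl rfl) (by omega) (by simp [hx₁])
      hxn hm₁ ?_
    intro s₂ hF₂ hr₂
    have hc₂ : Ctx n k r L s₂ := hF₂.ctx rfl (by simp [Ctx, hc₁])
    have hm₂ : s₂.mem = layout n A m := by rw [hF₂.mem rfl]; exact hm₁
    have hx₂ : s₂.reg 20 = x := by rw [hF₂.reg 20 rfl]; simp [hx₁]
    have hs₂ : s₂.reg 26 = 0 := by rw [hF₂.reg 26 rfl]; simp [hs₁]
    have hD₂ : s₂.reg 23 = deg A x (cls n m.st 3) := by rw [hF₂.reg 23 rfl]; simp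
    simp [hc₂, hr₂]
    refine ⟨by omega, ?_⟩
    refine wp_sumP hw (L := L) (by simp [Ctx, hc₂]) (.inl ⟨rfl, rfl⟩) (.inl rfl) (by omega) (by simp [hx₂])
      hxn hm₂ ?_
    intro s₃ hF₃ hr₃
    have hc₃ : Ctx n k r L s₃ := hF₃.ctx rfl (by simp [Ctx, hc₂])
    have hm₃ : s₃.mem = layout n A m := by rw [hF₃.mem rfl]; exact hm₂
    have hx₃ : s₃.reg 20 = x := by rw [hF₃.reg 20 rfl]; simp [hx₂]
    have hs₃ : s₃.reg 26 = 0 := by rw [hF₃.reg 26 rfl]; simp [hs₂]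
    have hD₃ : s₃.reg 23 = deg A x (cls n m.st 3) := by rw [hF₃.reg 23 rfl]; simp [hD₂]
    have hK₃ : s₃.reg 24 = deg A x (cls n m.st 4) := by rw [hF₃.reg 24 rfl]; simp
    simp [hc₃, hm₃, hx₃, layout_adj hxn hxn, hmul, hmul']
    refine wp_mono (wp_rateP (n := n) (k := k) (r := r) (L := L) ?_ ?_ ?_ ?_ ?_ ?_ ?_)
      fun s h => h.trans (by rw [score, if_pos hst2])
    · simp [Ctx, hc₃]
    · simp [hD₃]
    · simp [hK₃]
    · simp [hr₃]
    · simp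
    · simp [hs₃]
    · omega
  · simp [score, hst2]

/-- `R[27]` becomes the largest score, and `R[28]` the first vertex that attains it. -/
def pickP : Program :=
  .const 27 0 ⨟ .const 28 0 ⨟ forN 20 (scoreP ⨟
    .cond 27 26 (.arith .add 27 26 4 ⨟ .arith .add 28 20 4) .skip)

lemma wp_pickP (hw : Wide W N A n k r e) (hc : Ctx n k r L s) (hm : s.mem = layout n A m)
    (hQ : ∀ s', Frame pickP s s' → s'.reg 27 = (pick A n m.st n).1 →
      s'.reg 28 = (pick A n m.st n).2 → Q s') :
    wp W N pickP Q s := by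
  suffices h : wp W N pickP (fun s' => s'.reg 27 = (pick A n m.st n).1 ∧
      s'.reg 28 = (pick A n m.st n).2) s from
    wp_mono (wp_frame h) fun s' ⟨hF, h⟩ => hQ s' hF h.1 h.2
  have haddr := hw.addr
  have hdeg := hw.degree
  simp [pickP]
  refine ⟨by omega, wp_forN (n := n) (fun j s => s.reg 27 = (pick A n m.st j).1 ∧
      s.reg 28 = (pick A n m.st j).2) (by decide) ⟨rfl, rfl, rfl⟩ hw.loops (by omega)
      (by simp [hc]) (by simp [hc]) (by simp [pick]) ?_ ?_⟩
  · intro j hj s₁ hF₁ hj₁ hI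
    have hc₁ : Ctx n k r L s₁ := hF₁.ctx rfl (by simp [Ctx, hc])
    have hm₁ : s₁.mem = layout n A m := by rw [hF₁.mem rfl]; exact hm
    refine wp_scoreP hw hc₁ hj₁ hj hm₁ fun s₂ hF₂ hs₂ => ?_
    have hc₂ : Ctx n k r L s₂ := hF₂.ctx rfl hc₁
    have hj₂ := (hF₂.reg 20 rfl).trans hj₁
    have h27 := (hF₂.reg 27 rfl).trans hI.1
    have h28 := (hF₂.reg 28 rfl).trans hI.2
    have hsc : score A n m.st j ≤ 1 + n * e + 5 := by
      have := hw.deg_le j m.st 4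
      rw [score]; split_ifs <;> omega
    simp [hc₂, hs₂, hj₂, h27, h28, pick]
    clear hc hc₁ hc₂
    split_ifs
    · simp; omega
    · simp
  · intro s₁ _ _ hI
    exact hI

end

section
variable {W : ℕ} {N : ℕ → ℕ} {A : ℕ → ℕ → ℕ} {n k r e L p i : ℕ} {P : Program} {s s' : State}
  {Q : State → Prop} {m : Mem} {c : Cfg}

/-! ### Running the branching -/

/-- The machine state `s` represents the state `c` of the branching; `p` choices have been read. -/
structure Rep (A : ℕ → ℕ → ℕ) (n r : ℕ) (m : Mem) (p : ℕ) (c : Cfg) (s : State) : Prop where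
  mem : s.mem = layout n A { m with st := c.st }
  cnt : s.reg 18 = c.cnt
  pos : s.reg 17 = n * n + n + n + n + n + p
  dig : c.dig = fun q => m.dig (p + q)
  le : c.cnt ≤ r + 2

lemma Rep.congr (h : Rep A n r m p c s) (h1 : s'.mem = s.mem) (h2 : s'.reg 18 = s.reg 18)
    (h3 : s'.reg 17 = s.reg 17) : Rep A n r m p c s' :=
  ⟨h1.trans h.mem, h2.trans h.cnt, h3.trans h.pos, h.dig, h.le⟩

/-- Outside a chain, read a choice. The counter is `R[18]`, and `R[17]` is the address of the next
choice. -/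
def fetchP : Program :=
  .cond 18 3 (.load 18 17 ⨟ .arith .add 18 18 3 ⨟ .arith .add 17 17 3) .skip

/-- Treat the vertex `R[28]` of score `R[27]`. -/
def actP : Program :=
  .const 36 3 ⨟ .cond 36 27 (.arith .add 30 5 28 ⨟ .store 30 27)
    (fetchP ⨟ .arith .sub 18 18 3 ⨟ .cond 18 3 (.arith .add 30 5 28 ⨟ .store 30 3)
      (.const 36 4 ⨟ .arith .add 30 5 28 ⨟ .store 30 36 ⨟ ifEq 27 3 (.const 18 0) .skip))

/-- At the end of a chain its vertices become ordinary kept vertices. -/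
def settleP : Program :=
  .cond 18 3 (.const 36 3 ⨟ forN 21 (.arith .add 30 5 21 ⨟ .load 33 30 ⨟
    ifEq 33 4 (.store 30 36) .skip)) .skip

/-- One step of the branching. -/
def stepP : Program := pickP ⨟ .cond 4 27 (actP ⨟ settleP) .skip

/-- The whole branching. -/
def runP : Program := .const 18 0 ⨟ forN 19 stepP

lemma wp_actP (hw : Wide W N A n k r e) (hc : Ctx n k r L s) (hd : ∀ q, m.dig q ≤ r + 1)
    (hp : p ≤ 3 * n) (hr : Rep A n r m p c s) {sc v : ℕ} (hsc : s.reg 27 = sc)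
    (hv : s.reg 28 = v) (hvn : v < n) :
    wp W N actP (fun s' => ∃ p' ≤ p + 1, Rep A n r m p' (c.act sc v) s') s := by
  have haddr := hw.addr
  have htar := hw.target
  have hst : ∀ x, Function.update s.mem (n * n + v) x =
      layout n A { m with st := Function.update c.st v x } := by
    intro x; rw [hr.mem, update_layout_st hvn]
  have hdp := hd p
  have hload : s.mem (n * n + n + n + n + n + p) = m.dig p := by rw [hr.mem, layout_dig]
  have hle := hr.le
  have hpos := hr.pos
  have hcnt := hr.cnt
  have hdig := hr.dig
  have hdig0 : c.dig 0 = m.dig p := by rw [hdig]; rfl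
  have hfetch (x : ℕ) : (fun q => m.dig (p + (q + 1))) = fun q => m.dig (p + 1 + q) :=
    funext fun q => congrArg _ (by omega)
  by_cases h3 : 3 < sc
  · simp [actP, hc, hsc, hv, h3]
    refine ⟨by omega, by omega, p, by omega, ?_⟩
    rw [Cfg.act, if_pos h3]
    exact ⟨by simp [hst], by simpa using hr.cnt, by simpa using hr.pos, hr.dig, hr.le⟩
  by_cases h0 : c.cnt = 0
  · have h1 : c.fetch.cnt = m.dig p + 1 := by simp [Cfg.fetch, h0, hdig0]
    have h2 : c.fetch.dig = fun q => m.dig (p + 1 + q) := by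
      simp [Cfg.fetch, h0, hdig]; exact hfetch 0
    by_cases hz : m.dig p = 0
    · simp [actP, fetchP, hc, hsc, hv, h3, hcnt, h0, hpos, hload, hz]
      refine ⟨by omega, by omega, by omega, by omega, by omega, p + 1, by omega, ?_⟩
      rw [Cfg.act, if_neg h3, if_pos (show c.fetch.cnt - 1 = 0 by rw [h1]; omega)]
      clear hc
      exact ⟨by simp [hst], by simp, by simp; omega, h2, by simp⟩
    · simp [actP, fetchP, hc, hsc, hv, h3, hcnt, h0, hpos, hload, hz]
      refine ⟨by omega, by omega, by omega, by omega, by omega, by omega, ?_⟩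
      rw [wp_ifEq (by decide) (by omega)]
      simp [hsc]
      rw [Cfg.act, if_neg h3, if_neg (show ¬ c.fetch.cnt - 1 = 0 by rw [h1]; omega), h1]
      clear hc
      split_ifs with hs3
      · exact ⟨by omega, p + 1, by omega, by simp [hst], by simp, by simp; omega, h2, by simp⟩
      · exact ⟨p + 1, by omega, by simp [hst], by simp, by simp; omega, h2, by simp; omega⟩
  · have h1 : c.fetch = c := by simp [Cfg.fetch, h0]
    by_cases hz : c.cnt - 1 = 0
    · simp [actP, fetchP, hc, hsc, hv, h3, hcnt, h0, hz]
      refine ⟨by omega, by omega, by omega, p, by omega, ?_⟩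
      rw [Cfg.act, if_neg h3, h1, if_pos hz]
      exact ⟨by simp [hst], by simp, by simpa using hpos, hdig, by simp⟩
    · simp [actP, fetchP, hc, hsc, hv, h3, hcnt, h0, hz]
      refine ⟨by omega, by omega, by omega, by omega, ?_⟩
      rw [wp_ifEq (by decide) (by omega)]
      simp [hsc]
      rw [Cfg.act, if_neg h3, h1, if_neg hz]
      split_ifs with hs3
      · exact ⟨by omega, p, by omega, by simp [hst], by simp, by simpa using hpos, hdig, by simp⟩
      · exact ⟨p, by omega, by simp [hst], by simp, by simpa using hpos, hdig, by simp; omega⟩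

lemma wp_settleP (hw : Wide W N A n k r e) (hc : Ctx n k r L s) (hr : Rep A n r m p c s) :
    wp W N settleP (Rep A n r m p c.settle) s := by
  have haddr := hw.addr
  have hcnt := hr.cnt
  by_cases h0 : c.cnt = 0
  · simp only [settleP, wp_cond, hcnt, h0, hc, Nat.zero_lt_one, if_true, wp_seq, wp_const]
    refine ⟨by omega, wp_forN (n := n) (fun j s => Rep A n r m p
      { c with st := fun u => if u < j ∧ c.st u = 4 then 3 else c.st u } s ∧ s.reg 36 = 3)
      (by decide) ⟨rfl, rfl, rfl⟩ hw.loops (by omega) (by simp [hc]) (by simp [hc]) ?_ ?_ ?_⟩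
    · simp only [Nat.not_lt_zero, false_and, if_false, reg_setReg]
      exact ⟨hr.congr rfl (by simp) (by simp), by simp⟩
    · intro j hj s₁ hF₁ hj₁ ⟨hI, h36⟩
      have hc₁ : Ctx n k r L s₁ := hF₁.ctx rfl (by simp [Ctx, hc])
      have hmem : s₁.mem (n * n + j) = c.st j := by
        rw [hI.mem, layout_st hj]; simp
      simp [hc₁, hj₁]
      refine ⟨by omega, ?_⟩
      rw [wp_ifEq (by decide) (by omega)]
      simp [hmem, h36]
      have hupd : ∀ x, x = (if c.st j = 4 then 3 else c.st j) →
          Function.update (fun u => if u < j ∧ c.st u = 4 then 3 else c.st u) j x =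
            fun u => if u ≤ j ∧ c.st u = 4 then 3 else c.st u := by
        intro x hx
        refine update_eq (by simp [hx]) fun u hu => ?_
        simp [Nat.le_iff_lt_or_eq, hu]
      split_ifs with h4
      · refine ⟨?_, ?_, ?_, hI.dig, hI.le⟩
        · simp only [mem_setReg, mem_setMem, hI.mem, update_layout_st hj]
          rw [hupd 3 (by simp [h4])]
        · simpa using hI.cnt
        · simpa using hI.pos
      · refine ⟨?_, ?_, ?_, hI.dig, hI.le⟩
        · simp only [mem_setReg, hI.mem]
          rw [← hupd (c.st j) (by simp [h4]), Function.update_eq_self_iff.2 (by simp)]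
        · simpa using hI.cnt
        · simpa using hI.pos
    · intro s₁ _ _ ⟨hI, _⟩
      rw [Cfg.settle, if_pos h0]
      refine ⟨hI.mem.trans (layout_congr (fun v hv => by simp [hv]) (fun _ _ => rfl)
        (fun _ _ => rfl) (fun _ _ => rfl) rfl), hI.cnt, hI.pos, hI.dig, hI.le⟩
  · simp only [settleP, wp_cond, hcnt, h0, hc, Nat.lt_one_iff, if_false, wp_skip]
    rw [Cfg.settle, if_neg h0]
    exact hr

lemma wp_stepP (hw : Wide W N A n k r e) (hc : Ctx n k r L s) (hd : ∀ q, m.dig q ≤ r + 1)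
    (hp : p ≤ 3 * n) (hr : Rep A n r m p c s) :
    wp W N stepP (fun s' => ∃ p' ≤ p + 1, Rep A n r m p' (c.step A n) s') s := by
  refine wp_pickP hw hc hr.mem fun s₁ hF₁ h27 h28 => ?_
  have hc₁ := hF₁.ctx rfl hc
  have hr₁ : Rep A n r m p c s₁ := hr.congr (hF₁.mem rfl) (hF₁.reg 18 rfl) (hF₁.reg 17 rfl)
  simp only at h27 h28
  rw [wp_cond, h27, hc₁.2.2.2.2.1]
  by_cases h0 : (pick A n c.st n).1 = 0
  · rw [if_neg (by omega), wp_skip, Cfg.step, if_pos h0]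
    exact ⟨p, by omega, hr₁⟩
  · rw [if_pos (by omega), wp_seq, Cfg.step, if_neg h0]
    refine wp_mono (wp_frame (wp_actP hw hc₁ hd hp hr₁ h27 h28 (pick_snd n h0).1)) ?_
    rintro s₂ ⟨hF₂, p', hp', hr₂⟩
    exact wp_mono (wp_settleP hw (hF₂.ctx rfl hc₁) hr₂) fun s₃ hr₃ => ⟨p', hp', hr₃⟩

lemma Cfg.run_succ (N : ℕ) (c : Cfg) : c.run A n (N + 1) = (c.run A n N).step A n := by
  induction N generalizing c with
  | zero => rfl
  | succ N ih => exact ih (c.step A n)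

lemma wp_runP (hw : Wide W N A n k r e) (hc : Ctx n k r L s) (hd : ∀ q, m.dig q ≤ r + 1)
    (hp : p ≤ n) (hm : s.mem = layout n A { m with st := c.st })
    (hpos : s.reg 17 = n * n + n + n + n + n + p) (hcnt : c.cnt = 0)
    (hdig : c.dig = fun q => m.dig (p + q)) :
    wp W N runP (fun s' => s'.mem = layout n A { m with st := (c.run A n n).st }) s := by
  have haddr := hw.addr
  rw [runP, wp_seq, wp_const]
  refine ⟨by omega, wp_forN (n := n) (fun j s => ∃ p' ≤ p + j, Rep A n r m p' (c.run A n j) s)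
    (by decide) ⟨rfl, rfl, rfl⟩ hw.loops (by omega) (by simp [hc]) (by simp [hc]) ?_ ?_ ?_⟩
  · exact ⟨p, by omega, hm, by simp [Cfg.run, hcnt], by simp [hpos], hdig,
      by simp [Cfg.run, hcnt]⟩
  · rintro j hj s₁ hF₁ hj₁ ⟨p', hp', hr⟩
    have hc₁ : Ctx n k r L s₁ := hF₁.ctx rfl (by simp [Ctx, hc])
    refine wp_mono (wp_stepP hw hc₁ hd (by omega) hr) ?_
    rintro s₂ ⟨p'', hp'', hr₂⟩
    rw [Cfg.run_succ]
    exact ⟨p'', by omega, hr₂.congr rfl (by simp) (by simp)⟩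
  · rintro s₁ - - ⟨p', -, hr⟩
    exact hr.mem

/-- Set up the statuses for the subgraph induced by the vertices up to `R[12]`, reading one choice for
each marked vertex. -/
def initP : Program :=
  .arith .add 17 9 4 ⨟ forN 21 (.cond 12 21 (.const 33 0)
    (.arith .add 30 6 21 ⨟ .load 34 30 ⨟ .cond 34 3 (.const 33 2)
      (.load 33 17 ⨟ .arith .add 17 17 3 ⨟ .cond 33 3 (.const 33 1) (.const 33 3))) ⨟
    .arith .add 30 5 21 ⨟ .store 30 33)

lemma wp_initP (hw : Wide W N A n k r e) (hc : Ctx n k r L s) (hm : s.mem = layout n A m)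
    (hi : s.reg 12 = i) :
    wp W N initP (fun s' => s'.mem = layout n A { m with st := (start n i m.zf m.dig).st } ∧
      s'.reg 17 = n * n + n + n + n + n + rank i m.zf n) s := by
  have haddr := hw.addr
  simp only [initP, wp_seq, wp_add, hc]
  refine ⟨by omega, wp_forN (n := n) (fun j s =>
    s.mem = layout n A { m with
      st := fun u => if u < j then (start n i m.zf m.dig).st u else m.st u } ∧
    s.reg 17 = n * n + n + n + n + n + rank i m.zf j)
    (by decide) ⟨rfl, rfl, rfl⟩ hw.loops (by omega) (by simp [hc]) (by simp [hc]) ?_ ?_ ?_⟩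
  · simp [hm, rank]
  · rintro j hj s₁ hF₁ hj₁ ⟨hmem, hpos⟩
    have hc₁ : Ctx n k r L s₁ := hF₁.ctx rfl (by simp [Ctx, hc])
    have hi₁ : s₁.reg 12 = i := by rw [hF₁.reg 12 rfl]; simp [hi]
    have hzf : s₁.mem (n * n + n + j) = m.zf j := by rw [hmem, layout_zf hj]
    have hdig : s₁.mem (n * n + n + n + n + n + rank i m.zf j) = m.dig (rank i m.zf j) := by
      rw [hmem, layout_dig]
    have hrk := rank_le i m.zf j
    have hupd : ∀ x, x = (start n i m.zf m.dig).st j →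
        Function.update s₁.mem (n * n + j) x = layout n A { m with
          st := fun u => if u ≤ j then (start n i m.zf m.dig).st u else m.st u } := by
      intro x hx
      rw [hmem, update_layout_st hj]
      congr 2
      refine update_eq (by simp [hx]) fun u hu => ?_
      simp [Nat.le_iff_lt_or_eq, hu]
    have hst : (start n i m.zf m.dig).st j = if i < j then 0 else if m.zf j = 0 then 2
      else if m.dig (rank i m.zf j) = 0 then 1 else 3 := rfl
    rw [rank_succ]
    by_cases h1 : i < j
    · simp [hc₁, hi₁, hj₁, h1, hpos]
      clear hc hc₁ hpos hdig
      exact ⟨by omega, by omega, hupd 0 (by simp [hst, h1])⟩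
    by_cases h2 : m.zf j = 0
    · simp [hc₁, hi₁, hj₁, h1, hzf, h2, hpos]
      clear hc hc₁ hpos hdig
      exact ⟨by omega, by omega, by omega, hupd 2 (by simp [hst, h1, h2])⟩
    have h1' : j ≤ i := by clear hc hc₁; omega
    by_cases h3 : m.dig (rank i m.zf j) = 0
    · simp [hc₁, hi₁, hj₁, h1, hzf, h2, hpos, hdig, h3, h1']
      clear hc hc₁ hpos hdig
      exact ⟨by omega, by omega, by omega, by omega, hupd 1 (by simp [hst, h1, h2, h3]), by omega⟩
    · simp [hc₁, hi₁, hj₁, h1, hzf, h2, hpos, hdig, h3, h1']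
      clear hc hc₁ hpos hdig
      exact ⟨by omega, by omega, by omega, by omega, hupd 3 (by simp [hst, h1, h2, h3]), by omega⟩
  · rintro s₁ - - ⟨hmem, hpos⟩
    exact ⟨hmem.trans (layout_congr (fun v hv => by simp [hv]) (fun _ _ => rfl)
      (fun _ _ => rfl) (fun _ _ => rfl) rfl), hpos⟩

end

section
variable {W : ℕ} {N : ℕ → ℕ} {A : ℕ → ℕ → ℕ} {n k r e L i v : ℕ} {P : Program} {s s' : State}
  {Q : State → Prop} {m : Mem}

/-! ### The program that verifies a candidate -/

/-- `R[46]` becomes the number of deleted vertices. -/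
def countP : Program :=
  .const 46 0 ⨟ forN 21 (.arith .add 30 5 21 ⨟ .load 33 30 ⨟ ifEq 33 1 (.arith .add 46 46 3) .skip)

/-- Give the mark `2` to the vertices that are deleted or larger than `R[12]`, and `0` to the
others. -/
def markP : Program :=
  forN 21 (.const 34 0 ⨟ .cond 12 21 (.const 34 2)
    (.arith .add 30 5 21 ⨟ .load 33 30 ⨟ ifEq 33 1 (.const 34 2) .skip) ⨟
    .arith .add 30 8 21 ⨟ .store 30 34)

/-- One search step, at the vertex `R[42]`; the excess is held in `R[45]`. -/
def visitP : Program :=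
  .arith .add 30 8 42 ⨟ .load 33 30 ⨟ .cond 33 3 (sumP 8 1 42 ⨟ .cond 4 22
    (.arith .mul 35 0 42 ⨟ .arith .add 35 35 42 ⨟ .load 35 35 ⨟ .arith .add 45 45 22 ⨟
      .arith .add 45 45 35 ⨟ .arith .sub 45 45 3 ⨟ .arith .add 30 8 42 ⨟ .store 30 3) .skip) .skip

/-- The search from the vertex `R[40]`. -/
def searchP : Program :=
  .store 30 3 ⨟ .arith .mul 45 0 40 ⨟ .arith .add 45 45 40 ⨟ .load 45 45 ⨟
    forN 41 (forN 42 visitP)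

/-- `R[16]` becomes `1` if the deleted vertices form a solution for the subgraph induced by the
vertices up to `R[12]`, and `0` otherwise. -/
def checkP : Program :=
  .const 16 1 ⨟ countP ⨟ .cond 1 46 (.const 16 0) .skip ⨟
    forN 40 (markP ⨟ .arith .add 30 8 40 ⨟ .load 33 30 ⨟
      .cond 33 3 (searchP ⨟ .cond 2 45 (.const 16 0) .skip) .skip)

lemma wp_countP (hw : Wide W N A n k r e) (hc : Ctx n k r L s) (hm : s.mem = layout n A m) :
    wp W N countP (fun s' => s'.reg 46 = (cls n m.st 1).card) s := by
  have haddr := hw.addr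
  simp only [countP, wp_seq, wp_const]
  refine ⟨by omega, wp_forN (n := n) (fun j s => s.reg 46 = (cls j m.st 1).card)
    (by decide) ⟨rfl, rfl, rfl⟩ hw.loops (by omega) (by simp [hc]) (by simp [hc]) (by simp [cls])
    ?_ fun s₁ _ _ h => h⟩
  intro j hj s₁ hF₁ hj₁ hI
  have hc₁ : Ctx n k r L s₁ := hF₁.ctx rfl (by simp [Ctx, hc])
  have hm₁ : s₁.mem = layout n A m := by rw [hF₁.mem rfl]; exact hm
  simp [hc₁, hj₁]
  refine ⟨by omega, ?_⟩
  rw [wp_ifEq (by decide) (by omega)]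
  have hle : (cls j m.st 1).card ≤ j := (Finset.card_filter_le _ _).trans (by simp)
  have hcls : (cls (j + 1) m.st 1).card = (cls j m.st 1).card + if m.st j = 1 then 1 else 0 := by
    rw [cls, Finset.range_add_one, Finset.filter_insert]
    split_ifs with h
    · rw [Finset.card_insert_of_notMem (by simp)]; rfl
    · rfl
  simp [hm₁, layout_st hj, hc₁, hI, hcls]
  clear hc hc₁
  intro h
  exact ⟨by omega, h⟩

lemma wp_markP (hw : Wide W N A n k r e) (hc : Ctx n k r L s) (hi : s.reg 12 = i)
    (hm : s.mem = layout n A m) :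
    wp W N markP (fun s' => s'.mem =
      layout n A { m with mark := fun u => if i < u ∨ m.st u = 1 then 2 else 0 }) s := by
  have haddr := hw.addr
  refine wp_forN (n := n) (fun j s => s.mem =
      layout n A { m with mark := fun u =>
        if u < j then (if i < u ∨ m.st u = 1 then 2 else 0) else m.mark u }) (by decide) ⟨rfl, rfl, rfl⟩ hw.loops (by omega) (by simp [hc])
    (by simp [hc]) (by simp [hm]) ?_ ?_
  · intro j hj s₁ hF₁ hj₁ hI
    have hc₁ : Ctx n k r L s₁ := hF₁.ctx rfl (by simp [Ctx, hc])
    have hi₁ : s₁.reg 12 = i := by rw [hF₁.reg 12 rfl]; simp [hi]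
    have hst : s₁.mem (n * n + j) = m.st j := by rw [hI, layout_st hj]
    have hupd : ∀ x, x = (if i < j ∨ m.st j = 1 then 2 else 0) →
        Function.update s₁.mem (n * n + n + n + n + j) x = layout n A { m with
          mark := fun u => if u ≤ j then (if i < u ∨ m.st u = 1 then 2 else 0) else m.mark u } := by
      intro x hx
      rw [hI, update_layout_mark hj]
      congr 2
      refine update_eq (by simp [hx]) fun u hu => ?_
      simp [Nat.le_iff_lt_or_eq, hu]
    by_cases h1 : i < j
    · simp [hc₁, hi₁, hj₁, h1]
      clear hc hc₁
      exact ⟨by omega, by omega, by omega, hupd 2 (by simp [h1])⟩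
    · simp [hc₁, hi₁, hj₁, h1]
      refine ⟨by omega, by omega, ?_⟩
      rw [wp_ifEq (by decide) (by omega)]
      simp [hst, hc₁, hj₁]
      clear hc hc₁
      split_ifs with h2
      · exact ⟨by omega, by omega, hupd 2 (by simp [h2])⟩
      · exact ⟨by omega, hupd 0 (by simp [h1, h2])⟩
  · intro s₁ _ _ hI
    exact hI.trans (layout_congr (fun _ _ => rfl) (fun _ _ => rfl) (fun _ _ => rfl)
      (fun v hv => by simp [hv]) rfl)

/-- The excess is bounded by the number of edges, so it fits into a word. -/
lemma SearchInv.snd_le (hw : Wide W N A n k r e) {Y : Finset ℕ} {p : (ℕ → ℕ) × ℕ} {x : ℕ}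
    (h : SearchInv A n Y x p) : p.2 ≤ n * (n * e + e) := by
  have h1 := h.excess
  have h2 : 0 < (cls n p.1 1).card := Finset.card_pos.2 ⟨x, h.mem⟩
  have h3 : twiceEdges A (cls n p.1 1) ≤ n * (n * e + e) := by
    refine (Finset.sum_le_card_nsmul _ _ (n * e + e) fun u _ => ?_).trans ?_
    · exact Nat.add_le_add (hw.deg_le u p.1 1) (hw.le u u)
    · rw [smul_eq_mul]
      exact Nat.mul_le_mul_right _ ((Finset.card_filter_le _ _).trans (by simp))
  omega

lemma wp_visitP (hw : Wide W N A n k r e) (hc : Ctx n k r L s) {Y : Finset ℕ} {p : (ℕ → ℕ) × ℕ}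
    {x : ℕ} (h : SearchInv A n Y x p) (hm : s.mem = layout n A { m with mark := p.1 })
    (hp : s.reg 45 = p.2) (hv : s.reg 42 = v) (hvn : v < n) :
    wp W N visitP (fun s' => s'.mem = layout n A { m with mark := (visit A n v p).1 } ∧
      s'.reg 45 = (visit A n v p).2) s := by
  have haddr := hw.addr
  have hle := h.snd_le hw
  have hex := hw.excess
  have hdeg := hw.deg_le v p.1 1
  have hl := hw.le v v
  have hmk : s.mem (n * n + n + n + n + v) = p.1 v := by rw [hm, layout_mark hvn]
  have h1 := hw.mul_lt hvn
  have h2 := hw.mul_add_lt hvn hvn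
  simp [visitP, hc, hv, hmk]
  refine ⟨by omega, ?_⟩
  by_cases h0 : p.1 v = 0
  · rw [if_pos h0]
    refine wp_sumP (m := { m with mark := p.1 }) (f := p.1) hw (L := L) (by simp [Ctx, hc])
      (.inr ⟨rfl, rfl⟩) (.inr rfl) (by omega) (by simpa using hv) hvn (by simpa using hm) ?_
    intro s₁ hF₁ hs₁
    have hc₁ : Ctx n k r L s₁ := hF₁.ctx rfl (by simp [Ctx, hc])
    have hm₁ : s₁.mem = layout n A { m with mark := p.1 } := by rw [hF₁.mem rfl]; simpa using hm
    have hv₁ : s₁.reg 42 = v := by rw [hF₁.reg 42 rfl]; simpa using hv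
    have hp₁ : s₁.reg 45 = p.2 := by rw [hF₁.reg 45 rfl]; simpa using hp
    have hadj : s₁.mem (n * v + v) = A v v := by rw [hm₁, layout_adj hvn hvn]
    by_cases hd : 0 < deg A v (cls n p.1 1)
    · simp [hc₁, hs₁, hv₁, hd, hp₁, hadj, visit, h0]
      clear hc hc₁
      exact ⟨h1, h2, by omega, by omega, by omega, by omega,
        by rw [hm₁, update_layout_mark hvn]⟩
    · simp only [wp_cond, hc₁, hs₁, hd, if_false, wp_skip]
      rw [visit, if_neg (by tauto)]
      exact ⟨hm₁, hp₁⟩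
  · rw [if_neg h0, visit, if_neg (by tauto)]
    simpa using ⟨hm, hp⟩

lemma wp_searchP (hw : Wide W N A n k r e) (hc : Ctx n k r L s) {Y : Finset ℕ} {x : ℕ}
    (hY : cls n m.mark 0 = Y) (h1 : cls n m.mark 1 = ∅) (hx : s.reg 40 = x) (hxn : x < n)
    (hx0 : m.mark x = 0) (h30 : s.reg 30 = n * n + n + n + n + x) (hm : s.mem = layout n A m) :
    wp W N searchP (fun s' => (∃ mk, s'.mem = layout n A { m with mark := mk }) ∧
      s'.reg 45 = (search A n m.mark x).2) s := by
  have haddr := hw.addr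
  have hinit := SearchInv.init (A := A) hY h1 (by rw [← hY]; exact mem_cls.2 ⟨hxn, hx0⟩)
  have h1 := hw.mul_lt hxn
  have h2 := hw.mul_add_lt hxn hxn
  have hms : Function.update s.mem (n * n + n + n + n + x) 1 =
      layout n A { m with mark := Function.update m.mark x 1 } := by
    rw [hm, update_layout_mark hxn]
  simp [searchP, hc, hx, h30, h1, h2, hms, layout_adj hxn hxn]
  refine wp_forN (n := n) (fun t s =>
    s.mem = layout n A { m with mark := (rounds A n t (Function.update m.mark x 1, A x x)).1 } ∧
    s.reg 45 = (rounds A n t (Function.update m.mark x 1, A x x)).2)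
    (by decide) ⟨rfl, rfl, rfl⟩ hw.loops (by omega) (by simp [hc]) (by simp [hc]) ?_ ?_
    fun s₁ _ _ h => ⟨⟨_, h.1⟩, h.2⟩
  · simp [rounds, hms]
  intro t ht s₁ hF₁ ht₁ hI
  have hc₁ : Ctx n k r L s₁ := hF₁.ctx rfl (by simp [Ctx, hc])
  have hinv := hinit.rounds hw.symm t
  refine wp_forN (n := n) (fun j s =>
    s.mem = layout n A { m with mark :=
      (pass A n j (rounds A n t (Function.update m.mark x 1, A x x))).1 } ∧
    s.reg 45 = (pass A n j (rounds A n t (Function.update m.mark x 1, A x x))).2)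
    (by decide) ⟨rfl, rfl, rfl⟩ hw.loops (by omega) (by simp [hc₁]) (by simp [hc₁]) ?_ ?_ ?_
  · simpa [pass] using hI
  · intro j hj s₂ hF₂ hj₂ hI₂
    have hc₂ : Ctx n k r L s₂ := hF₂.ctx rfl (by simp [Ctx, hc₁])
    refine wp_mono (wp_visitP hw hc₂ (hinv.pass hw.symm hj.le) hI₂.1 hI₂.2 hj₂ hj) ?_
    intro s₃ h₃
    simpa [pass] using h₃
  · intro s₂ _ _ h
    simpa [rounds] using h

lemma wp_checkP (hw : Wide W N A n k r e) (hc : Ctx n k r L s) (hi : s.reg 12 = i) (hin : i < n)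
    (hm : s.mem = layout n A m) :
    wp W N checkP (fun s' => (∃ mk, s'.mem = layout n A { m with mark := mk }) ∧ s'.reg 16 ≤ 1 ∧
      (s'.reg 16 = 1 ↔ Valid A n r k i m.st)) s := by
  have haddr := hw.addr
  set mk : ℕ → ℕ := fun u => if i < u ∨ m.st u = 1 then 2 else 0 with hmk
  have hY : cls n mk 0 = Finset.range (i + 1) \ cls n m.st 1 := by
    ext u
    simp only [mem_cls, hmk, Finset.mem_sdiff, Finset.mem_range]
    clear hc
    grind
  have h1 : cls n mk 1 = ∅ := by
    ext u
    have : mk u ≠ 1 := by simp only [hmk]; split_ifs <;> simp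
    simp [mem_cls, this]
  have hsp := sparse_iff_search (r := r) hw.symm hY h1
  simp only [checkP, wp_seq, wp_const]
  refine ⟨by omega, wp_mono (wp_frame (wp_countP (L := L) (m := m) hw (by simp [Ctx, hc])
    (by simpa using hm))) ?_⟩
  rintro s₁ ⟨hF₁, hs₁⟩
  have hc₁ : Ctx n k r L s₁ := hF₁.ctx rfl (by simp [Ctx, hc])
  have hi₁ : s₁.reg 12 = i := by rw [hF₁.reg 12 rfl]; simp [hi]
  have hm₁ : s₁.mem = layout n A m := by rw [hF₁.mem rfl]; simpa using hm
  have hg₁ : s₁.reg 16 = 1 := by rw [hF₁.reg 16 rfl]; simp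
  suffices H : ∀ s₂ : State, Ctx n k r L s₂ → s₂.reg 12 = i → s₂.mem = layout n A m →
      (s₂.reg 16 = if (cls n m.st 1).card ≤ k then 1 else 0) →
      wp W N (forN 40 (markP ⨟ .arith .add 30 8 40 ⨟ .load 33 30 ⨟
        .cond 33 3 (searchP ⨟ .cond 2 45 (.const 16 0) .skip) .skip)) 
        (fun s' => (∃ mk, s'.mem = layout n A { m with mark := mk }) ∧ s'.reg 16 ≤ 1 ∧
          (s'.reg 16 = 1 ↔ Valid A n r k i m.st)) s₂ by
    rw [wp_seq, wp_cond, hc₁.2.1, hs₁]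
    split_ifs with hk
    · exact ⟨by omega, H _ (by simp [Ctx, hc₁]) (by simpa using hi₁) hm₁
        (by rw [if_neg (by omega)]; simp)⟩
    · exact H _ hc₁ hi₁ hm₁ (by rw [if_pos (by omega)]; exact hg₁)
  clear hc hi hm hF₁ hs₁ hc₁ hi₁ hm₁ hg₁ s₁
  intro s₀ hc hi hm hg
  refine wp_forN (n := n) (fun j s => (∃ mk, s.mem = layout n A { m with mark := mk }) ∧
    s.reg 16 = if (cls n m.st 1).card ≤ k ∧ ∀ x < j, mk x = 0 → (search A n mk x).2 ≤ r
      then 1 else 0)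
    (by decide) ⟨rfl, rfl, rfl⟩ hw.loops (by omega) (by simp [hc]) (by simp [hc]) ?_ ?_ ?_
  · simpa [hg] using ⟨m.mark, hm⟩
  · rintro j hj s₁ hF₁ hj₁ ⟨⟨mk₁, hm₁⟩, hg₁⟩
    have hc₁ : Ctx n k r L s₁ := hF₁.ctx rfl (by simp [Ctx, hc])
    have hi₁ : s₁.reg 12 = i := by rw [hF₁.reg 12 rfl]; simp [hi]
    rw [wp_seq]
    refine wp_mono (wp_frame (wp_markP hw hc₁ hi₁ hm₁)) ?_
    rintro s₂ ⟨hF₂, hm₂⟩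
    have hc₂ : Ctx n k r L s₂ := hF₂.ctx rfl hc₁
    have hj₂ := (hF₂.reg 40 rfl).trans hj₁
    have hg₂ := (hF₂.reg 16 rfl).trans hg₁
    change s₂.mem = layout n A { m with mark := mk } at hm₂
    have hmkj : s₂.mem (n * n + n + n + n + j) = mk j := by rw [hm₂, layout_mark hj]
    have hstep : (∀ x < j + 1, mk x = 0 → (search A n mk x).2 ≤ r) ↔
        (∀ x < j, mk x = 0 → (search A n mk x).2 ≤ r) ∧ (mk j = 0 → (search A n mk j).2 ≤ r) :=
      Nat.forall_lt_succ_right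
    simp only [hstep]
    simp only [wp_seq, wp_add, wp_load, wp_cond, reg_setReg, mem_setReg, hc₂, hj₂]
    refine ⟨by clear hc hc₁ hc₂; omega, ?_⟩
    by_cases h0 : mk j = 0
    · simp [hmkj, h0]
      refine wp_mono (wp_frame (wp_searchP (m := { m with mark := mk }) (L := L) hw
        (by simp [Ctx, hc₂]) hY h1 (by simp [hj₂]) hj h0 (by simp) (by simpa using hm₂))) ?_
      rintro s₃ ⟨hF₃, ⟨mk₃, hm₃⟩, hs₃⟩
      have hc₃ : Ctx n k r L s₃ := hF₃.ctx rfl (by simp [Ctx, hc₂])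
      have hg₃ : s₃.reg 16 = _ := (hF₃.reg 16 rfl).trans (by simpa using hg₂)
      rw [wp_cond, hc₃.2.2.1, hs₃]
      change (if r < (search A n mk j).2 then _ else _)
      split_ifs with hr h2 h2
      · exact absurd hr (by simpa using h2.2.2)
      · exact ⟨by clear hc hc₁ hc₂ hc₃; omega, ⟨mk₃, by simpa using hm₃⟩, by simp⟩
      · exact ⟨⟨mk₃, hm₃⟩, hg₃.trans (if_pos ⟨h2.1, h2.2.1⟩)⟩
      · exact ⟨⟨mk₃, hm₃⟩, hg₃.trans (if_neg fun h => h2 ⟨h.1, h.2, not_lt.1 hr⟩)⟩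
    · simp [hmkj, h0, hg₂]
      exact ⟨mk, hm₂⟩
  · rintro s₁ - - ⟨⟨mk₁, hm₁⟩, hg₁⟩
    refine ⟨⟨mk₁, hm₁⟩, by rw [hg₁]; split_ifs <;> omega, ?_⟩
    rw [hg₁, Valid, hsp]
    split_ifs with h
    · exact iff_of_true rfl h
    · exact iff_of_false (by decide) h

end

/-! ### Enumerating the choices -/

/-- The digits of `t` to the base `r + 2`, cut off after `L` digits. -/
def digits (r L t j : ℕ) : ℕ := if j < L then t / (r + 2) ^ j % (r + 2) else 0

section
variable {r L t j : ℕ}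

lemma digits_le (r L t j : ℕ) : digits r L t j ≤ r + 1 := by
  rw [digits]
  split_ifs
  · have := Nat.mod_lt (t / (r + 2) ^ j) (show 0 < r + 2 by omega); omega
  · omega

lemma digits_zero (r L : ℕ) : digits r L 0 = fun _ => 0 := by
  funext j; simp [digits]

lemma digits_pow (r L : ℕ) : digits r L ((r + 2) ^ L) = fun _ => 0 := by
  funext j
  rw [digits]
  split_ifs with h
  · rw [Nat.pow_div h.le (by omega)]
    exact Nat.mod_eq_zero_of_dvd (dvd_pow_self _ (by omega))
  · rfl

/-- Every sequence of `L` choices occurs in the enumeration. -/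
lemma exists_digits (d : ℕ → ℕ) (hd : ∀ j, d j ≤ r + 1) :
    ∀ L, (∀ j, L ≤ j → d j = 0) → ∃ t < (r + 2) ^ L, digits r L t = d := by
  have key : ∀ L, ∃ t < (r + 2) ^ L, ∀ j < L, t / (r + 2) ^ j % (r + 2) = d j := by
    intro L
    induction L with
    | zero => exact ⟨0, by simp, by simp⟩
    | succ L ih =>
      obtain ⟨t, ht, h⟩ := ih
      refine ⟨t + (r + 2) ^ L * d L, ?_, fun j hj => ?_⟩
      · have := Nat.mul_le_mul_left ((r + 2) ^ L) (hd L)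
        rw [pow_succ]
        nlinarith
      · rcases Nat.lt_succ_iff_lt_or_eq.1 hj with hj | rfl
        · obtain ⟨q, rfl⟩ := Nat.exists_eq_add_of_lt hj
          rw [show (r + 2) ^ (j + q + 1) * d (j + q + 1) =
            (r + 2) ^ j * ((r + 2) * ((r + 2) ^ q * d (j + q + 1))) by ring,
            Nat.add_mul_div_left _ _ (by positivity), Nat.add_mul_mod_self_left]
          exact h j hj
        · rw [Nat.add_mul_div_left _ _ (by positivity), Nat.div_eq_of_lt ht, zero_add]
          exact Nat.mod_eq_of_lt (by have := hd j; omega)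
  intro L hL
  obtain ⟨t, ht, h⟩ := key L
  refine ⟨t, ht, funext fun j => ?_⟩
  rw [digits]
  split_ifs with hj
  · exact h j hj
  · exact (hL j (by omega)).symm

/-- The effect of an increment on one digit, and on the carry. -/
lemma digits_succ (hj : j < L) :
    digits r L (t + 1) j = (if (r + 2) ^ j ∣ t + 1 then
      if digits r L t j < r + 1 then digits r L t j + 1 else 0 else digits r L t j) ∧
    ((r + 2) ^ (j + 1) ∣ t + 1 ↔ (r + 2) ^ j ∣ t + 1 ∧ digits r L t j = r + 1) := by
  simp only [digits, if_pos hj, Nat.succ_div]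
  set q := t / (r + 2) ^ j with hq
  have hm := Nat.mod_lt q (show 0 < r + 2 by omega)
  have hmod : (q + 1) % (r + 2) = if q % (r + 2) < r + 1 then q % (r + 2) + 1 else 0 := by
    rw [Nat.add_mod, Nat.mod_eq_of_lt (show 1 < r + 2 by omega)]
    split_ifs with h
    · exact Nat.mod_eq_of_lt (by omega)
    · rw [show q % (r + 2) + 1 = r + 2 by omega, Nat.mod_self]
  constructor
  · split_ifs at hmod ⊢ <;> simp_all
  · constructor
    · intro h
      have hd : (r + 2) ^ j ∣ t + 1 := (pow_dvd_pow _ (by omega)).trans h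
      refine ⟨hd, ?_⟩
      obtain ⟨x, hx⟩ := h
      have : q + 1 = (r + 2) * x := by
        have := Nat.succ_div (a := t) (b := (r + 2) ^ j)
        rw [if_pos hd, hx, pow_succ, mul_assoc, Nat.mul_div_cancel_left _ (by positivity)] at this
        exact this.symm
      rw [this, Nat.mul_mod_right] at hmod
      split_ifs at hmod
      omega
    · rintro ⟨hd, h⟩
      have h1 : (t + 1) / (r + 2) ^ j = q + 1 := by rw [Nat.succ_div, if_pos hd]
      rw [if_neg (by omega)] at hmod
      rw [← Nat.mul_div_cancel' hd, h1, pow_succ]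
      exact Nat.mul_dvd_mul_left _ (Nat.dvd_of_mod_eq_zero hmod)

end

section
variable {W : ℕ} {N : ℕ → ℕ} {A : ℕ → ℕ → ℕ} {n k r e L i t : ℕ} {P : Program} {s s' : State}
  {Q : State → Prop} {m : Mem}

/-- Proceed to the next sequence of choices; `R[15]` becomes `1` if there is none, and `0`
otherwise. -/
def nextP : Program :=
  .const 15 1 ⨟ forN 21 (.cond 21 10 (.cond 4 15 (.arith .add 30 9 21 ⨟ .load 33 30 ⨟
    .cond 33 11 (.arith .add 33 33 3 ⨟ .store 30 33 ⨟ .const 15 0) (.store 30 4)) .skip) .skip)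

lemma wp_nextP (hw : Wide W N A n k r e) (hc : Ctx n k r L s) (hL : L ≤ n)
    (hm : s.mem = layout n A { m with dig := digits r L t }) :
    wp W N nextP (fun s' => s'.mem = layout n A { m with dig := digits r L (t + 1) } ∧
      s'.reg 15 = if (r + 2) ^ L ∣ t + 1 then 1 else 0) s := by
  have haddr := hw.addr
  have htar := hw.target
  simp only [nextP, wp_seq, wp_const]
  refine ⟨by omega, wp_forN (n := n) (fun j s => s.mem = layout n A { m with
      dig := fun q => if q < j then digits r L (t + 1) q else digits r L t q } ∧
      s.reg 15 = if (r + 2) ^ min j L ∣ t + 1 then 1 else 0)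
    (by decide) ⟨rfl, rfl, rfl⟩ hw.loops (by omega) (by simp [hc]) (by simp [hc]) ?_ ?_ ?_⟩
  · simpa using hm
  · rintro j hj s₁ hF₁ hj₁ ⟨hm₁, h15⟩
    have hc₁ : Ctx n k r L s₁ := hF₁.ctx rfl (by simp [Ctx, hc])
    have hupd : ∀ x, x = digits r L (t + 1) j →
        Function.update s₁.mem (n * n + n + n + n + n + j) x = layout n A { m with
          dig := fun q => if q ≤ j then digits r L (t + 1) q else digits r L t q } := by
      intro x hx
      rw [hm₁, update_layout_dig]
      congr 2
      refine update_eq (by simp [hx]) fun u hu => ?_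
      simp [Nat.le_iff_lt_or_eq, hu]
    have hkeep : digits r L t j = digits r L (t + 1) j → s₁.mem = layout n A { m with
          dig := fun q => if q ≤ j then digits r L (t + 1) q else digits r L t q } := by
      intro h
      rw [hm₁]
      congr 2
      funext q
      by_cases hq : q = j
      · simp [hq, h]
      · simp [Nat.le_iff_lt_or_eq, hq]
    have hmem : s₁.mem (n * n + n + n + n + n + j) = digits r L t j := by
      rw [hm₁, layout_dig]; simp
    have hdl := digits_le r L t j
    by_cases hjL : j < L
    · obtain ⟨h1, h2⟩ := digits_succ (r := r) (t := t) hjL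
      rw [min_eq_left hjL.le] at h15
      rw [min_eq_left (Nat.succ_le_of_lt hjL)]
      by_cases hd : (r + 2) ^ j ∣ t + 1
      · rw [if_pos hd] at h15 h1
        by_cases hl : digits r L t j < r + 1
        · rw [if_pos hl] at h1
          have h2' : ¬ (r + 2) ^ (j + 1) ∣ t + 1 := by rw [h2]; omega
          simp [hc₁, hj₁, hjL, h15, hmem, hl, h2']
          clear hc hc₁
          exact ⟨by omega, by omega, by omega, hupd _ h1.symm⟩
        · rw [if_neg hl] at h1
          have h2' : (r + 2) ^ (j + 1) ∣ t + 1 := h2.2 ⟨hd, by omega⟩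
          simp [hc₁, hj₁, hjL, h15, hmem, hl, h2']
          clear hc hc₁
          exact ⟨by omega, hupd _ h1.symm⟩
      · rw [if_neg hd] at h15 h1
        have h2' : ¬ (r + 2) ^ (j + 1) ∣ t + 1 := fun h => hd (h2.1 h).1
        simp [hc₁, hj₁, hjL, h15, h2']
        exact hkeep h1.symm
    · rw [min_eq_right (by omega)] at h15
      rw [min_eq_right (by omega)]
      simp [hc₁, hj₁, hjL, h15]
      exact hkeep (by simp [digits, hjL])
  · rintro s₁ - - ⟨hm₁, h15⟩
    rw [min_eq_right hL] at h15
    refine ⟨hm₁.trans ?_, h15⟩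
    congr 2
    funext q
    by_cases hq : q < n
    · simp [hq]
    · simp [hq, digits, show ¬ q < L by omega]

end

section
variable {W : ℕ} {N : ℕ → ℕ} {A : ℕ → ℕ → ℕ} {n k r e L i t : ℕ} {P : Program} {s s' : State}
  {Q : State → Prop} {m : Mem}

/-! ### The whole program -/

/-- Store the deleted vertices as a solution. -/
def saveP : Program :=
  forN 21 (.arith .add 30 5 21 ⨟ .load 33 30 ⨟ .const 34 0 ⨟ ifEq 33 1 (.const 34 1) .skip ⨟
    .arith .add 30 7 21 ⨟ .store 30 34)

lemma wp_saveP (hw : Wide W N A n k r e) (hc : Ctx n k r L s) (hm : s.mem = layout n A m) :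
    wp W N saveP (fun s' => s'.mem =
      layout n A { m with bst := fun u => if m.st u = 1 then 1 else 0 }) s := by
  have haddr := hw.addr
  refine wp_forN (n := n) (fun j s => s.mem = layout n A { m with
      bst := fun u => if u < j then (if m.st u = 1 then 1 else 0) else m.bst u })
    (by decide) ⟨rfl, rfl, rfl⟩ hw.loops (by omega) (by simp [hc]) (by simp [hc]) (by simp [hm])
    ?_ ?_
  · intro j hj s₁ hF₁ hj₁ hI
    have hc₁ : Ctx n k r L s₁ := hF₁.ctx rfl (by simp [Ctx, hc])
    have hst : s₁.mem (n * n + j) = m.st j := by rw [hI, layout_st hj]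
    have hupd : ∀ x, x = (if m.st j = 1 then 1 else 0) →
        Function.update s₁.mem (n * n + n + n + j) x = layout n A { m with
          bst := fun u => if u ≤ j then (if m.st u = 1 then 1 else 0) else m.bst u } := by
      intro x hx
      rw [hI, update_layout_bst hj]
      congr 2
      refine update_eq (by simp [hx]) fun u hu => ?_
      simp [Nat.le_iff_lt_or_eq, hu]
    simp [hc₁, hj₁]
    refine ⟨by omega, by omega, ?_⟩
    rw [wp_ifEq (by decide) (by omega)]
    simp [hst, hc₁, hj₁]
    clear hc hc₁
    split_ifs with h
    · exact ⟨by omega, by omega, hupd 1 (by simp [h])⟩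
    · exact ⟨by omega, hupd 0 (by simp [h])⟩
  · intro s₁ _ _ hI
    exact hI.trans (layout_congr (fun _ _ => rfl) (fun _ _ => rfl)
      (fun v hv => by simp [hv]) (fun _ _ => rfl) rfl)

/-- Take the stored solution as the present one. -/
def adoptP : Program :=
  forN 21 (.arith .add 30 7 21 ⨟ .load 33 30 ⨟ .arith .add 30 6 21 ⨟ .store 30 33)

lemma wp_adoptP (hw : Wide W N A n k r e) (hc : Ctx n k r L s) (hm : s.mem = layout n A m) :
    wp W N adoptP (fun s' => s'.mem = layout n A { m with zf := m.bst }) s := by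
  have haddr := hw.addr
  refine wp_forN (n := n) (fun j s => s.mem = layout n A { m with
      zf := fun u => if u < j then m.bst u else m.zf u })
    (by decide) ⟨rfl, rfl, rfl⟩ hw.loops (by omega) (by simp [hc]) (by simp [hc]) (by simp [hm])
    ?_ ?_
  · intro j hj s₁ hF₁ hj₁ hI
    have hc₁ : Ctx n k r L s₁ := hF₁.ctx rfl (by simp [Ctx, hc])
    have hb : s₁.mem (n * n + n + n + j) = m.bst j := by rw [hI, layout_bst hj]
    simp [hc₁, hj₁, hb]
    clear hc hc₁
    refine ⟨by omega, by omega, ?_⟩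
    rw [hI, update_layout_zf hj]
    congr 2
    refine update_eq (by simp) fun u hu => ?_
    simp [Nat.le_iff_lt_or_eq, hu]
  · intro s₁ _ _ hI
    exact hI.trans (layout_congr (fun _ _ => rfl) (fun v hv => by simp [hv])
      (fun _ _ => rfl) (fun _ _ => rfl) rfl)

/-- Try the present sequence of choices. -/
def tryP : Program :=
  initP ⨟ runP ⨟ checkP ⨟ .cond 4 16 (saveP ⨟ .const 14 1) .skip ⨟ nextP

/-- The entries of `f` below `i` mark a solution for the subgraph induced by `0, …, i - 1`. -/
def Marks (A : ℕ → ℕ → ℕ) (k r i : ℕ) (f : ℕ → ℕ) : Prop :=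
  ((Finset.range i).filter (fun u => f u ≠ 0)).card ≤ k ∧
    Sparse A r ((Finset.range i).filter (fun u => f u = 0))

lemma Valid.marks {st : ℕ → ℕ} (h : Valid A n r k i st) (hi : i < n) :
    Marks A k r (i + 1) (fun u => if st u = 1 then 1 else 0) := by
  refine ⟨(Finset.card_le_card fun u hu => ?_).trans h.1, h.2.mono fun u hu => ?_⟩
  · simp only [Finset.mem_filter, Finset.mem_range, ne_eq, ite_eq_right_iff, Nat.one_ne_zero,
      imp_false, not_not] at hu
    exact mem_cls.2 ⟨by omega, hu.2⟩
  · simp only [Finset.mem_filter, Finset.mem_range, ite_eq_right_iff, Nat.one_ne_zero,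
      imp_false] at hu
    simp [mem_cls, hu]

/-- The state before the sequence of choices with number `t` is tried: the marks `zf` are those of the
solution to be compressed, and `R[14]` tells whether an earlier sequence has produced a smaller
solution, which then is stored in the array `bst`. -/
structure Trial (A : ℕ → ℕ → ℕ) (n k r L i : ℕ) (zf : ℕ → ℕ) (t : ℕ) (s : State) : Prop where
  ctx : Ctx n k r L s
  idx : s.reg 12 = i
  mem : ∃ m : Mem, m.zf = zf ∧ m.dig = digits r L t ∧ s.mem = layout n A m ∧
    (s.reg 14 = 1 → Marks A k r (i + 1) m.bst)
  le : s.reg 14 ≤ 1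
  none : s.reg 14 = 0 → ∀ t' < t, ¬ Valid A n r k i (outcome A n i zf (digits r L t'))

lemma wp_tryP (hw : Wide W N A n k r e) (hL : L ≤ n) (hi : i < n) {zf : ℕ → ℕ}
    (h : Trial A n k r L i zf t s) :
    wp W N tryP (fun s' => Trial A n k r L i zf (t + 1) s' ∧
      s'.reg 15 = if (r + 2) ^ L ∣ t + 1 then 1 else 0) s := by
  have haddr := hw.addr
  obtain ⟨hc, hx, ⟨m, rfl, hd, hm, hb⟩, hle, hno⟩ := h
  rw [tryP, wp_seq]
  refine wp_mono (wp_frame (wp_initP hw hc hm hx)) ?_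
  rintro s₁ ⟨hF₁, hm₁, hp₁⟩
  have hc₁ : Ctx n k r L s₁ := hF₁.ctx rfl hc
  have hx₁ := (hF₁.reg 12 rfl).trans hx
  have h14₁ : s₁.reg 14 = s.reg 14 := hF₁.reg 14 rfl
  rw [wp_seq]
  refine wp_mono (wp_frame (wp_runP (c := start n i m.zf m.dig) hw hc₁
    (fun q => by rw [hd]; exact digits_le _ _ _ _) (rank_le i m.zf n) hm₁ hp₁ rfl rfl)) ?_
  rintro s₂ ⟨hF₂, hm₂⟩
  have hc₂ : Ctx n k r L s₂ := hF₂.ctx rfl hc₁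
  have hx₂ := (hF₂.reg 12 rfl).trans hx₁
  have h14₂ : s₂.reg 14 = s.reg 14 := (hF₂.reg 14 rfl).trans h14₁
  rw [wp_seq]
  refine wp_mono (wp_frame (wp_checkP hw hc₂ hx₂ hi hm₂)) ?_
  rintro s₃ ⟨hF₃, ⟨mk, hm₃⟩, hg, hv⟩
  have hc₃ : Ctx n k r L s₃ := hF₃.ctx rfl hc₂
  have hx₃ := (hF₃.reg 12 rfl).trans hx₂
  have h14₃ : s₃.reg 14 = s.reg 14 := (hF₃.reg 14 rfl).trans h14₂
  change s₃.reg 16 = 1 ↔ Valid A n r k i (outcome A n i m.zf m.dig) at hv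
  suffices H : ∀ s₄, Ctx n k r L s₄ → s₄.reg 12 = i → s₄.reg 14 ≤ 1 →
      (s₄.reg 14 = 0 → ∀ t' < t + 1, ¬ Valid A n r k i (outcome A n i m.zf (digits r L t'))) →
      (∃ m' : Mem, m'.zf = m.zf ∧ m'.dig = digits r L t ∧ s₄.mem = layout n A m' ∧
        (s₄.reg 14 = 1 → Marks A k r (i + 1) m'.bst)) →
      wp W N nextP (fun s' => Trial A n k r L i m.zf (t + 1) s' ∧
        s'.reg 15 = if (r + 2) ^ L ∣ t + 1 then 1 else 0) s₄ by
    rw [wp_seq, wp_cond, hc₃.2.2.2.2.1]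
    by_cases h16 : 0 < s₃.reg 16
    · rw [if_pos h16]
      have hval := hv.1 (by omega)
      rw [wp_seq]
      refine wp_mono (wp_frame (wp_saveP hw hc₃ hm₃)) ?_
      rintro s₄ ⟨hF₄, hm₄⟩
      have hc₄ : Ctx n k r L s₄ := hF₄.ctx rfl hc₃
      have hx₄ := (hF₄.reg 12 rfl).trans hx₃
      refine ⟨by clear hc hc₁ hc₂ hc₃ hc₄; omega, H _ (by simp [Ctx, hc₄]) (by simpa using hx₄)
        (by simp) (by simp) ⟨_, ?_, ?_, hm₄, fun _ => hval.marks hi⟩⟩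
      · rfl
      · exact hd
    · rw [if_neg h16]
      refine H s₃ hc₃ hx₃ (h14₃.trans_le hle) ?_ ⟨_, ?_, ?_, hm₃, fun h => hb (h14₃ ▸ h)⟩
      · intro h t' ht'
        rcases Nat.lt_succ_iff_lt_or_eq.1 ht' with ht' | rfl
        · exact hno (h14₃ ▸ h) t' ht'
        · rw [← hd, ← hv]; omega
      · rfl
      · exact hd
  rintro s₄ hc₄ hx₄ hle₄ hno₄ ⟨m', hz', hd', hm₄, hb₄⟩
  refine wp_mono (wp_frame (wp_nextP (m := m') (t := t) hw hc₄ hL (by rw [hm₄, ← hd']))) ?_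
  rintro s₅ ⟨hF₅, hm₅, h15⟩
  have h14₅ : s₅.reg 14 = s₄.reg 14 := hF₅.reg 14 rfl
  exact ⟨⟨hF₅.ctx rfl hc₄, (hF₅.reg 12 rfl).trans hx₄,
    ⟨{ m' with dig := digits r L (t + 1) }, hz', rfl, hm₅, fun h => hb₄ (h14₅ ▸ h)⟩, h14₅.trans_le hle₄,
    fun h => hno₄ (h14₅ ▸ h)⟩, h15⟩

/-- Add the vertex `R[12]` to the subgraph and to the solution; then search for a solution of the
new subgraph that is small enough. `R[13]` is set to `0` if there is none. The loop runs through all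
sequences of choices; it is the only loop whose length is not bounded by `R[0]`, and its test
`R[15] < R[3]` identifies it in `Program.cost`. -/
def extendP : Program :=
  .arith .add 30 6 12 ⨟ .store 30 3 ⨟ .const 14 0 ⨟ .const 15 0 ⨟ .loop 15 3 tryP ⨟
    .cond 4 14 adoptP (.const 13 0)

/-- The state before the vertex `i` is added. If `R[13]` is `1`, then the marks are a solution for the
subgraph induced by the smaller vertices; if it is `0`, then there is no solution of size at most `k`
for that subgraph, nor for any larger one. -/
structure Compressed (A : ℕ → ℕ → ℕ) (n k r i : ℕ) (s : State) : Prop where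
  mem : ∃ m : Mem, m.dig = (fun _ => 0) ∧ s.mem = layout n A m ∧
    (s.reg 13 = 1 → Marks A k r i m.zf)
  le : s.reg 13 ≤ 1
  none : s.reg 13 = 0 → ¬ ∃ X : Finset ℕ, X.card ≤ k ∧ Sparse A r (Finset.range i \ X)

lemma rank_update_self (f : ℕ → ℕ) :
    rank i (Function.update f i 1) n ≤ ((Finset.range i).filter (fun u => f u ≠ 0)).card + 1 := by
  refine (Finset.card_le_card (t := insert i ((Finset.range i).filter (fun u => f u ≠ 0)))
    fun u hu => ?_).trans (Finset.card_insert_le _ _)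
  simp only [Finset.mem_filter, Finset.mem_range, Finset.mem_insert] at hu ⊢
  by_cases h : u = i
  · exact Or.inl h
  · rw [Function.update_of_ne h] at hu
    exact Or.inr ⟨by omega, hu.2.2⟩

lemma wp_extendP (hw : Wide W N A n k r e) (hN : (r + 2) ^ L ≤ N 3) (hL : L ≤ n)
    (hL' : n ≤ L ∨ (k + 1) * (r + 3) ≤ L) (hi : i < n) (hc : Ctx n k r L s) (hx : s.reg 12 = i)
    (h : Compressed A n k r i s) :
    wp W N extendP (Compressed A n k r (i + 1)) s := by
  have haddr := hw.addr
  obtain ⟨⟨m, hd, hm, hz⟩, hle, hno⟩ := h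
  set zf := Function.update m.zf i 1 with hzf
  have hm' : Function.update s.mem (n * n + n + i) 1 = layout n A { m with zf := zf } := by
    rw [hm, update_layout_zf hi]
  simp [extendP, hc, hx]
  refine ⟨by omega, by omega, ?_⟩
  refine ⟨fun d s' => (∃ t, t + d = (r + 2) ^ L ∧ Trial A n k r L i zf t s') ∧
    s'.reg 13 = s.reg 13 ∧ s'.reg 15 = if d = 0 then 1 else 0, (r + 2) ^ L, hN, ?_, ?_, ?_⟩
  · refine ⟨⟨0, by simp, ⟨by simp [Ctx, hc], by simp [hx], ⟨{ m with zf := zf }, rfl, ?_, ?_, ?_⟩,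
      by simp, by simp⟩⟩, by simp, by simp⟩
    · simp [digits_zero, hd]
    · simp [hm']
    · simp
  · rintro d s₁ ⟨⟨t, ht, hT⟩, h13, h15⟩
    refine ⟨by rw [h15, hT.ctx.2.2.2.1]; simp, wp_mono (wp_frame (wp_tryP hw hL hi hT)) ?_⟩
    rintro s₂ ⟨hF₂, hT₂, h15₂⟩
    refine ⟨⟨t + 1, by omega, hT₂⟩, (hF₂.reg 13 rfl).trans h13, ?_⟩
    rw [h15₂]
    by_cases hd0 : d = 0
    · rw [if_pos hd0, if_pos]
      rw [← ht, hd0]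
    · rw [if_neg hd0, if_neg]
      exact Nat.not_dvd_of_pos_of_lt (by omega) (by omega)
  · rintro s₁ ⟨⟨t, ht, hT⟩, h13, h15⟩
    obtain rfl : t = (r + 2) ^ L := by simpa using ht
    obtain ⟨hc₁, hx₁, ⟨m₁, hz₁, hd₁, hm₁, hb₁⟩, hle₁, hno₁⟩ := hT
    rw [digits_pow] at hd₁
    refine ⟨by rw [h15, hc₁.2.2.2.1]; simp, ?_⟩
    rw [wp_cond, hc₁.2.2.2.2.1]
    split_ifs with h14
    · refine wp_mono (wp_frame (wp_adoptP hw hc₁ hm₁)) ?_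
      rintro s₂ ⟨hF₂, hm₂⟩
      have h13₂ : s₂.reg 13 = s.reg 13 := (hF₂.reg 13 rfl).trans h13
      refine ⟨⟨{ m₁ with zf := m₁.bst }, hd₁, hm₂, fun _ => hb₁ (by omega)⟩, h13₂.trans_le hle, fun h0 => ?_⟩
      rintro ⟨X, hX, hs⟩
      exact hno (h13₂ ▸ h0) ⟨X, hX, hs.mono (Finset.sdiff_subset_sdiff
        (Finset.range_subset_range.2 (Nat.le_succ i)) (Finset.Subset.refl _))⟩
    · refine ⟨by clear hc hc₁; omega, ⟨m₁, hd₁, hm₁, by simp⟩, by simp, fun _ hsol => ?_⟩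
      have h13' : s.reg 13 = 1 := by
        by_contra h0
        obtain ⟨X, hX, hs⟩ := hsol
        exact hno (by clear hc hc₁; omega) ⟨X, hX, hs.mono (Finset.sdiff_subset_sdiff
          (Finset.range_subset_range.2 (Nat.le_succ i)) (Finset.Subset.refl _))⟩
      obtain ⟨hz1, hz2⟩ := hz h13'
      have hz' : Sparse A r ((Finset.range (i + 1)).filter (fun u => zf u = 0)) := by
        refine hz2.mono fun u hu => ?_
        simp only [Finset.mem_filter, Finset.mem_range] at hu ⊢
        have hui : u ≠ i := by rintro rfl; simp [hzf] at hu
        rw [hzf, Function.update_of_ne hui] at hu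
        exact ⟨by omega, hu.2⟩
      obtain ⟨dig, hdig, hdL, hval⟩ := exists_valid_outcome (zf := zf) hw.symm hi
        ((rank_update_self m.zf).trans (by omega)) hz' hsol hL'
      obtain ⟨t, ht, rfl⟩ := exists_digits dig hdig L hdL
      exact hno₁ (by clear hc hc₁; omega) t ht hval

/-- The program: set up the registers, and add the vertices one after another. The sequences of
choices have length `min n ((k + 1) * (r + 3))`. -/
def mainP : Program :=
  .const 3 1 ⨟ .const 4 0 ⨟ .arith .mul 5 0 0 ⨟ .arith .add 6 5 0 ⨟ .arith .add 7 6 0 ⨟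
  .arith .add 8 7 0 ⨟ .arith .add 9 8 0 ⨟ .const 10 3 ⨟ .arith .add 10 10 2 ⨟
  .arith .add 11 1 3 ⨟ .arith .mul 10 11 10 ⨟ .cond 0 10 (.arith .add 10 0 4) .skip ⨟
  .arith .add 11 2 3 ⨟ .const 13 1 ⨟ forN 12 extendP ⨟ .arith .add 0 13 4

lemma wp_mainP (hw : Wide W N A n k r e) (hkr : (k + 1) * (r + 3) < W)
    (hN : (r + 2) ^ min n ((k + 1) * (r + 3)) ≤ N 3)
    (h0 : s.reg 0 = n) (h1 : s.reg 1 = k) (h2 : s.reg 2 = r)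
    (hm : s.mem = layout n A ⟨fun _ => 0, fun _ => 0, fun _ => 0, fun _ => 0, fun _ => 0⟩) :
    wp W N mainP (fun s' => s'.reg 0 ≤ 1 ∧ (s'.reg 0 = 1 ↔
      ∃ X : Finset ℕ, X.card ≤ k ∧ Sparse A r (Finset.range n \ X))) s := by
  have haddr := hw.addr
  have htar := hw.target
  set L := min n ((k + 1) * (r + 3)) with hL
  suffices H : ∀ s₁, Ctx n k r L s₁ → s₁.mem = s.mem →
      wp W N (.const 13 1 ⨟ forN 12 extendP ⨟ .arith .add 0 13 4) (fun s' => s'.reg 0 ≤ 1 ∧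
        (s'.reg 0 = 1 ↔ ∃ X : Finset ℕ, X.card ≤ k ∧ Sparse A r (Finset.range n \ X))) s₁ by
    have e3 : 3 + r = r + 3 := by omega
    simp only [mainP, wp_seq, wp_const, wp_add, wp_mul, wp_cond, wp_skip, reg_setReg, h0, h1, h2]
      at H ⊢
    simp [e3]
    refine ⟨by omega, by omega, by omega, by omega, by omega, by omega, by omega, by omega,
      by omega, by omega, hkr, ?_⟩
    split_ifs with hlt
    · refine ⟨by omega, by omega, ?_⟩
      simpa using H _ (by simp [Ctx, h0, h1, h2, hL]; omega) (by simp)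
    · refine ⟨by omega, ?_⟩
      simpa using H _ (by simp [Ctx, h0, h1, h2, hL]; omega) (by simp)
  intro s₁ hc hm₁
  rw [hm] at hm₁
  simp only [wp_seq, wp_const]
  refine ⟨by omega, wp_forN (n := n) (fun i s => Compressed A n k r i s)
    (by decide) ⟨rfl, rfl, rfl⟩ hw.loops (by omega) (by simp [hc]) (by simp [hc]) ?_ ?_ ?_⟩
  · refine ⟨⟨_, ?_, hm₁, fun _ => ⟨by simp, ?_⟩⟩, by simp, by simp⟩
    · rfl
    · intro S hS hconn
      obtain ⟨x, hx⟩ := hconn.nonempty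
      simpa using hS hx
  · intro i hi s₂ hF₂ hi₂ hI
    have hc₂ : Ctx n k r L s₂ := hF₂.ctx rfl (by simp [Ctx, hc])
    refine wp_mono (wp_extendP hw hN (min_le_left _ _) ?_ hi hc₂ hi₂ hI) ?_
    · rcases le_total n ((k + 1) * (r + 3)) with h | h
      · exact Or.inl (by rw [hL, min_eq_left h])
      · exact Or.inr (by rw [hL, min_eq_right h])
    · rintro s₃ ⟨hm₃, hle₃, hno₃⟩
      exact ⟨by simpa using hm₃, by simpa using hle₃, by simpa using hno₃⟩
  · rintro s₂ hF₂ - ⟨⟨m, -, -, hz⟩, hle, hno⟩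
    have hc₂ : Ctx n k r L s₂ := hF₂.ctx rfl (by simp [Ctx, hc])
    simp [hc₂]
    clear hc hc₂
    refine ⟨by omega, hle, fun h => ?_, fun h => ?_⟩
    · obtain ⟨h1, h2⟩ := hz h
      refine ⟨_, h1, h2.mono fun u hu => ?_⟩
      simp only [Finset.mem_sdiff, Finset.mem_filter, Finset.mem_range] at hu ⊢
      exact ⟨hu.1, not_not.1 fun h0 => hu.2 ⟨hu.1, h0⟩⟩
    · by_contra h'
      exact hno (by omega) h

end

/-! ### The running time -/

/-- The nesting depth of the loops with upper register `3`. -/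
def Program.depth : Program → ℕ
  | .seq P Q => max P.depth Q.depth
  | .cond _ _ P Q => max P.depth Q.depth
  | .loop _ b P => P.depth + if b = 3 then 1 else 0
  | _ => 0

set_option maxRecDepth 4000 in
lemma depth_mainP : mainP.depth = 1 := rfl

/-- The running time is polynomial in `n`, apart from the loops with upper register `3`. -/
lemma Program.cost_le (P : Program) : ∃ p : Polynomial ℕ, ∀ n M : ℕ, 1 ≤ M →
    P.cost (fun b => if b = 3 then M else n) ≤ M ^ P.depth * p.eval n := by
  induction P with
  | seq P Q ihP ihQ =>
    obtain ⟨p, hp⟩ := ihP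
    obtain ⟨q, hq⟩ := ihQ
    refine ⟨p + q, fun n M hM => ?_⟩
    rw [cost, depth, Polynomial.eval_add, mul_add]
    exact Nat.add_le_add
      ((hp n M hM).trans (Nat.mul_le_mul_right _ (Nat.pow_le_pow_right hM (le_max_left _ _))))
      ((hq n M hM).trans (Nat.mul_le_mul_right _ (Nat.pow_le_pow_right hM (le_max_right _ _))))
  | cond a b P Q ihP ihQ =>
    obtain ⟨p, hp⟩ := ihP
    obtain ⟨q, hq⟩ := ihQ
    refine ⟨p + q + 1, fun n M hM => ?_⟩
    rw [cost, depth, Polynomial.eval_add, Polynomial.eval_add, mul_add, mul_add]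
    refine Nat.add_le_add (Nat.add_le_add
      ((hp n M hM).trans (Nat.mul_le_mul_right _ (Nat.pow_le_pow_right hM (le_max_left _ _))))
      ((hq n M hM).trans (Nat.mul_le_mul_right _ (Nat.pow_le_pow_right hM (le_max_right _ _))))) ?_
    simpa using Nat.one_le_pow _ _ hM
  | loop a b P ih =>
    obtain ⟨p, hp⟩ := ih
    refine ⟨(Polynomial.X + 1) * (p + 1) + 1, fun n M hM => ?_⟩
    have h := hp n M hM
    have h1 : 1 ≤ M ^ P.depth := Nat.one_le_pow _ _ hM
    rw [cost, depth]
    simp only [Polynomial.eval_add, Polynomial.eval_mul, Polynomial.eval_X, Polynomial.eval_one]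
    set c := P.cost (fun b => if b = 3 then M else n)
    have h2 : c + 1 ≤ M ^ P.depth * (p.eval n + 1) := by rw [mul_add]; omega
    split_ifs
    · have h3 := Nat.mul_le_mul_left M h2
      have h4 : 1 ≤ M ^ (P.depth + 1) := Nat.one_le_pow _ _ hM
      calc M * (c + 1) + 1 ≤ M * (M ^ P.depth * (p.eval n + 1)) + M ^ (P.depth + 1) :=
            Nat.add_le_add h3 h4
        _ = M ^ (P.depth + 1) * ((p.eval n + 1) + 1) := by ring
        _ ≤ _ := Nat.mul_le_mul_left _ (by nlinarith)
    · have h3 := Nat.mul_le_mul_left n h2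
      calc n * (c + 1) + 1 ≤ n * (M ^ P.depth * (p.eval n + 1)) + M ^ P.depth :=
            Nat.add_le_add h3 h1
        _ = M ^ (P.depth + 0) * (n * (p.eval n + 1) + 1) := by ring
        _ ≤ _ := Nat.mul_le_mul_left _ (by nlinarith)
  | _ => exact ⟨1, fun n M hM => by simp [cost, depth]⟩

/-- A form of Bernoulli's inequality. -/
lemma pow_mul_add_le (x y n : ℕ) : x ^ n * (x + n * y) ≤ (x + y) ^ n * x := by
  induction n with
  | zero => simp
  | succ n ih =>
    calc x ^ (n + 1) * (x + (n + 1) * y) ≤ (x + y) * (x ^ n * (x + n * y)) := by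
          have : x * (x + (n + 1) * y) ≤ (x + y) * (x + n * y) := by nlinarith [Nat.zero_le (n * y * y)]
          calc x ^ (n + 1) * (x + (n + 1) * y) = x ^ n * (x * (x + (n + 1) * y)) := by ring
            _ ≤ x ^ n * ((x + y) * (x + n * y)) := Nat.mul_le_mul_left _ this
            _ = _ := by ring
      _ ≤ (x + y) * ((x + y) ^ n * x) := Nat.mul_le_mul_left _ ih
      _ = (x + y) ^ (n + 1) * x := by ring

/-- The bound for the number of sequences of choices, from `(r + 2) ^ (r + 3) ≤ (2 * r + 3) ^ (r + 2)`. -/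
lemma pow_choices_le (n k r : ℕ) :
    (r + 2) ^ min n ((k + 1) * (r + 3)) ≤ (1 + (2 * r + 3) ^ (r + 2)) ^ (k + 1) := by
  have h : (r + 2) ^ (r + 3) ≤ (2 * r + 3) ^ (r + 2) := by
    have := pow_mul_add_le (r + 2) (r + 1) (r + 2)
    refine Nat.le_of_mul_le_mul_right ?_ (show 0 < r + 2 by omega)
    calc (r + 2) ^ (r + 3) * (r + 2) = (r + 2) ^ (r + 2) * (r + 2 + (r + 2) * (r + 1)) := by ring
      _ ≤ (r + 2 + (r + 1)) ^ (r + 2) * (r + 2) := this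
      _ = _ := by rw [show r + 2 + (r + 1) = 2 * r + 3 by ring]
  calc (r + 2) ^ min n ((k + 1) * (r + 3)) ≤ (r + 2) ^ ((r + 3) * (k + 1)) :=
        Nat.pow_le_pow_right (by omega) ((min_le_right _ _).trans_eq (mul_comm _ _))
    _ = ((r + 2) ^ (r + 3)) ^ (k + 1) := pow_mul _ _ _
    _ ≤ _ := Nat.pow_le_pow_left (h.trans (by omega)) _

lemma multiplicity_le {β : Type*} {G : Graph ℕ β} (hfin : G.edgeSet.Finite) (u v : ℕ) :
    multiplicity G u v ≤ G.edgeSet.ncard :=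
  Set.ncard_le_ncard (fun _ he => he.edge_mem) hfin

lemma multiplicity_of_notMem {β : Type*} {G : Graph ℕ β} {u : ℕ} (hu : u ∉ G.vertexSet) (v : ℕ) :
    multiplicity G u v = 0 := by
  have : {e | G.IsLink e u v} = ∅ := Set.eq_empty_of_forall_notMem fun e he => hu he.left_mem
  rw [multiplicity, this, Set.ncard_empty]

/-- Words of `8 * log (n + |E| + k + r + 2)` bits suffice. -/
lemma wide_wordBound {β : Type*} (n k r : ℕ) (G : Graph ℕ β) (hfin : G.edgeSet.Finite)
    (N : ℕ → ℕ) (hN : n ≤ N 0) :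
    Wide (wordBound 8 n k r G) N (multiplicity G) n k r G.edgeSet.ncard ∧
      (k + 1) * (r + 3) < wordBound 8 n k r G := by
  set e := G.edgeSet.ncard with he
  obtain ⟨b, hb⟩ : ∃ b, b = n + e + k + r := ⟨_, rfl⟩
  have hW : wordBound 8 n k r G = (b + 2) ^ 8 := by rw [wordBound, ← he, hb]
  have hnb : n ≤ b := by omega
  have heb : e ≤ b := by omega
  have h1 : n * n ≤ b * b := Nat.mul_le_mul hnb hnb
  have h2 : n * e ≤ b * b := Nat.mul_le_mul hnb heb
  have h3 : n * (n * e + e) ≤ b * (b * b + b) := Nat.mul_le_mul hnb (Nat.add_le_add h2 heb)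
  have h4 : (k + 1) * (r + 3) ≤ (b + 1) * (b + 3) :=
    Nat.mul_le_mul (by omega) (by omega)
  have h5 : b * (b * b + b) + 12 * (b * b) + 16 * b + 16 ≤ (b + 2) ^ 8 := by
    ring_nf
    have := Nat.zero_le (b ^ 2)
    omega
  rw [hW]
  refine ⟨⟨hN, multiplicity_comm G, multiplicity_le hfin, ?_, ?_, ?_, ?_⟩, ?_⟩ <;> nlinarith

lemma inputState_mem {β : Type*} {n k r : ℕ} {G : Graph ℕ β} (hV : G.vertexSet = Set.Iio n) :
    (inputState n k r G).mem = layout n (multiplicity G)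
      ⟨fun _ => 0, fun _ => 0, fun _ => 0, fun _ => 0, fun _ => 0⟩ := by
  funext a
  rw [layout]
  by_cases ha : a < n * n
  · rw [if_pos ha]; rfl
  · rw [if_neg ha]
    have : a / n ∉ G.vertexSet := by
      rw [hV, Set.mem_Iio, not_lt]
      rcases Nat.eq_zero_or_pos n with rfl | hn
      · exact Nat.zero_le _
      · exact (Nat.le_div_iff_mul_le hn).2 (not_lt.1 ha)
    exact (multiplicity_of_notMem this (a % n)).trans (by split_ifs <;> rfl)

end PseudoforestDeletion

open PseudoforestDeletion in
theorem mainTheorem1 :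
    ∃ (P : Program) (c : ℕ) (p : Polynomial ℕ),
      ∀ (r k n : ℕ) (β : Type) (G : Graph ℕ β),
        G.vertexSet = Set.Iio n → G.edgeSet.Finite →
        ∃ (t : ℕ) (s : State),
          Exec (wordBound c n k r G) P (inputState n k r G) t s ∧
          t ≤ (1 + (2 * r + 3) ^ (r + 2)) ^ (k + 1) * p.eval n ∧
          (HasSolution r k G → s.reg 0 = 1) ∧
          (¬ HasSolution r k G → s.reg 0 = 0) := by
  obtain ⟨p, hp⟩ := mainP.cost_le
  refine ⟨mainP, 8, p, fun r k n β G hV hfin => ?_⟩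
  have hM := pow_choices_le n k r
  set M := (r + 2) ^ min n ((k + 1) * (r + 3))
  obtain ⟨hw, hkr⟩ := wide_wordBound n k r G hfin (fun b => if b = 3 then M else n) le_rfl
  obtain ⟨t, s, hs, ht, hle, hiff⟩ := exec_of_wp (wp_mainP hw hkr le_rfl
    (s := inputState n k r G) rfl rfl rfl (inputState_mem hV))
  have hcost := hp n M (Nat.one_le_pow _ _ (by omega))
  rw [depth_mainP, pow_one] at hcost
  rw [← hasSolution_iff hV hfin] at hiff
  exact ⟨t, s, hs, ht.trans (hcost.trans (Nat.mul_le_mul_right _ hM)), hiff.2,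
    fun h => by have := mt hiff.1 h; omega⟩
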